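/- Let $d\ge 1$ be an integer and let $f_0:[0,\infty)\to\mathbb{C}$ belong to $C_0[0,\infty)$, i.e. $f_0$ is continuous and $f_0(t)\to 0$ as $t\to+\infty$. Suppose that $f_0$ is $d-1$ times differentiable on $(0,\infty)$ and that $f_0^{(d-1)}$ is absolutely continuous on every segment $[a,b]\subset(0,\infty)$ (so that $f_0^{(d)}$ exists almost everywhere on $(0,\infty)$). For $x\in\mathbb{R}^d$ put $|x|_{p,d}=\big(\sum_{j=1}^d|x_j|^p\big)^{1/p}$ if $0<p<\infty$ and $|x|_{\infty,d}=\max_{1\le j\le d}|x_j|$. Let $A(\mathbb{R}^d)$ be the set of all functions $f$ on $\mathbb{R}^d$ of the form $f(x)=\int_{\mathbb{R}^d}g(y)e^{-i(x,y)}\,dy$ for all $x\in\mathbb{R}^d$, with $g\in L_1(\mathbb{R}^d)$ and $(x,y)=\sum_{j=1}^d x_jy_j$. Consider the conditions А. $\displaystyle\int_0^\infty t^{d-1}\,\operatorname*{ess\,sup}_{u\ge t}\big|f_0^{(d)}(u)\big|\,dt<\infty$; Б (for a given $p\in(0,1)$). $\displaystyle\int_0^\infty t^{dp-1}\,\operatorname*{ess\,sup}_{u\ge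 t}\,u^{d(1-p)}\big|f_0^{(d)}(u)\big|\,dt<\infty$; В. There are $a>0$, $\varepsilon>0$ and a real number $\delta>1-\frac{2\varepsilon}{d}$ such that $f_0(t)=0$ for $t\in[0,a]$ and, for each integer $\nu$ with $0\le\nu\le d$, there is a constant $C$ such that $|f_0^{(\nu)}(t)|\le C\,t^{-\varepsilon-\nu\delta}$ for all $t>0$ (for almost all $t>0$ if $\nu=d$). If condition А or condition В holds, then $f_0(|x|_{p,d})\in A(\mathbb{R}^d)$ for every $p\in[1,\infty]$. If $p\in(0,1)$ and condition Б holds for this $p$, then $f_0(|x|_{p,d})\in A(\mathbb{R}^d)$. -/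

import Mathlib

open MeasureTheory Set Filter Topology
open scoped ENNReal

/-- The Wiener algebra `A(ℝ^d)`: all functions of the form
`f x = ∫ g(y) e^{-i (x, y)} dy` (for every `x`) with `g` integrable on `ℝ^d`. -/
def WienerAlgebra (d : ℕ) : Set (EuclideanSpace ℝ (Fin d) → ℂ) :=
  {f | ∃ g : EuclideanSpace ℝ (Fin d) → ℂ, Integrable g ∧
    ∀ x, f x = ∫ y, g y * Complex.exp (-Complex.I * ((inner ℝ x y : ℝ) : ℂ))}

/-- `|x|_{p,d}` for `p ∈ (0, ∞]`, as the (quasi-)norm of `PiLp`. -/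
noncomputable def pAbs {d : ℕ} (p : ℝ≥0∞) (x : EuclideanSpace ℝ (Fin d)) : ℝ :=
  ‖(WithLp.toLp p (fun j => x j) : PiLp p (fun _ : Fin d => ℝ))‖

theorem pAbs_top {d : ℕ} (x : EuclideanSpace ℝ (Fin d)) :
    pAbs ∞ x = ⨆ j, |x j| := rfl

theorem pAbs_ofReal {d : ℕ} {p : ℝ} (hp : 0 < p) (x : EuclideanSpace ℝ (Fin d)) :
    pAbs (ENNReal.ofReal p) x = (∑ j, |x j| ^ p) ^ (1 / p) := by
  have h : (ENNReal.ofReal p).toReal = p := ENNReal.toReal_ofReal hp.le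
  unfold pAbs
  rw [PiLp.norm_eq_sum (by rw [h]; exact hp)]
  simp [h, Real.norm_eq_abs]

/-- `f₀ ∈ C₀[0, ∞)`: continuous on `[0, ∞)` and tending to `0` at infinity.
The values of `f₀` on `(-∞, 0)` play no role. -/
def IsC0HalfLine (f₀ : ℝ → ℂ) : Prop :=
  ContinuousOn f₀ (Ici 0) ∧ Tendsto f₀ atTop (𝓝 0)

/-- `f₀^{(m)}` exists on `(0, ∞)` and is absolutely continuous on every `[a, b] ⊂ (0, ∞)`. -/
def HasLocACDeriv (m : ℕ) (f₀ : ℝ → ℂ) : Prop :=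
  ContDiffOn ℝ m f₀ (Ioi 0) ∧
    ∀ a b : ℝ, 0 < a → a ≤ b → AbsolutelyContinuousOnInterval (iteratedDeriv m f₀) a b

/-- Condition А: `∫_0^∞ t^{d-1} ess sup_{u ≥ t} |f₀^{(d)}(u)| dt < ∞`. -/
def ConditionA (d : ℕ) (f₀ : ℝ → ℂ) : Prop :=
  ∫⁻ t in Ioi (0 : ℝ), ENNReal.ofReal (t ^ ((d : ℝ) - 1)) *
    essSup (fun u => ‖iteratedDeriv d f₀ u‖ₑ) (volume.restrict (Ici t)) < ∞

/-- Condition Б: `∫_0^∞ t^{dp-1} ess sup_{u ≥ t} u^{d(1-p)} |f₀^{(d)}(u)| dt < ∞`. -/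
def ConditionB (d : ℕ) (p : ℝ) (f₀ : ℝ → ℂ) : Prop :=
  ∫⁻ t in Ioi (0 : ℝ), ENNReal.ofReal (t ^ ((d : ℝ) * p - 1)) *
    essSup (fun u => ENNReal.ofReal (u ^ ((d : ℝ) * (1 - p))) * ‖iteratedDeriv d f₀ u‖ₑ)
      (volume.restrict (Ici t)) < ∞

/-- Condition В: `f₀ = 0` on some `[0, a]`, `a > 0`, and, for some `ε > 0` and
`δ > 1 - 2ε/d`, `f₀^{(ν)}(t) = O(t^{-ε-νδ})` on `t > 0` for `0 ≤ ν ≤ d`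
(for `ν = d`, where the derivative exists only almost everywhere, for almost every `t`). -/
def ConditionV (d : ℕ) (f₀ : ℝ → ℂ) : Prop :=
  ∃ a > (0 : ℝ), ∃ ε > (0 : ℝ), ∃ δ > 1 - 2 * ε / (d : ℝ),
    (∀ t ∈ Icc 0 a, f₀ t = 0) ∧
    (∀ ν < d, ∃ C : ℝ, ∀ t > (0 : ℝ), ‖iteratedDeriv ν f₀ t‖ ≤ C * t ^ (-(ε + ν * δ))) ∧
    (∃ C : ℝ, ∀ᵐ t ∂(volume.restrict (Ioi (0 : ℝ))),
      ‖iteratedDeriv d f₀ t‖ ≤ C * t ^ (-(ε + d * δ)))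

/-! Put E(s) = f₀(s^{1/p}), so that f₀(|x|_p) = E(∑|x_i|^p). When E and its derivatives of order
below d vanish at infinity, integrating d times from infinity gives E(∑|x_i|^p) = (-1)^d ∫_{w_i >
|x_i|^p} E^{(d)}(∑ w_i) dw. Since w_i > |x_i|^p means |x_i| < w_i^{1/p}, the function is a
superposition of indicators of boxes centred at the origin. For p = ∞ a single integration suffices:
f₀(max|x_i|) is a superposition of cubes with density -f₀'. Both are instances of `boxIntegral`.

The core estimate is `exists_hasWienerNorm_boxIntegral`, for bounded boxes and a density of size at
most B. Take a mixed difference with step h_i in each coordinate. It is O(B ∏ min(h_i,1)^η)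
pointwise, because only boxes with edges in prescribed intervals contribute, and O(B ∏ min(h_i,1))
in L¹; hence its squared L² norm is O(B² ∏ min(h_i,1)^{1+η}). By Plancherel, integration over h
against a power weight bounds ∫|F̂|² W, with W the product of |ξ_i|^{1+β} + |ξ_i|^{1/2} up to
constants. Hölder's inequality then puts F̂ in L¹, with norm O(A^{1-θ} B^θ), where A bounds the
superposition itself and θ(1+η) > 1.

Conditions А and Б. Each bounds f₀^{(d)} on dyadic intervals by M_k with ∑ 2^{kd} M_k < ∞
(`ConditionB.exists_lacunary`). Such bounds descend to lower derivatives
(`IsACJet.tendsto_and_lacunaryBound`) and survive the substitution s^{1/p} (`LacunaryBound.powJet`).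
Cut E^{(d)} into pieces on [ρ^k, ρ^{k+1}), ρ = 2^p. The Wiener norm is dilation invariant, so the
core estimate with θ = 1 bounds each piece by its sup times ρ^{kd}, and the series converges.

Condition В. There is no absolute summability at θ = 1, so E itself is cut by a smooth dyadic
partition of unity (`mem_wienerAlgebra_of_growth`). At scale r the piece has size r^{-κ} and, after
rescaling, top derivative of size r^{-κ+dσ}, with κ = ε/p and σ = (1-δ)/p. Its norm is
O(r^{-κ+θdσ}). For p ≥ 1 one has η = 1, so any θ > 1/2 is admissible, and summability for some such
θ amounts to dσ < 2κ, that is, δ > 1 - 2ε/d. -/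

open scoped FourierTransform SchwartzMap

/-! ### Plancherel for the Fourier integral -/

section Plancherel

variable {V : Type*} [NormedAddCommGroup V] [InnerProductSpace ℝ V] [FiniteDimensional ℝ V]
  [MeasurableSpace V] [BorelSpace V]

/-- On `L¹ ∩ L²` the Fourier integral agrees almost everywhere with the `L²` Fourier transform. -/
theorem fourier_ae_eq_Lp_fourier {f : V → ℂ} (h1 : Integrable f) (h2 : MemLp f 2) :
    (𝓕 (h2.toLp f) : Lp ℂ 2 (volume : Measure V)) =ᵐ[volume] 𝓕 f := by
  apply ae_eq_of_integral_contDiff_smul_eq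
  · exact (Lp.memLp _).locallyIntegrable (by norm_num)
  · have : Continuous (𝓕 f) := VectorFourier.fourierIntegral_continuous
      Real.continuous_fourierChar (by exact continuous_inner) h1
    exact this.locallyIntegrable
  · intro g hg hgs
    have hgs' : HasCompactSupport (fun x => (g x : ℂ)) :=
      hgs.comp_left (g := fun x : ℝ => (x : ℂ)) (by simp)
    have hg' : ContDiff ℝ ((⊤ : ℕ∞) : WithTop ℕ∞) (fun x => (g x : ℂ)) :=
      Complex.ofRealCLM.contDiff.comp hg
    set G : 𝓢(V, ℂ) := hgs'.toSchwartzMap hg' with hG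
    have hGg : ∀ x, G x = (g x : ℂ) := fun x => rfl
    -- Tested against a Schwartz function, the L² transform acts by duality; the multiplication
    -- formula says the same for the Fourier integral.
    have key := congrArg (fun T => T G)
      (Lp.fourier_toTemperedDistribution_eq (E := V) (F := ℂ) (h2.toLp f))
    simp only [TemperedDistribution.fourier_apply, Lp.toTemperedDistribution_apply] at key
    have e1 : ∫ x, (𝓕 G) x • (h2.toLp f) x = ∫ x, (𝓕 (fun y => G y)) x • f x := by
      apply integral_congr_ae
      filter_upwards [h2.coeFn_toLp] with x hx
      rw [hx]; rfl
    have e2 : ∫ x, (𝓕 (fun y => G y)) x • f x = ∫ x, G x • 𝓕 f x := by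
      have := VectorFourier.integral_fourierIntegral_smul_eq_flip (𝕜 := ℝ) (L := innerₗ V)
        (μ := volume) (ν := volume) Real.continuous_fourierChar (by exact continuous_inner)
        (f := fun y => G y) (g := f) (G.integrable (μ := volume)) h1
      rw [flip_innerₗ] at this
      exact this
    calc ∫ x, g x • (𝓕 (h2.toLp f) : Lp ℂ 2 (volume : Measure V)) x
        = ∫ x, G x • (𝓕 (h2.toLp f) : Lp ℂ 2 (volume : Measure V)) x := by simp [hGg]
      _ = ∫ x, G x • 𝓕 f x := by rw [← key, e1, e2]
      _ = ∫ x, g x • 𝓕 f x := by simp [hGg]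

/-- Plancherel's theorem for the Fourier integral on `L¹ ∩ L²`. -/
theorem lintegral_enorm_fourier_sq {f : V → ℂ} (h1 : Integrable f) (h2 : MemLp f 2) :
    ∫⁻ ξ, ‖𝓕 f ξ‖ₑ ^ 2 = ∫⁻ x, ‖f x‖ₑ ^ 2 := by
  have e : eLpNorm (𝓕 f) 2 volume = eLpNorm f 2 volume := by
    rw [← eLpNorm_congr_ae (fourier_ae_eq_Lp_fourier h1 h2), ← eLpNorm_congr_ae h2.coeFn_toLp,
      ← Lp.enorm_def, ← Lp.enorm_def, ← ofReal_norm, ← ofReal_norm,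
      Lp.norm_fourier_eq]
  have h := fun u : V → ℂ => eLpNorm_nnreal_pow_eq_lintegral (f := u) (μ := volume) (p := 2)
    (by norm_num)
  have h' := h (𝓕 f)
  have h'' := h f
  simp only [ENNReal.coe_ofNat, NNReal.coe_ofNat, ENNReal.rpow_ofNat] at h' h''
  rw [← h', ← h'', e]

end Plancherel

/-! ### Integrals of products of one-variable functions -/

theorem lintegral_fin_prod_eq_prod {n : ℕ} (f : Fin n → ℝ → ℝ≥0∞) (hf : ∀ i, Measurable (f i)) :
    ∫⁻ x : Fin n → ℝ, ∏ i, f i (x i) = ∏ i, ∫⁻ t, f i t := by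
  induction n with
  | zero => simp [volume_pi]
  | succ n ih =>
    have := (volume_preserving_piFinSuccAbove (fun _ : Fin (n + 1) => ℝ) 0).symm
    rw [← this.lintegral_comp_emb (MeasurableEquiv.measurableEmbedding _)]
    simp only [Fin.prod_univ_succ, MeasurableEquiv.piFinSuccAbove_symm_apply, Fin.insertNthEquiv,
      Fin.insertNth_zero', Equiv.coe_fn_mk, Fin.cons_zero, Fin.cons_succ]
    rw [Measure.volume_eq_prod, lintegral_prod_mul (f := f 0)
      (g := fun x : Fin n → ℝ => ∏ i, f i.succ (x i)) (hf 0).aemeasurable]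
    · rw [ih (fun i => f i.succ) (fun i => hf _)]
    · exact (Finset.measurable_prod _ fun i _ => (hf _).comp (measurable_pi_apply i)).aemeasurable

theorem lintegral_euclidean_prod_eq_prod {n : ℕ} (f : Fin n → ℝ → ℝ≥0∞)
    (hf : ∀ i, Measurable (f i)) :
    ∫⁻ x : EuclideanSpace ℝ (Fin n), ∏ i, f i (x i) = ∏ i, ∫⁻ t, f i t := by
  rw [← lintegral_fin_prod_eq_prod f hf,
    ← (PiLp.volume_preserving_toLp (Fin n)).lintegral_comp_emb
      (MeasurableEquiv.toLp 2 (Fin n → ℝ)).measurableEmbedding]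

/-! ### The Wiener norm: dilations, series, Fourier inversion -/

/-- `F` has a Wiener representation whose density has `L¹` norm at most `a`. -/
def HasWienerNorm {d : ℕ} (F : EuclideanSpace ℝ (Fin d) → ℂ) (a : ℝ) : Prop :=
  ∃ g : EuclideanSpace ℝ (Fin d) → ℂ, Integrable g ∧ ∫ y, ‖g y‖ ≤ a ∧
    ∀ x, F x = ∫ y, g y * Complex.exp (-Complex.I * ((inner ℝ x y : ℝ) : ℂ))

namespace HasWienerNorm

variable {d : ℕ} {F : EuclideanSpace ℝ (Fin d) → ℂ} {a : ℝ}

theorem mem_wienerAlgebra (h : HasWienerNorm F a) : F ∈ WienerAlgebra d := by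
  obtain ⟨g, hg, -, hF⟩ := h
  exact ⟨g, hg, hF⟩

theorem mono {b : ℝ} (h : HasWienerNorm F a) (hab : a ≤ b) : HasWienerNorm F b := by
  obtain ⟨g, hg, hga, hF⟩ := h
  exact ⟨g, hg, hga.trans hab, hF⟩

theorem norm_exp_inner (x y : EuclideanSpace ℝ (Fin d)) :
    ‖Complex.exp (-Complex.I * ((inner ℝ x y : ℝ) : ℂ))‖ = 1 := by
  rw [Complex.norm_exp]; simp

/-- A change of variables in the density produces exactly its Jacobian, so the L¹ norm is dilation
invariant. This reduces every dyadic piece to unit scale. -/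
theorem comp_smul (h : HasWienerNorm F a) {r : ℝ} (hr : r ≠ 0) :
    HasWienerNorm (fun x => F (r • x)) a := by
  obtain ⟨g, hg, hga, hF⟩ := h
  have hs : |r⁻¹ ^ d| ≠ 0 := by positivity
  have key : ∀ {E : Type} [NormedAddCommGroup E] [NormedSpace ℝ E]
      (u : EuclideanSpace ℝ (Fin d) → E), |r⁻¹ ^ d| • ∫ y, u (r⁻¹ • y) = ∫ y, u y := by
    intro E _ _ u
    rw [Measure.integral_comp_smul, finrank_euclideanSpace_fin, smul_smul, abs_inv,
      mul_inv_cancel₀ hs, one_smul]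
  refine ⟨fun y => |r⁻¹ ^ d| • g (r⁻¹ • y), ?_, ?_, fun x => ?_⟩
  · exact (hg.comp_smul (inv_ne_zero hr)).smul |r⁻¹ ^ d|
  · simp only [norm_smul, Real.norm_eq_abs, abs_abs]
    rw [integral_const_mul, ← smul_eq_mul, key (fun y => ‖g y‖)]
    exact hga
  · simp only [hF]
    rw [← key]
    rw [← integral_smul]
    congr 1 with y
    rw [smul_mul_assoc]
    congr 2
    rw [inner_smul_left, inner_smul_right]
    simp [hr]

/-- A pointwise convergent series of functions with summable Wiener norms lies in the algebra. -/
theorem mem_wienerAlgebra_of_hasSum {ι : Type*} [Countable ι]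
    {f : ι → EuclideanSpace ℝ (Fin d) → ℂ} {b : ι → ℝ}
    (hf : ∀ k, HasWienerNorm (f k) (b k)) (hb : Summable b)
    (hF : ∀ x, HasSum (fun k => f k x) (F x)) : F ∈ WienerAlgebra d := by
  choose g hg hga hfg using hf
  have hs : Summable fun k => ∫ y, ‖g k y‖ :=
    hb.of_nonneg_of_le (fun k => integral_nonneg fun y => norm_nonneg _) hga
  have hs1 : ∑' k, ‖(hg k).toL1 (g k)‖ₑ ≠ ∞ := by
    have h0 : ∀ k, ‖(hg k).toL1 (g k)‖ = ∫ y, ‖g k y‖ := fun k => by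
      rw [L1.norm_eq_integral_norm]
      exact integral_congr_ae ((hg k).coeFn_toL1.mono fun y hy => by simp only [hy])
    rw [tsum_enorm_ne_top_iff_summable_norm]
    simpa only [h0] using hs
  -- The L¹ sum of the densities agrees almost everywhere with their pointwise sum.
  have hL : ⇑(∑' k, (hg k).toL1 (g k)) =ᵐ[volume] fun y => ∑' k, g k y := by
    have h2 : ∀ᵐ y, ∀ k, (hg k).toL1 (g k) y = g k y := ae_all_iff.2 fun k => (hg k).coeFn_toL1
    filter_upwards [Lp.hasSum_coeFn_tsum hs1, h2] with y hy hy2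
    simp only [hy2] at hy
    exact hy.tsum_eq.symm
  refine ⟨fun y => ∑' k, g k y, (integrable_congr hL).1 (L1.integrable_coeFn _), fun x => ?_⟩
  have hi : ∀ k, Integrable fun y =>
      g k y * Complex.exp (-Complex.I * ((inner ℝ x y : ℝ) : ℂ)) := fun k =>
    (hg k).mul_bdd (c := 1) (by fun_prop) (ae_of_all _ fun y => (norm_exp_inner x y).le)
  have h1 := hasSum_integral_of_summable_integral_norm hi
    (by simpa only [norm_mul, norm_exp_inner, mul_one] using hs)
  simp only [tsum_mul_right] at h1
  refine (hF x).unique ?_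
  simpa only [hfg] using h1

/-- Fourier inversion, after a rescaling of the frequency variable to the kernel without 2π. -/
theorem of_fourier (hc : Continuous F) (hi : Integrable F) (ha : 0 ≤ a)
    (h : ∫⁻ ξ, ‖𝓕 F ξ‖ₑ ≤ ENNReal.ofReal a) : HasWienerNorm F a := by
  have hcont : Continuous (𝓕 F) := VectorFourier.fourierIntegral_continuous
      Real.continuous_fourierChar (by exact continuous_inner) hi
  have hint : Integrable (𝓕 F) := ⟨hcont.aestronglyMeasurable, h.trans_lt ENNReal.ofReal_lt_top⟩
  have hπ : (-(2 * Real.pi)⁻¹ : ℝ) ≠ 0 := by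
    have := Real.pi_pos; simp [this.ne']
  -- The substitution ξ = ry turns the kernel e^{2πi(x,ξ)} of the inversion formula into
  -- e^{-i(x,y)}.
  set r : ℝ := -(2 * Real.pi)⁻¹ with hr
  have hs : |r ^ d| ≠ 0 := by positivity
  have key : ∀ {E : Type} [NormedAddCommGroup E] [NormedSpace ℝ E]
      (u : EuclideanSpace ℝ (Fin d) → E), |r ^ d| • ∫ y, u (r • y) = ∫ y, u y := by
    intro E _ _ u
    rw [Measure.integral_comp_smul, finrank_euclideanSpace_fin, smul_smul, abs_inv,
      mul_inv_cancel₀ hs, one_smul]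
  refine ⟨fun y => |r ^ d| • 𝓕 F (r • y), ?_, ?_, fun x => ?_⟩
  · exact (hint.comp_smul hπ).smul |r ^ d|
  · simp only [norm_smul, Real.norm_eq_abs, abs_abs]
    rw [integral_const_mul, ← smul_eq_mul, key (fun y => ‖𝓕 F y‖),
      integral_norm_eq_lintegral_enorm hcont.aestronglyMeasurable]
    exact ENNReal.toReal_le_of_le_ofReal ha h
  · conv_lhs => rw [← hc.fourierInv_fourier_eq hi hint]
    rw [Real.fourierInv_eq', ← key]
    rw [← integral_smul]
    congr 1 with y
    rw [smul_mul_assoc, smul_eq_mul, mul_comm]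
    congr 3
    rw [inner_smul_left, real_inner_comm, hr]
    have : (Real.pi : ℂ) ≠ 0 := by exact_mod_cast Real.pi_ne_zero
    push_cast
    simp
    field_simp

end HasWienerNorm

/-! ### Superpositions of boxes and their mixed differences -/

/-- The indicator of `|t| < z`. -/
noncomputable def cut (t z : ℝ) : ℂ := if |t| < z then 1 else 0

theorem norm_cut_le_one (t z : ℝ) : ‖cut t z‖ ≤ 1 := by
  unfold cut; split_ifs <;> simp

theorem measurable_cut : Measurable fun q : ℝ × ℝ => cut q.1 q.2 :=
  Measurable.ite (measurableSet_lt (by fun_prop) (by fun_prop)) measurable_const measurable_const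

theorem Measurable.cut {α : Type*} [MeasurableSpace α] {f g : α → ℝ} (hf : Measurable f)
    (hg : Measurable g) : Measurable fun a => cut (f a) (g a) :=
  measurable_cut.comp (hf.prodMk hg)

/-- A superposition of indicators of coordinate boxes centred at the origin. -/
noncomputable def boxIntegral {d : ℕ} {Ω : Type*} [MeasurableSpace Ω] (ν : Measure Ω)
    (Z : Ω → Fin d → ℝ) (ψ : Ω → ℂ) (x : EuclideanSpace ℝ (Fin d)) : ℂ :=
  ∫ ω, (∏ i, cut (x i) (Z ω i)) * ψ ω ∂ν

/-- The mixed difference of `boxIntegral` with steps `h`. -/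
noncomputable def boxDiff {d : ℕ} {Ω : Type*} [MeasurableSpace Ω] (ν : Measure Ω)
    (Z : Ω → Fin d → ℝ) (ψ : Ω → ℂ) (h : Fin d → ℝ) (x : EuclideanSpace ℝ (Fin d)) : ℂ :=
  ∫ ω, (∏ i, (cut (x i + h i) (Z ω i) - cut (x i) (Z ω i))) * ψ ω ∂ν

section BoxIntegral

variable {d : ℕ} {Ω : Type*} [MeasurableSpace Ω] {ν : Measure Ω} [IsFiniteMeasure ν]
  {Z : Ω → Fin d → ℝ} {ψ : Ω → ℂ} {R B A : ℝ}

theorem measurable_prod_cut (hZ : Measurable Z) :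
    Measurable fun q : EuclideanSpace ℝ (Fin d) × Ω => ∏ i, cut (q.1 i) (Z q.2 i) :=
  Finset.measurable_fun_prod _ fun i _ => Measurable.cut (by fun_prop) (by fun_prop)

theorem norm_prod_cut_le_one (x z : Fin d → ℝ) : ‖∏ i, cut (x i) (z i)‖ ≤ 1 := by
  rw [norm_prod]
  exact Finset.prod_le_one (fun _ _ => norm_nonneg _) fun _ _ => norm_cut_le_one _ _

theorem integrable_of_bound (hψ : Measurable ψ) (hB : ∀ ω, ‖ψ ω‖ ≤ B) : Integrable ψ ν :=
  Integrable.of_bound hψ.aestronglyMeasurable B (ae_of_all _ hB)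

theorem integrable_prod_cut_mul (hZ : Measurable Z) (hψ : Measurable ψ) (hB : ∀ ω, ‖ψ ω‖ ≤ B)
    (x : EuclideanSpace ℝ (Fin d)) :
    Integrable (fun ω => (∏ i, cut (x i) (Z ω i)) * ψ ω) ν :=
  (integrable_of_bound hψ hB).bdd_mul (c := 1)
    ((measurable_prod_cut hZ).comp measurable_prodMk_left).aestronglyMeasurable
    (ae_of_all _ fun _ => norm_prod_cut_le_one _ _)

/-- The product of differences is expanded over the sets t of coordinates left unshifted. A signed
sum of translates of one function inherits its integrability and has a computable Fourier transform.
-/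
theorem boxDiff_eq_sum (hZ : Measurable Z) (hψ : Measurable ψ) (hB : ∀ ω, ‖ψ ω‖ ≤ B)
    (h : Fin d → ℝ) (x : EuclideanSpace ℝ (Fin d)) :
    boxDiff ν Z ψ h x = ∑ t ∈ (Finset.univ : Finset (Fin d)).powerset,
      (-1) ^ t.card * boxIntegral ν Z ψ (x + WithLp.toLp 2 fun i => if i ∈ t then 0 else h i) := by
  unfold boxDiff boxIntegral
  simp_rw [← integral_const_mul]
  rw [← integral_finsetSum]
  · congr 1 with ω
    rw [Finset.prod_sub, Finset.sum_mul]
    refine Finset.sum_congr rfl fun t ht => ?_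
    rw [mul_assoc, mul_assoc, ← mul_assoc (∏ i ∈ _, _)]
    congr 2
    rw [← Finset.prod_sdiff (Finset.subset_univ t)]
    congr 1
    · refine Finset.prod_congr rfl fun i hi => ?_
      have : i ∉ t := (Finset.mem_sdiff.1 hi).2
      simp [this]
    · refine Finset.prod_congr rfl fun i hi => ?_
      simp [hi]
  · intro t _
    exact (integrable_prod_cut_mul hZ hψ hB _).const_mul _

theorem measurable_boxIntegral (hZ : Measurable Z) (hψ : Measurable ψ) :
    StronglyMeasurable (boxIntegral ν Z ψ) :=
  StronglyMeasurable.integral_prod_right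
    ((measurable_prod_cut hZ).mul (hψ.comp measurable_snd)).stronglyMeasurable

/-- The cube of half-width `R`. -/
def cube (d : ℕ) (R : ℝ) : Set (EuclideanSpace ℝ (Fin d)) :=
  WithLp.ofLp ⁻¹' Icc (fun _ => -R) (fun _ => R)

theorem measurableSet_cube (d : ℕ) (R : ℝ) : MeasurableSet (cube d R) :=
  (PiLp.volume_preserving_ofLp (Fin d)).measurable measurableSet_Icc

theorem volume_cube_lt_top (d : ℕ) (R : ℝ) : volume (cube d R) < ∞ := by
  unfold cube
  rw [(PiLp.volume_preserving_ofLp (Fin d)).measure_preimage measurableSet_Icc.nullMeasurableSet]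
  exact isCompact_Icc.measure_lt_top

theorem boxIntegral_eq_zero (hR : ∀ ω i, Z ω i ≤ R) {x : EuclideanSpace ℝ (Fin d)}
    (hx : x ∉ cube d R) : boxIntegral ν Z ψ x = 0 := by
  have : ∃ i, R < |x i| := by
    by_contra! hc
    exact hx ⟨fun i => (abs_le.1 (hc i)).1, fun i => (abs_le.1 (hc i)).2⟩
  obtain ⟨i, hi⟩ := this
  unfold boxIntegral
  rw [← integral_zero Ω ℂ]
  congr 1 with ω
  rw [Finset.prod_eq_zero (Finset.mem_univ i), zero_mul]
  simp [cut, (hR ω i).trans hi.le]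

theorem memLp_boxIntegral (hZ : Measurable Z) (hψ : Measurable ψ) (hR : ∀ ω i, Z ω i ≤ R)
    (hA : ∀ x, ‖boxIntegral ν Z ψ x‖ ≤ A) (p : ℝ≥0∞) : MemLp (boxIntegral ν Z ψ) p := by
  have h0 : boxIntegral ν Z ψ = (cube d R).indicator (boxIntegral ν Z ψ) := by
    ext x
    by_cases hx : x ∈ cube d R
    · rw [indicator_of_mem hx]
    · rw [indicator_of_notMem hx, boxIntegral_eq_zero hR hx]
  have : IsFiniteMeasure ((volume : Measure (EuclideanSpace ℝ (Fin d))).restrict (cube d R)) :=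
    ⟨by simpa using volume_cube_lt_top d R⟩
  rw [h0, memLp_indicator_iff_restrict (measurableSet_cube d R)]
  exact MemLp.of_bound (measurable_boxIntegral hZ hψ).aestronglyMeasurable A (ae_of_all _ hA)

theorem lintegral_boxIntegral_sq_le (hR : ∀ ω i, Z ω i ≤ R)
    (hA : ∀ x, ‖boxIntegral ν Z ψ x‖ ≤ A) :
    ∫⁻ x, ‖boxIntegral ν Z ψ x‖ₑ ^ 2 ≤ ENNReal.ofReal A ^ 2 * volume (cube d R) := by
  calc ∫⁻ x, ‖boxIntegral ν Z ψ x‖ₑ ^ 2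
      ≤ ∫⁻ x, (cube d R).indicator (fun _ => ENNReal.ofReal A ^ 2) x := by
        refine lintegral_mono fun x => ?_
        by_cases hx : x ∈ cube d R
        · rw [indicator_of_mem hx]
          gcongr
          rw [← ofReal_norm]
          exact ENNReal.ofReal_le_ofReal (hA x)
        · rw [boxIntegral_eq_zero hR hx]; simp
    _ = _ := by rw [lintegral_indicator_const (measurableSet_cube d R)]

theorem memLp_boxDiff (hZ : Measurable Z) (hψ : Measurable ψ) (hR : ∀ ω i, Z ω i ≤ R)
    (hB : ∀ ω, ‖ψ ω‖ ≤ B) (hA : ∀ x, ‖boxIntegral ν Z ψ x‖ ≤ A) (h : Fin d → ℝ) (p : ℝ≥0∞) :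
    MemLp (boxDiff ν Z ψ h) p := by
  rw [funext (boxDiff_eq_sum hZ hψ hB h)]
  refine memLp_finsetSum _ fun t _ => MemLp.const_mul ?_ _
  exact (memLp_boxIntegral hZ hψ hR hA p).comp_measurePreserving (measurePreserving_add_right _ _)

theorem fourierChar_sum {ι : Type*} (s : Finset ι) (a : ι → ℝ) :
    (Real.fourierChar (∑ i ∈ s, a i) : ℂ) = ∏ i ∈ s, (Real.fourierChar (a i) : ℂ) := by
  simp only [Real.fourierChar_apply]
  rw [← Complex.exp_sum, Finset.mul_sum]
  push_cast
  rw [Finset.sum_mul]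

/-- Each translation multiplies the transform by a character, and the signed sum over subsets folds
back into a product. -/
theorem fourier_boxDiff (hZ : Measurable Z) (hψ : Measurable ψ) (hR : ∀ ω i, Z ω i ≤ R)
    (hB : ∀ ω, ‖ψ ω‖ ≤ B) (hA : ∀ x, ‖boxIntegral ν Z ψ x‖ ≤ A) (h : Fin d → ℝ)
    (ξ : EuclideanSpace ℝ (Fin d)) :
    𝓕 (boxDiff ν Z ψ h) ξ =
      (∏ i, ((Real.fourierChar (h i * ξ i) : ℂ) - 1)) * 𝓕 (boxIntegral ν Z ψ) ξ := by
  have hi := memLp_one_iff_integrable.1 (memLp_boxIntegral (ν := ν) hZ hψ hR hA 1)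
  have htr : ∀ v : EuclideanSpace ℝ (Fin d),
      𝓕 (fun x => boxIntegral ν Z ψ (x + v)) ξ =
        (Real.fourierChar (inner ℝ v ξ) : ℂ) * 𝓕 (boxIntegral ν Z ψ) ξ := fun v => by
    have := congrFun (VectorFourier.fourierIntegral_comp_add_right Real.fourierChar volume
      (innerₗ (EuclideanSpace ℝ (Fin d))) (boxIntegral ν Z ψ) v) ξ
    exact this
  have hsum : 𝓕 (boxDiff ν Z ψ h) ξ = ∑ t ∈ (Finset.univ : Finset (Fin d)).powerset,
      (-1) ^ t.card * 𝓕 (fun x => boxIntegral ν Z ψ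
        (x + WithLp.toLp 2 fun i => if i ∈ t then 0 else h i)) ξ := by
    rw [funext (boxDiff_eq_sum hZ hψ hB h)]
    simp only [Real.fourier_eq, Finset.smul_sum]
    rw [integral_finsetSum]
    · refine Finset.sum_congr rfl fun t _ => ?_
      rw [← integral_const_mul]
      congr 1 with x
      rw [mul_smul_comm]
    · intro t _
      have := (hi.comp_add_right (WithLp.toLp 2 fun i => if i ∈ t then 0 else h i)).const_mul
        ((-1) ^ t.card)
      exact (Real.fourierIntegral_convergent_iff ξ).2 this
  rw [hsum, Finset.prod_sub, Finset.sum_mul]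
  refine Finset.sum_congr rfl fun t _ => ?_
  rw [htr, Finset.prod_const_one, mul_one, mul_assoc]
  congr 2
  rw [PiLp.inner_apply, fourierChar_sum, ← Finset.prod_sdiff (Finset.subset_univ t)]
  have : ∏ i ∈ t, (Real.fourierChar (inner ℝ ((WithLp.toLp 2 fun i => if i ∈ t then 0 else h i :
    EuclideanSpace ℝ (Fin d)) i) (ξ i)) : ℂ) = 1 :=
    Finset.prod_eq_one fun i hi => by simp [hi]
  rw [this, mul_one]
  refine Finset.prod_congr rfl fun i hi => ?_
  have : i ∉ t := (Finset.mem_sdiff.1 hi).2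
  simp [this, mul_comm]

end BoxIntegral

/-! ### Pointwise, L¹ and L² bounds for mixed differences -/

theorem cut_sub_cut_eq_zero_or {t h z : ℝ} :
    cut (t + h) z - cut t z = 0 ∨
      (‖cut (t + h) z - cut t z‖ₑ = 1 ∧ ((|t| < z ∧ z ≤ |t + h|) ∨ (z ≤ |t| ∧ |t + h| < z))) := by
  unfold cut
  by_cases h1 : |t + h| < z <;> by_cases h2 : |t| < z
  · simp [h1, h2]
  · right; simp [h1, h2, not_lt.1 h2]
  · right; simp [h1, h2, not_lt.1 h1]
  · simp [h1, h2]

/-- The difference is nonzero only if the threshold z separates |t| from |t + h|, and these numbers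
are at most h apart. -/
theorem enorm_cut_sub_cut_le (t z : ℝ) {h : ℝ} (hh : 0 < h) :
    ‖cut (t + h) z - cut t z‖ₑ ≤
      (Icc (min |t| |t + h|) (min |t| |t + h| + h)).indicator (fun _ => 1) z := by
  rcases cut_sub_cut_eq_zero_or (t := t) (h := h) (z := z) with h0 | ⟨h1, h2⟩
  · simp [h0]
  · have hd : |(|t + h| - |t|)| ≤ h := by
      simpa [abs_of_pos hh] using abs_abs_sub_abs_le (t + h) t
    have hd' := abs_le.1 hd
    rw [h1, indicator_of_mem]
    rcases h2 with h2 | h2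
    · rw [min_eq_left (h2.1.le.trans h2.2)]
      exact ⟨h2.1.le, by linarith⟩
    · rw [min_eq_right (h2.2.le.trans h2.1)]
      exact ⟨h2.2.le, by linarith⟩

/-- Here z is fixed and t varies. For h ≤ 1 the difference lives on two intervals of length h
adjacent to ±z; for h ≥ 1 it lives on [-z, z] and its translate, of total length 4z. The constant 4R
+ 2 covers both cases. -/
theorem lintegral_enorm_cut_sub_cut_le {z h R : ℝ} (hh : 0 < h) (hz : 0 ≤ z) (hzR : z ≤ R) :
    ∫⁻ t, ‖cut (t + h) z - cut t z‖ₑ ≤ ENNReal.ofReal ((4 * R + 2) * min h 1) := by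
  have bound : ∀ s : Set ℝ, MeasurableSet s →
      (∀ t, ((|t| < z ∧ z ≤ |t + h|) ∨ (z ≤ |t| ∧ |t + h| < z)) → t ∈ s) →
      ∫⁻ t, ‖cut (t + h) z - cut t z‖ₑ ≤ volume s := fun s hs hts => by
    rw [← lintegral_indicator_one hs]
    refine lintegral_mono fun t => ?_
    rcases cut_sub_cut_eq_zero_or (t := t) (h := h) (z := z) with h0 | ⟨h1, h2⟩
    · simp [h0]
    · rw [h1, indicator_of_mem (hts t h2)]; simp
  rcases le_total h 1 with hh1 | hh1
  · rw [min_eq_left hh1]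
    refine (bound (Icc (z - h) z ∪ Icc (-z - h) (-z)) (measurableSet_Icc.union measurableSet_Icc)
      fun t ht => ?_).trans ((measure_union_le _ _).trans ?_)
    · rcases ht with ⟨h1, h2⟩ | ⟨h1, h2⟩
      · have := abs_lt.1 h1
        rcases le_abs'.1 h2 with h3 | h3
        · linarith
        · exact Or.inl ⟨by linarith, by linarith⟩
      · have := abs_lt.1 h2
        rcases le_abs'.1 h1 with h3 | h3
        · exact Or.inr ⟨by linarith, by linarith⟩
        · linarith
    · rw [Real.volume_Icc, Real.volume_Icc, ← ENNReal.ofReal_add (by linarith) (by linarith)]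
      apply ENNReal.ofReal_le_ofReal
      nlinarith
  · rw [min_eq_right hh1]
    refine (bound (Icc (-z) z ∪ Icc (-z - h) (z - h)) (measurableSet_Icc.union measurableSet_Icc)
      fun t ht => ?_).trans ((measure_union_le _ _).trans ?_)
    · rcases ht with ⟨h1, h2⟩ | ⟨h1, h2⟩
      · have := abs_lt.1 h1
        exact Or.inl ⟨by linarith, by linarith⟩
      · have := abs_lt.1 h2
        exact Or.inr ⟨by linarith, by linarith⟩
    · rw [Real.volume_Icc, Real.volume_Icc, ← ENNReal.ofReal_add (by linarith) (by linarith)]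
      apply ENNReal.ofReal_le_ofReal
      linarith

/-- The measure `ν` gives a coordinate box mass `O(∏ min(ℓ_i, 1)^η)`, `ℓ` the side lengths. -/
def BoxBound {d : ℕ} {Ω : Type*} [MeasurableSpace Ω] (ν : Measure Ω) (Z : Ω → Fin d → ℝ)
    (C η : ℝ) : Prop :=
  ∀ a ℓ : Fin d → ℝ, (∀ i, 0 < ℓ i) →
    ν {ω | ∀ i, a i ≤ Z ω i ∧ Z ω i ≤ a i + ℓ i} ≤ ENNReal.ofReal (C * ∏ i, min (ℓ i) 1 ^ η)

section Estimates

variable {d : ℕ} {Ω : Type*} [MeasurableSpace Ω] {ν : Measure Ω} [IsFiniteMeasure ν]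
  {Z : Ω → Fin d → ℝ} {ψ : Ω → ℂ} {R B A C η : ℝ}

/-- Every factor is at most 1, and the product vanishes unless Z ω lies in the box with lower corner
min(|x_i|, |x_i + h_i|) and sides h_i. -/
theorem lintegral_prod_cut_sub_le (hbox : BoxBound ν Z C η) (hZ : Measurable Z)
    {h : Fin d → ℝ} (hh : ∀ i, 0 < h i) (x : EuclideanSpace ℝ (Fin d)) :
    ∫⁻ ω, ∏ i, ‖cut (x i + h i) (Z ω i) - cut (x i) (Z ω i)‖ₑ ∂ν ≤
      ENNReal.ofReal (C * ∏ i, min (h i) 1 ^ η) := by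
  set a : Fin d → ℝ := fun i => min |x i| |x i + h i|
  have hm : MeasurableSet {ω | ∀ i, a i ≤ Z ω i ∧ Z ω i ≤ a i + h i} := by
    have : {ω | ∀ i, a i ≤ Z ω i ∧ Z ω i ≤ a i + h i} = Z ⁻¹' Icc a (a + h) := by
      ext ω; simp [Pi.le_def, forall_and]
    rw [this]
    exact hZ measurableSet_Icc
  refine le_trans ?_ (hbox a h hh)
  rw [← lintegral_indicator_one hm]
  refine lintegral_mono fun ω => ?_
  by_cases hω : ω ∈ {ω | ∀ i, a i ≤ Z ω i ∧ Z ω i ≤ a i + h i}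
  · rw [indicator_of_mem hω]
    refine Finset.prod_le_one' fun i _ => ?_
    exact (enorm_cut_sub_cut_le _ _ (hh i)).trans (indicator_le_self' (by simp) _)
  · rw [indicator_of_notMem hω]
    simp only [mem_ofPred_eq, not_forall] at hω
    obtain ⟨i, hi⟩ := hω
    rw [Finset.prod_eq_zero (Finset.mem_univ i)]
    refine le_antisymm ((enorm_cut_sub_cut_le _ _ (hh i)).trans ?_) zero_le
    rw [indicator_of_notMem]
    exact hi

theorem enorm_boxDiff_le (hB : ∀ ω, ‖ψ ω‖ ≤ B) (h : Fin d → ℝ) (x : EuclideanSpace ℝ (Fin d)) :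
    ‖boxDiff ν Z ψ h x‖ₑ ≤ ENNReal.ofReal B *
      ∫⁻ ω, ∏ i, ‖cut (x i + h i) (Z ω i) - cut (x i) (Z ω i)‖ₑ ∂ν := by
  refine (enorm_integral_le_lintegral_enorm _).trans ?_
  rw [← lintegral_const_mul' _ _ ENNReal.ofReal_ne_top]
  refine lintegral_mono fun ω => ?_
  have : ∀ s : Finset (Fin d), ∀ u : Fin d → ℂ, ‖∏ i ∈ s, u i‖ₑ = ∏ i ∈ s, ‖u i‖ₑ := by
    intro s u
    simp only [← ofReal_norm, norm_prod]
    exact ENNReal.ofReal_prod_of_nonneg fun i _ => norm_nonneg _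
  rw [enorm_mul, mul_comm, this]
  gcongr
  rw [← ofReal_norm]
  exact ENNReal.ofReal_le_ofReal (hB ω)

/-- The square is at most sup times L¹ norm: the sup gives min(h_i,1)^η, and the L¹ norm, by Fubini,
gives one more power. -/
theorem lintegral_boxDiff_sq_le (hbox : BoxBound ν Z C η) (hZ : Measurable Z)
    (hZ0 : ∀ ω i, 0 ≤ Z ω i) (hR : ∀ ω i, Z ω i ≤ R) (hC : 0 ≤ C)
    (hB : ∀ ω, ‖ψ ω‖ ≤ B) {h : Fin d → ℝ} (hh : ∀ i, 0 < h i) :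
    ∫⁻ x, ‖boxDiff ν Z ψ h x‖ₑ ^ 2 ≤ ENNReal.ofReal B ^ 2 *
      ((ENNReal.ofReal C * ν univ * ENNReal.ofReal (4 * R + 2) ^ d) *
        ∏ i, ENNReal.ofReal (min (h i) 1 ^ (1 + η))) := by
  have hmeas : Measurable fun q : EuclideanSpace ℝ (Fin d) × Ω =>
      ∏ i, ‖cut (q.1 i + h i) (Z q.2 i) - cut (q.1 i) (Z q.2 i)‖ₑ := by
    refine Finset.measurable_fun_prod _ fun i _ => Measurable.enorm (Measurable.sub ?_ ?_)
    · exact Measurable.cut (by fun_prop) (by fun_prop)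
    · exact Measurable.cut (by fun_prop) (by fun_prop)
  set N : EuclideanSpace ℝ (Fin d) → ℝ≥0∞ := fun x =>
    ∫⁻ ω, ∏ i, ‖cut (x i + h i) (Z ω i) - cut (x i) (Z ω i)‖ₑ ∂ν with hN
  have hNm : Measurable N := hmeas.lintegral_prod_right'
  have hN1 : ∫⁻ x, N x ≤ ν univ * ∏ i, ENNReal.ofReal ((4 * R + 2) * min (h i) 1) := by
    rw [hN, lintegral_lintegral_swap hmeas.aemeasurable]
    calc ∫⁻ ω, (∫⁻ x : EuclideanSpace ℝ (Fin d),
            ∏ i, ‖cut (x i + h i) (Z ω i) - cut (x i) (Z ω i)‖ₑ) ∂ν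
        ≤ ∫⁻ _ω, ∏ i, ENNReal.ofReal ((4 * R + 2) * min (h i) 1) ∂ν := by
          refine lintegral_mono fun ω => ?_
          rw [lintegral_euclidean_prod_eq_prod
            (fun i t => ‖cut (t + h i) (Z ω i) - cut t (Z ω i)‖ₑ)]
          · exact Finset.prod_le_prod' fun i _ =>
              lintegral_enorm_cut_sub_cut_le (hh i) (hZ0 ω i) (hR ω i)
          · intro i
            refine Measurable.enorm (Measurable.sub ?_ ?_)
            · exact Measurable.cut (by fun_prop) (by fun_prop)
            · exact Measurable.cut (by fun_prop) (by fun_prop)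
      _ = _ := by rw [lintegral_const, mul_comm]
  have hmin : ∀ i, 0 < min (h i) 1 := fun i => lt_min (hh i) one_pos
  calc ∫⁻ x, ‖boxDiff ν Z ψ h x‖ₑ ^ 2
      ≤ ∫⁻ x, ENNReal.ofReal B ^ 2 * (ENNReal.ofReal (C * ∏ i, min (h i) 1 ^ η) * N x) := by
        refine lintegral_mono fun x => ?_
        have h1 := enorm_boxDiff_le (ν := ν) (Z := Z) hB h x
        have h2 := lintegral_prod_cut_sub_le hbox hZ hh x
        calc ‖boxDiff ν Z ψ h x‖ₑ ^ 2 ≤ (ENNReal.ofReal B * N x) ^ 2 := by gcongr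
          _ = ENNReal.ofReal B ^ 2 * (N x * N x) := by ring
          _ ≤ _ := by gcongr
    _ = ENNReal.ofReal B ^ 2 * (ENNReal.ofReal (C * ∏ i, min (h i) 1 ^ η) * ∫⁻ x, N x) := by
        rw [lintegral_const_mul _ (hNm.const_mul _), lintegral_const_mul _ hNm]
    _ ≤ ENNReal.ofReal B ^ 2 * (ENNReal.ofReal (C * ∏ i, min (h i) 1 ^ η) *
          (ν univ * ∏ i, ENNReal.ofReal ((4 * R + 2) * min (h i) 1))) := by gcongr
    _ = _ := by
        congr 1
        have e1 : ∀ i, ENNReal.ofReal (min (h i) 1 ^ (1 + η)) =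
            ENNReal.ofReal (min (h i) 1) * ENNReal.ofReal (min (h i) 1 ^ η) := fun i => by
          rw [Real.rpow_add (hmin i), Real.rpow_one, ENNReal.ofReal_mul (hmin i).le]
        have e2 : ∀ i, ENNReal.ofReal ((4 * R + 2) * min (h i) 1) =
            ENNReal.ofReal (4 * R + 2) * ENNReal.ofReal (min (h i) 1) := fun i => by
          rw [ENNReal.ofReal_mul' (hmin i).le]
        rw [ENNReal.ofReal_mul hC, ENNReal.ofReal_prod_of_nonneg
          fun i _ => Real.rpow_nonneg (hmin i).le _]
        simp only [e1, e2, Finset.prod_mul_distrib, Finset.prod_const, Finset.card_univ,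
          Fintype.card_fin]
        ring

end Estimates

/-! ### Weighted L² bounds for the Fourier transform and interpolation -/

/-- The weight in the step of a difference whose Fourier symbol dominates
`|ξ|^{1+β} + |ξ|^{1/2}`. -/
noncomputable def stepWeight (β h : ℝ) : ℝ≥0∞ :=
  (Ioi (0 : ℝ)).indicator (fun h => ENNReal.ofReal (h ^ (-2 - β) + h ^ (-(3 / 2) : ℝ))) h

theorem measurable_stepWeight (β : ℝ) : Measurable (stepWeight β) :=
  Measurable.indicator (by fun_prop) measurableSet_Ioi

/-- Near 0 the exponents are η - β - 1 and η - 1/2, both above -1; beyond 1 the weight alone is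
integrable. -/
theorem lintegral_stepWeight_mul_lt_top {β η : ℝ} (hβ : 0 < β) (hβη : β < η) :
    ∫⁻ h, stepWeight β h * ENNReal.ofReal (min h 1 ^ (1 + η)) < ∞ := by
  have e : ∀ h, stepWeight β h * ENNReal.ofReal (min h 1 ^ (1 + η)) =
      (Ioi (0 : ℝ)).indicator (fun h => ENNReal.ofReal (h ^ (-2 - β) + h ^ (-(3 / 2) : ℝ)) *
        ENNReal.ofReal (min h 1 ^ (1 + η))) h := fun h => by
    unfold stepWeight
    by_cases hh : h ∈ Ioi (0 : ℝ)
    · simp only [indicator_of_mem hh]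
    · simp only [indicator_of_notMem hh, zero_mul]
  simp_rw [e]
  rw [lintegral_indicator measurableSet_Ioi, ← Ioc_union_Ioi_eq_Ioi (zero_le_one (α := ℝ))]
  refine (lintegral_union_le _ _ _).trans_lt (ENNReal.add_lt_top.2 ⟨?_, ?_⟩)
  · have hint : IntegrableOn (fun h : ℝ => h ^ (-1 - β + η) + h ^ (η - 1 / 2)) (Ioc 0 1) := by
      refine Integrable.add ?_ ?_
      · exact (intervalIntegrable_iff_integrableOn_Ioc_of_le zero_le_one).1
          (intervalIntegral.intervalIntegrable_rpow' (by linarith))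
      · exact (intervalIntegrable_iff_integrableOn_Ioc_of_le zero_le_one).1
          (intervalIntegral.intervalIntegrable_rpow' (by linarith))
    refine lt_of_le_of_lt (le_of_eq ?_) hint.lintegral_lt_top
    refine setLIntegral_congr_fun measurableSet_Ioc fun h hh => ?_
    have h0 : 0 < h := hh.1
    simp only [min_eq_left hh.2]
    rw [← ENNReal.ofReal_mul (by positivity), add_mul, ← Real.rpow_add h0, ← Real.rpow_add h0]
    ring_nf
  · have hint : IntegrableOn (fun h : ℝ => h ^ (-2 - β) + h ^ (-(3 / 2) : ℝ)) (Ioi 1) :=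
      (integrableOn_Ioi_rpow_of_lt (by linarith) one_pos).add
        (integrableOn_Ioi_rpow_of_lt (by norm_num) one_pos)
    refine lt_of_le_of_lt (le_of_eq ?_) hint.lintegral_lt_top
    refine setLIntegral_congr_fun measurableSet_Ioi fun h hh => ?_
    simp [min_eq_right (le_of_lt (mem_Ioi.1 hh))]

theorem norm_sq_fourierChar_sub_one (t : ℝ) :
    ‖(Real.fourierChar t : ℂ) - 1‖ ^ 2 = 2 - 2 * Real.cos (2 * Real.pi * t) := by
  rw [Real.fourierChar_apply, Complex.exp_mul_I, ← Complex.ofReal_cos, ← Complex.ofReal_sin,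
    ← Complex.normSq_eq_norm_sq, Complex.normSq_apply]
  have h := Real.sin_sq_add_cos_sq (2 * Real.pi * t)
  generalize Real.sin (2 * Real.pi * t) = s at *
  generalize Real.cos (2 * Real.pi * t) = c at *
  simp
  nlinarith

/-- Only the steps 1/(4|ξ|) ≤ h ≤ 1/(2|ξ|) are kept. There cos(2πhξ) ≤ 0, so the squared symbol is
at least 2; the weight is at least |ξ|^{2+β} + |ξ|^{3/2}, and the interval has length 1/(4|ξ|). -/
theorem le_lintegral_stepWeight_mul (β ξ : ℝ) (hβ : 0 < β) :
    ENNReal.ofReal (1 / 2 * (|ξ| ^ (1 + β) + |ξ| ^ (1 / 2 : ℝ))) ≤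
      ∫⁻ h, stepWeight β h * ‖(Real.fourierChar (h * ξ) : ℂ) - 1‖ₑ ^ 2 := by
  rcases eq_or_ne ξ 0 with rfl | hξ
  · rw [abs_zero, Real.zero_rpow (by positivity), Real.zero_rpow (by norm_num)]; simp
  have hx : 0 < |ξ| := abs_pos.2 hξ
  set x := |ξ| with hxdef
  have key : ∀ h ∈ Icc (1 / (4 * x)) (1 / (2 * x)),
      ENNReal.ofReal (2 * (x ^ (2 + β) + x ^ (3 / 2 : ℝ))) ≤
        stepWeight β h * ‖(Real.fourierChar (h * ξ) : ℂ) - 1‖ₑ ^ 2 := by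
    intro h hh
    have h0 : 0 < h := lt_of_lt_of_le (by positivity) hh.1
    have hhx : h ≤ x⁻¹ := hh.2.trans (by rw [one_div]; gcongr; linarith)
    unfold stepWeight
    rw [indicator_of_mem (show h ∈ Ioi 0 from h0), ← ofReal_norm,
      ← ENNReal.ofReal_pow (norm_nonneg _), ← ENNReal.ofReal_mul (by positivity)]
    apply ENNReal.ofReal_le_ofReal
    have h1 : 2 ≤ ‖(Real.fourierChar (h * ξ) : ℂ) - 1‖ ^ 2 := by
      rw [norm_sq_fourierChar_sub_one]
      have : Real.cos (2 * Real.pi * (h * ξ)) ≤ 0 := by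
        rw [← Real.cos_abs]
        have e : |2 * Real.pi * (h * ξ)| = 2 * Real.pi * (h * x) := by
          rw [abs_mul, abs_mul, abs_mul, abs_of_pos h0, abs_of_pos Real.pi_pos]; simp [hxdef]
        rw [e]
        have l1 : 1 / 4 ≤ h * x := by
          have := mul_le_mul_of_nonneg_right hh.1 hx.le
          calc (1 : ℝ) / 4 = 1 / (4 * x) * x := by field_simp
            _ ≤ _ := this
        have l2 : h * x ≤ 1 / 2 := by
          have := mul_le_mul_of_nonneg_right hh.2 hx.le
          calc h * x ≤ 1 / (2 * x) * x := this
            _ = 1 / 2 := by field_simp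
        have hpi := Real.pi_pos
        apply Real.cos_nonpos_of_pi_div_two_le_of_le <;> nlinarith
      linarith
    have h2 : ∀ s : ℝ, 0 < s → x ^ s ≤ h ^ (-s) := fun s hs => by
      rw [Real.rpow_neg h0.le, ← Real.inv_rpow h0.le]
      exact Real.rpow_le_rpow hx.le ((le_inv_comm₀ hx h0).2 hhx) hs.le
    have h3 := h2 (2 + β) (by positivity)
    have h4 := h2 (3 / 2) (by norm_num)
    rw [show -(2 + β) = -2 - β by ring] at h3
    have h5 : 0 ≤ x ^ (2 + β) := by positivity
    have h6 : 0 ≤ x ^ (3 / 2 : ℝ) := by positivity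
    nlinarith
  calc ENNReal.ofReal (1 / 2 * (x ^ (1 + β) + x ^ (1 / 2 : ℝ)))
      = ENNReal.ofReal (2 * (x ^ (2 + β) + x ^ (3 / 2 : ℝ))) *
          volume (Icc (1 / (4 * x)) (1 / (2 * x))) := by
        rw [Real.volume_Icc, ← ENNReal.ofReal_mul (by positivity)]
        congr 1
        have e1 : x ^ (2 + β) = x * x ^ (1 + β) := by
          rw [show 2 + β = 1 + (1 + β) by ring, Real.rpow_add hx, Real.rpow_one]
        have e2 : x ^ (3 / 2 : ℝ) = x * x ^ (1 / 2 : ℝ) := by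
          rw [show (3 / 2 : ℝ) = 1 + 1 / 2 by norm_num, Real.rpow_add hx, Real.rpow_one]
        rw [e1, e2]
        generalize x ^ (1 + β) = u
        generalize x ^ (1 / 2 : ℝ) = v
        field_simp
        ring
    _ = ∫⁻ _h in Icc (1 / (4 * x)) (1 / (2 * x)),
          ENNReal.ofReal (2 * (x ^ (2 + β) + x ^ (3 / 2 : ℝ))) := by
        rw [setLIntegral_const]
    _ ≤ ∫⁻ h in Icc (1 / (4 * x)) (1 / (2 * x)),
          stepWeight β h * ‖(Real.fourierChar (h * ξ) : ℂ) - 1‖ₑ ^ 2 :=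
        setLIntegral_mono' measurableSet_Icc key
    _ ≤ _ := setLIntegral_le_lintegral _ _

/-- The two powers serve the two ends: |ξ|^{-θ/2} is integrable near 0 and |ξ|^{-θ(1+β)} at
infinity. -/
theorem lintegral_weight_rpow_lt_top {β θ : ℝ} (hθ : 0 < θ) (hθ1 : θ ≤ 1)
    (h : 1 < θ * (1 + β)) :
    ∫⁻ ξ : ℝ, ENNReal.ofReal (1 / 2 * (|ξ| ^ (1 + β) + |ξ| ^ (1 / 2 : ℝ))) ^ (-θ) < ∞ := by
  have half : ∫⁻ ξ in Ioi (0 : ℝ),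
      ENNReal.ofReal (1 / 2 * (|ξ| ^ (1 + β) + |ξ| ^ (1 / 2 : ℝ))) ^ (-θ) < ∞ := by
    have hle : ∀ a : ℝ, ∀ ξ : ℝ, 0 < ξ → (|ξ| ^ a ≤ |ξ| ^ (1 + β) + |ξ| ^ (1 / 2 : ℝ)) →
        ENNReal.ofReal (1 / 2 * (|ξ| ^ (1 + β) + |ξ| ^ (1 / 2 : ℝ))) ^ (-θ) ≤
          ENNReal.ofReal ((1 / 2) ^ (-θ) * ξ ^ (-(a * θ))) := by
      intro a ξ hξ ha
      rw [abs_of_pos hξ] at *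
      rw [ENNReal.ofReal_rpow_of_pos (by positivity)]
      apply ENNReal.ofReal_le_ofReal
      rw [Real.mul_rpow (by norm_num) (by positivity)]
      gcongr
      rw [show -(a * θ) = a * (-θ) by ring, Real.rpow_mul hξ.le]
      exact Real.rpow_le_rpow_of_nonpos (by positivity) ha (by linarith)
    rw [← Ioc_union_Ioi_eq_Ioi (zero_le_one (α := ℝ))]
    refine (lintegral_union_le _ _ _).trans_lt (ENNReal.add_lt_top.2 ⟨?_, ?_⟩)
    · have hint : IntegrableOn (fun ξ : ℝ => (1 / 2) ^ (-θ) * ξ ^ (-(1 / 2 * θ))) (Ioc 0 1) :=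
        ((intervalIntegrable_iff_integrableOn_Ioc_of_le zero_le_one).1
          (intervalIntegral.intervalIntegrable_rpow' (by linarith))).const_mul _
      refine lt_of_le_of_lt ?_ hint.lintegral_lt_top
      refine setLIntegral_mono' measurableSet_Ioc fun ξ hξ => hle _ ξ hξ.1 ?_
      have : 0 ≤ |ξ| ^ (1 + β) := by positivity
      linarith
    · have hint : IntegrableOn (fun ξ : ℝ => (1 / 2) ^ (-θ) * ξ ^ (-((1 + β) * θ))) (Ioi 1) :=
        (integrableOn_Ioi_rpow_of_lt (by linarith) one_pos).const_mul _
      refine lt_of_le_of_lt ?_ hint.lintegral_lt_top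
      refine setLIntegral_mono' measurableSet_Ioi fun ξ hξ =>
        hle _ ξ (one_pos.trans hξ) ?_
      have : 0 ≤ |ξ| ^ (1 / 2 : ℝ) := by positivity
      linarith
  have hneg : ∫⁻ ξ in Iic (0 : ℝ),
      ENNReal.ofReal (1 / 2 * (|ξ| ^ (1 + β) + |ξ| ^ (1 / 2 : ℝ))) ^ (-θ) < ∞ := by
    have := (Measure.measurePreserving_neg (volume : Measure ℝ)).setLIntegral_comp_preimage_emb
      (MeasurableEquiv.neg ℝ).measurableEmbedding
      (fun ξ => ENNReal.ofReal (1 / 2 * (|ξ| ^ (1 + β) + |ξ| ^ (1 / 2 : ℝ))) ^ (-θ)) (Ici 0)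
    rw [show Neg.neg ⁻¹' Ici (0 : ℝ) = Iic 0 by ext; simp] at this
    simp only [abs_neg] at this
    rw [this, setLIntegral_congr Ioi_ae_eq_Ici.symm]
    exact half
  rw [← setLIntegral_univ, ← Iic_union_Ioi (a := (0 : ℝ))]
  exact (lintegral_union_le _ _ _).trans_lt (ENNReal.add_lt_top.2 ⟨hneg, half⟩)

section UnitPiece

variable {d : ℕ} {Ω : Type*} [MeasurableSpace Ω] {ν : Measure Ω} [IsFiniteMeasure ν]
  {Z : Ω → Fin d → ℝ} {ψ : Ω → ℂ} {R B A C η : ℝ}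

/-- The level set lies in slabs of thickness ε, whose mass is O(ε^η); let ε tend to 0. -/
theorem BoxBound.measure_eq_zero (hbox : BoxBound ν Z C η) (hη : 0 < η)
    (hZ0 : ∀ ω i, 0 ≤ Z ω i) (hR : ∀ ω i, Z ω i ≤ R) (i : Fin d) (a : ℝ) :
    ν {ω | Z ω i = a} = 0 := by
  have key : ∀ ε : ℝ, 0 < ε → ν {ω | Z ω i = a} ≤ ENNReal.ofReal (|C| * ε ^ η) := by
    intro ε hε
    have hpos : ∀ j, 0 < (if j = i then ε else |R| + 1) := fun j => by split_ifs <;> positivity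
    refine le_trans (measure_mono ?_) ((hbox (fun j => if j = i then a else 0)
      (fun j => if j = i then ε else |R| + 1) hpos).trans ?_)
    · intro ω hω j
      have hω : Z ω i = a := hω
      by_cases hj : j = i
      · subst hj; simp [hω, hε.le]
      · simp only [hj, if_false, zero_add]
        exact ⟨hZ0 ω j, (hR ω j).trans (by linarith [le_abs_self R])⟩
    · apply ENNReal.ofReal_le_ofReal
      have h0 : ∀ j, 0 ≤ min (if j = i then ε else |R| + 1) 1 := fun j =>
        (lt_min (hpos j) one_pos).le
      have hprod : ∏ j, min (if j = i then ε else |R| + 1) 1 ^ η ≤ ε ^ η := by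
        rw [← Finset.mul_prod_erase _ _ (Finset.mem_univ i)]
        calc _ ≤ ε ^ η * 1 := by
              apply mul_le_mul
              · refine Real.rpow_le_rpow (h0 i) ?_ hη.le
                simp
              · exact Finset.prod_le_one (fun j _ => Real.rpow_nonneg (h0 j) _)
                  fun j _ => Real.rpow_le_one (h0 j) (min_le_right _ _) hη.le
              · exact Finset.prod_nonneg fun j _ => Real.rpow_nonneg (h0 j) _
              · positivity
          _ = ε ^ η := mul_one _
      have h1 : 0 ≤ ∏ j, min (if j = i then ε else |R| + 1) 1 ^ η :=
        Finset.prod_nonneg fun j _ => Real.rpow_nonneg (h0 j) _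
      calc C * ∏ j, min (if j = i then ε else |R| + 1) 1 ^ η
          ≤ |C| * ∏ j, min (if j = i then ε else |R| + 1) 1 ^ η := by gcongr; exact le_abs_self C
        _ ≤ _ := by gcongr
  have hlim : Tendsto (fun ε : ℝ => ENNReal.ofReal (|C| * ε ^ η)) (𝓝[>] 0) (𝓝 0) := by
    have h1 : Tendsto (fun ε : ℝ => |C| * ε ^ η) (𝓝 0) (𝓝 (|C| * 0 ^ η)) :=
      ((Real.continuousAt_rpow_const 0 η (Or.inr hη.le)).tendsto).const_mul _
    rw [Real.zero_rpow hη.ne', mul_zero] at h1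
    have h2 := ENNReal.tendsto_ofReal h1
    rw [ENNReal.ofReal_zero] at h2
    exact h2.mono_left nhdsWithin_le_nhds
  exact le_antisymm (ge_of_tendsto hlim (eventually_mem_nhdsWithin.mono fun ε hε => key ε hε))
    zero_le

/-- For almost every ω no edge passes through x₀, so the indicators are locally constant there and
dominated convergence applies. -/
theorem continuous_boxIntegral (hbox : BoxBound ν Z C η) (hη : 0 < η) (hZ : Measurable Z)
    (hZ0 : ∀ ω i, 0 ≤ Z ω i) (hR : ∀ ω i, Z ω i ≤ R) (hψ : Measurable ψ) (hB : ∀ ω, ‖ψ ω‖ ≤ B) :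
    Continuous (boxIntegral ν Z ψ) := by
  rw [continuous_iff_continuousAt]
  intro x₀
  refine tendsto_integral_filter_of_dominated_convergence (fun ω => ‖ψ ω‖) ?_ ?_ ?_ ?_
  · exact Eventually.of_forall fun x =>
      (integrable_prod_cut_mul hZ hψ hB x).aestronglyMeasurable
  · refine Eventually.of_forall fun x => ae_of_all _ fun ω => ?_
    rw [norm_mul]
    exact mul_le_of_le_one_left (norm_nonneg _) (norm_prod_cut_le_one _ _)
  · exact (integrable_of_bound hψ hB).norm
  · have hae : ∀ᵐ ω ∂ν, ∀ i, Z ω i ≠ |x₀ i| := by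
      rw [ae_all_iff]
      intro i
      have := hbox.measure_eq_zero hη hZ0 hR i |x₀ i|
      rw [ae_iff]
      simpa using this
    filter_upwards [hae] with ω hω
    refine Tendsto.mul_const _ (tendsto_finsetProd _ fun i _ => ?_)
    have hc : Continuous fun x : EuclideanSpace ℝ (Fin d) => |x i| := by fun_prop
    rcases lt_or_gt_of_ne (hω i) with h | h
    · refine Tendsto.congr' ?_ tendsto_const_nhds
      filter_upwards [hc.continuousAt.eventually (lt_mem_nhds h)] with x hx
      simp [cut, not_lt.2 h.le, not_lt.2 (le_of_lt hx)]
    · refine Tendsto.congr' ?_ tendsto_const_nhds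
      filter_upwards [hc.continuousAt.eventually (gt_mem_nhds h)] with x hx
      simp [cut, h, hx]

theorem ae_forall_ne_zero : ∀ᵐ ξ : EuclideanSpace ℝ (Fin d), ∀ i, ξ i ≠ 0 := by
  rw [ae_all_iff]
  intro i
  have h0 : ∀ᵐ t : ℝ, t ≠ 0 := by simp [ae_iff]
  have h1 : ∀ᵐ y : Fin d → ℝ, y i ≠ 0 :=
    (Measure.quasiMeasurePreserving_eval (fun _ : Fin d => (volume : Measure ℝ)) i).ae h0
  exact (PiLp.volume_preserving_ofLp (Fin d)).quasiMeasurePreserving.ae h1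

/-- The weight in ξ is dominated by an integral over steps of squared difference symbols. After
exchanging the integrals, Plancherel identifies the inner one with the squared L² norm of a mixed
difference. -/
theorem lintegral_fourier_sq_mul_weight_le {β : ℝ} (hbox : BoxBound ν Z C η) (hC : 0 ≤ C)
    (hβ : 0 < β) (hZ : Measurable Z) (hZ0 : ∀ ω i, 0 ≤ Z ω i)
    (hR : ∀ ω i, Z ω i ≤ R) (hψ : Measurable ψ) (hB : ∀ ω, ‖ψ ω‖ ≤ B)
    (hA : ∀ x, ‖boxIntegral ν Z ψ x‖ ≤ A) :
    ∫⁻ ξ : EuclideanSpace ℝ (Fin d), ‖𝓕 (boxIntegral ν Z ψ) ξ‖ₑ ^ 2 *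
        ∏ i, ENNReal.ofReal (1 / 2 * (|ξ i| ^ (1 + β) + |ξ i| ^ (1 / 2 : ℝ))) ≤
      ENNReal.ofReal B ^ 2 * ((ENNReal.ofReal C * ν univ * ENNReal.ofReal (4 * R + 2) ^ d) *
        (∫⁻ h, stepWeight β h * ENNReal.ofReal (min h 1 ^ (1 + η))) ^ d) := by
  have hi := memLp_one_iff_integrable.1 (memLp_boxIntegral (ν := ν) hZ hψ hR hA 1)
  have hcont : Continuous (𝓕 (boxIntegral ν Z ψ)) := VectorFourier.fourierIntegral_continuous
      Real.continuous_fourierChar (by exact continuous_inner) hi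
  have hsw : ∀ i : Fin d, Measurable fun h : Fin d → ℝ => stepWeight β (h i) := fun i =>
    (measurable_stepWeight β).comp (measurable_pi_apply i)
  have hφ : ∀ ξ : ℝ, Measurable fun h : ℝ => ‖(Real.fourierChar (h * ξ) : ℂ) - 1‖ₑ ^ 2 :=
    fun ξ => by
      have : Continuous fun h : ℝ => (Real.fourierChar (h * ξ) : ℂ) - 1 :=
        (continuous_subtype_val.comp (Real.continuous_fourierChar.comp (by fun_prop))).sub
          continuous_const
      exact this.measurable.enorm.pow_const 2
  have hφ2 : ∀ i : Fin d, Measurable fun q : EuclideanSpace ℝ (Fin d) × (Fin d → ℝ) =>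
      ‖(Real.fourierChar (q.2 i * q.1 i) : ℂ) - 1‖ₑ ^ 2 :=
    fun i => by
      have : Continuous fun q : EuclideanSpace ℝ (Fin d) × (Fin d → ℝ) =>
          (Real.fourierChar (q.2 i * q.1 i) : ℂ) - 1 :=
        (continuous_subtype_val.comp (Real.continuous_fourierChar.comp (by fun_prop))).sub
          continuous_const
      exact this.measurable.enorm.pow_const 2
  have henorm : ∀ u : Fin d → ℂ, ‖∏ i, u i‖ₑ = ∏ i, ‖u i‖ₑ := by
    intro u
    simp only [← ofReal_norm, norm_prod]
    exact ENNReal.ofReal_prod_of_nonneg fun i _ => norm_nonneg _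
  calc ∫⁻ ξ : EuclideanSpace ℝ (Fin d), ‖𝓕 (boxIntegral ν Z ψ) ξ‖ₑ ^ 2 *
        ∏ i, ENNReal.ofReal (1 / 2 * (|ξ i| ^ (1 + β) + |ξ i| ^ (1 / 2 : ℝ)))
      ≤ ∫⁻ ξ : EuclideanSpace ℝ (Fin d), ‖𝓕 (boxIntegral ν Z ψ) ξ‖ₑ ^ 2 *
          ∏ i, ∫⁻ h, stepWeight β h * ‖(Real.fourierChar (h * ξ i) : ℂ) - 1‖ₑ ^ 2 := by
        refine lintegral_mono fun ξ => ?_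
        gcongr with i
        exact le_lintegral_stepWeight_mul β (ξ i) hβ
    _ = ∫⁻ ξ : EuclideanSpace ℝ (Fin d), ∫⁻ h : Fin d → ℝ,
          ‖𝓕 (boxIntegral ν Z ψ) ξ‖ₑ ^ 2 *
            ∏ i, (stepWeight β (h i) * ‖(Real.fourierChar (h i * ξ i) : ℂ) - 1‖ₑ ^ 2) := by
        refine lintegral_congr fun ξ => ?_
        rw [lintegral_const_mul, lintegral_fin_prod_eq_prod (fun i h =>
          stepWeight β h * ‖(Real.fourierChar (h * ξ i) : ℂ) - 1‖ₑ ^ 2)]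
        · exact fun i => (measurable_stepWeight β).mul (hφ _)
        · exact Finset.measurable_fun_prod _ fun i _ => (hsw i).mul
            ((hφ (ξ i)).comp (measurable_pi_apply i))
    _ = ∫⁻ h : Fin d → ℝ, ∫⁻ ξ : EuclideanSpace ℝ (Fin d),
          ‖𝓕 (boxIntegral ν Z ψ) ξ‖ₑ ^ 2 *
            ∏ i, (stepWeight β (h i) * ‖(Real.fourierChar (h i * ξ i) : ℂ) - 1‖ₑ ^ 2) := by
        rw [lintegral_lintegral_swap]
        refine Measurable.aemeasurable (Measurable.mul ?_ ?_)
        · exact ((hcont.measurable.comp measurable_fst).enorm).pow_const 2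
        · exact Finset.measurable_fun_prod _ fun i _ =>
            ((hsw i).comp measurable_snd).mul (hφ2 i)
    _ = ∫⁻ h : Fin d → ℝ, (∏ i, stepWeight β (h i)) * ∫⁻ x, ‖boxDiff ν Z ψ h x‖ₑ ^ 2 := by
        refine lintegral_congr fun h => ?_
        rw [← lintegral_enorm_fourier_sq
          (memLp_one_iff_integrable.1 (memLp_boxDiff hZ hψ hR hB hA h 1))
          (memLp_boxDiff hZ hψ hR hB hA h 2), ← lintegral_const_mul']
        · refine lintegral_congr fun ξ => ?_
          rw [fourier_boxDiff hZ hψ hR hB hA, enorm_mul, henorm, Finset.prod_mul_distrib, mul_pow,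
            Finset.prod_pow]
          ring
        · refine ENNReal.prod_ne_top fun i _ => ?_
          rw [stepWeight, indicator_apply]
          split_ifs <;> simp
    _ ≤ ∫⁻ h : Fin d → ℝ, ENNReal.ofReal B ^ 2 *
          ((ENNReal.ofReal C * ν univ * ENNReal.ofReal (4 * R + 2) ^ d) *
          ∏ i, (stepWeight β (h i) * ENNReal.ofReal (min (h i) 1 ^ (1 + η)))) := by
        refine lintegral_mono fun h => ?_
        by_cases hh : ∀ i, 0 < h i
        · have := lintegral_boxDiff_sq_le (ψ := ψ) hbox hZ hZ0 hR hC hB hh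
          calc _ ≤ _ := mul_le_mul_right this (∏ i, stepWeight β (h i))
            _ = _ := by rw [Finset.prod_mul_distrib]; ring
        · push Not at hh
          obtain ⟨i, hi⟩ := hh
          rw [Finset.prod_eq_zero (Finset.mem_univ i), zero_mul]
          · exact zero_le
          · unfold stepWeight
            rw [indicator_of_notMem]
            exact not_lt.2 hi
    _ = _ := by
        have hm : ∀ i : Fin d, Measurable fun h : ℝ =>
            stepWeight β h * ENNReal.ofReal (min h 1 ^ (1 + η)) := fun _ =>
          (measurable_stepWeight β).mul (by fun_prop)
        have hm2 : Measurable fun h : Fin d → ℝ =>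
            ∏ i, (stepWeight β (h i) * ENNReal.ofReal (min (h i) 1 ^ (1 + η))) :=
          Finset.measurable_fun_prod _ fun i _ => (hm i).comp (measurable_pi_apply i)
        rw [lintegral_const_mul _ (hm2.const_mul _), lintegral_const_mul _ hm2,
          lintegral_fin_prod_eq_prod
          (fun _ h => stepWeight β h * ENNReal.ofReal (min h 1 ^ (1 + η))) hm]
        simp

theorem lintegral_euclidean_prod_weight_rpow (β θ : ℝ) :
    ∫⁻ ξ : EuclideanSpace ℝ (Fin d),
      ∏ i, ENNReal.ofReal (1 / 2 * (|ξ i| ^ (1 + β) + |ξ i| ^ (1 / 2 : ℝ))) ^ (-θ) =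
    (∫⁻ t : ℝ, ENNReal.ofReal (1 / 2 * (|t| ^ (1 + β) + |t| ^ (1 / 2 : ℝ))) ^ (-θ)) ^ d := by
  rw [lintegral_euclidean_prod_eq_prod (fun _ t =>
    ENNReal.ofReal (1 / 2 * (|t| ^ (1 + β) + |t| ^ (1 / 2 : ℝ))) ^ (-θ))]
  · simp
  · intro i
    fun_prop

/-- Interpolation estimate for the Wiener norm of a superposition of boxes: the size `A` of the
function and the size `B` of its density enter with complementary exponents. -/
theorem exists_hasWienerNorm_boxIntegral (hbox : BoxBound ν Z C η) (hC : 0 ≤ C) (hη : 0 < η)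
    (hZ : Measurable Z) (hZ0 : ∀ ω i, 0 ≤ Z ω i) (hR : ∀ ω i, Z ω i ≤ R)
    {θ : ℝ} (hθ : 0 < θ) (hθ1 : θ ≤ 1) (hθη : 1 < θ * (1 + η)) :
    ∃ K : ℝ, 0 ≤ K ∧ ∀ (ψ : Ω → ℂ) (A B : ℝ), Measurable ψ → 0 ≤ A → 0 ≤ B → (∀ ω, ‖ψ ω‖ ≤ B) →
      (∀ x, ‖boxIntegral ν Z ψ x‖ ≤ A) →
      HasWienerNorm (boxIntegral ν Z ψ) (K * (A ^ (1 - θ) * B ^ θ)) := by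
  -- Any β with max(0, 1/θ - 1) < β < η. The upper bound makes the integral over steps converge, the
  -- lower one the integral of W^{-θ}.
  obtain ⟨β, hβ, hβη, hθβ⟩ : ∃ β, 0 < β ∧ β < η ∧ 1 < θ * (1 + β) := by
    have h1 : 1 / θ - 1 < η := by
      have : 1 / θ < 1 + η := by rw [div_lt_iff₀ hθ]; linarith
      linarith
    obtain ⟨β, hβ1, hβ2⟩ := exists_between (max_lt hη h1)
    refine ⟨β, (le_max_left _ _).trans_lt hβ1, hβ2, ?_⟩
    have : 1 / θ < 1 + β := by linarith [(le_max_right _ _).trans_lt hβ1]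
    rw [div_lt_iff₀ hθ] at this
    linarith
  set c₁ : ℝ≥0∞ := (ENNReal.ofReal C * ν univ * ENNReal.ofReal (4 * R + 2) ^ d) *
    (∫⁻ h, stepWeight β h * ENNReal.ofReal (min h 1 ^ (1 + η))) ^ d with hc₁
  have hc₁t : c₁ ≠ ∞ := by
    refine ENNReal.mul_ne_top (ENNReal.mul_ne_top (ENNReal.mul_ne_top ENNReal.ofReal_ne_top
      (measure_ne_top _ _)) (ENNReal.pow_ne_top ENNReal.ofReal_ne_top)) (ENNReal.pow_ne_top ?_)
    exact (lintegral_stepWeight_mul_lt_top hβ hβη).ne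
  set c₂ : ℝ≥0∞ := volume (cube d R)
  have hc₂t : c₂ ≠ ∞ := (volume_cube_lt_top d R).ne
  set c₃ : ℝ≥0∞ := (∫⁻ t : ℝ,
    ENNReal.ofReal (1 / 2 * (|t| ^ (1 + β) + |t| ^ (1 / 2 : ℝ))) ^ (-θ)) ^ d
  have hc₃t : c₃ ≠ ∞ := ENNReal.pow_ne_top (lintegral_weight_rpow_lt_top hθ hθ1 hθβ).ne
  have hKt : c₁ ^ (θ / 2) * c₂ ^ ((1 - θ) / 2) * c₃ ^ (1 / 2 : ℝ) ≠ ∞ :=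
    ENNReal.mul_ne_top (ENNReal.mul_ne_top
      (ENNReal.rpow_ne_top_of_nonneg (by linarith) hc₁t)
      (ENNReal.rpow_ne_top_of_nonneg (by linarith) hc₂t))
      (ENNReal.rpow_ne_top_of_nonneg (by norm_num) hc₃t)
  refine ⟨(c₁ ^ (θ / 2) * c₂ ^ ((1 - θ) / 2) * c₃ ^ (1 / 2 : ℝ)).toReal, ENNReal.toReal_nonneg,
    fun ψ A B hψ hA0 hB0 hB hA => ?_⟩
  have hi := memLp_one_iff_integrable.1 (memLp_boxIntegral (ν := ν) hZ hψ hR hA 1)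
  have hcont : Continuous (𝓕 (boxIntegral ν Z ψ)) := VectorFourier.fourierIntegral_continuous
      Real.continuous_fourierChar (by exact continuous_inner) hi
  refine HasWienerNorm.of_fourier (continuous_boxIntegral hbox hη hZ hZ0 hR hψ hB) hi
    (by positivity) ?_
  set G := fun ξ => ‖𝓕 (boxIntegral ν Z ψ) ξ‖ₑ with hG
  set W : EuclideanSpace ℝ (Fin d) → ℝ≥0∞ := fun ξ =>
    ∏ i, ENNReal.ofReal (1 / 2 * (|ξ i| ^ (1 + β) + |ξ i| ^ (1 / 2 : ℝ))) with hW
  have hGm : Measurable G := hcont.measurable.enorm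
  have hWm : Measurable W := Finset.measurable_fun_prod _ fun i _ => by fun_prop
  have h1 : ∫⁻ ξ, G ξ ^ 2 * W ξ ≤ ENNReal.ofReal B ^ 2 * c₁ :=
    lintegral_fourier_sq_mul_weight_le hbox hC hβ hZ hZ0 hR hψ hB hA
  have h2 : ∫⁻ ξ, G ξ ^ 2 ≤ ENNReal.ofReal A ^ 2 * c₂ := by
    rw [hG, lintegral_enorm_fourier_sq hi (memLp_boxIntegral hZ hψ hR hA 2)]
    exact lintegral_boxIntegral_sq_le hR hA
  have hWt : ∀ ξ, W ξ ≠ ∞ := fun ξ => ENNReal.prod_ne_top fun i _ => ENNReal.ofReal_ne_top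
  have hW0 : ∀ ξ : EuclideanSpace ℝ (Fin d), (∀ i, ξ i ≠ 0) → W ξ ≠ 0 := fun ξ hξ => by
    refine Finset.prod_ne_zero_iff.2 fun i _ => ?_
    have : 0 < |ξ i| := abs_pos.2 (hξ i)
    exact (ENNReal.ofReal_pos.2 (by positivity)).ne'
  have h3 : ∫⁻ ξ, W ξ ^ (-θ) = c₃ := by
    refine Eq.trans (lintegral_congr_ae ?_) (lintegral_euclidean_prod_weight_rpow β θ)
    refine ae_of_all _ fun ξ => ?_
    simp only [hW]
    exact ENNReal.prod_rpow_of_ne_top (fun i _ => ENNReal.ofReal_ne_top) _ |>.symm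
  -- Hölder's inequality with exponents θ/2 + (1-θ)/2 + 1/2 = 1; the powers of W cancel off the
  -- coordinate hyperplanes. For θ = 1 this is Cauchy–Schwarz.
  have hprod : ∀ᵐ ξ : EuclideanSpace ℝ (Fin d), G ξ =
      ∏ j : Fin 3, (![fun ξ => G ξ ^ 2 * W ξ, fun ξ => G ξ ^ 2, fun ξ => W ξ ^ (-θ)] j) ξ ^
        (![θ / 2, (1 - θ) / 2, 1 / 2] j) := by
    filter_upwards [ae_forall_ne_zero] with ξ hξ
    simp only [Fin.prod_univ_three, Matrix.cons_val_zero, Matrix.cons_val_one, Matrix.cons_val]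
    rw [ENNReal.mul_rpow_of_nonneg _ _ (by linarith), mul_right_comm (_ ^ _), mul_assoc,
      ← ENNReal.rpow_add_of_nonneg _ _ (by linarith) (by linarith), ← ENNReal.rpow_mul,
      ← ENNReal.rpow_add _ _ (hW0 ξ hξ) (hWt ξ), ← ENNReal.rpow_natCast, ← ENNReal.rpow_mul]
    rw [show θ / 2 + -θ * (1 / 2) = 0 by ring, ENNReal.rpow_zero, mul_one,
      show ((2 : ℕ) : ℝ) * (θ / 2 + (1 - θ) / 2) = 1 by push_cast; ring, ENNReal.rpow_one]
  calc ∫⁻ ξ, G ξ = ∫⁻ ξ, ∏ j : Fin 3,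
        (![fun ξ => G ξ ^ 2 * W ξ, fun ξ => G ξ ^ 2, fun ξ => W ξ ^ (-θ)] j) ξ ^
        (![θ / 2, (1 - θ) / 2, 1 / 2] j) := lintegral_congr_ae hprod
    _ ≤ ∏ j : Fin 3, (∫⁻ ξ, (![fun ξ => G ξ ^ 2 * W ξ, fun ξ => G ξ ^ 2,
          fun ξ => W ξ ^ (-θ)] j) ξ) ^ (![θ / 2, (1 - θ) / 2, 1 / 2] j) := by
        refine ENNReal.lintegral_prod_norm_pow_le _ ?_ ?_ ?_
        · intro j _
          fin_cases j
          · exact ((hGm.pow_const 2).mul hWm).aemeasurable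
          · exact (hGm.pow_const 2).aemeasurable
          · exact (hWm.pow_const _).aemeasurable
        · simp [Fin.sum_univ_three]; ring
        · intro j _
          fin_cases j <;> simp <;> linarith
    _ = (∫⁻ ξ, G ξ ^ 2 * W ξ) ^ (θ / 2) * (∫⁻ ξ, G ξ ^ 2) ^ ((1 - θ) / 2) *
          (∫⁻ ξ, W ξ ^ (-θ)) ^ (1 / 2 : ℝ) := by
        simp [Fin.prod_univ_three]
    _ ≤ (ENNReal.ofReal B ^ 2 * c₁) ^ (θ / 2) * (ENNReal.ofReal A ^ 2 * c₂) ^ ((1 - θ) / 2) *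
          c₃ ^ (1 / 2 : ℝ) := by
        rw [h3]
        have h4 : 0 ≤ θ / 2 := by linarith
        have h5 : 0 ≤ (1 - θ) / 2 := by linarith
        gcongr
    _ = (c₁ ^ (θ / 2) * c₂ ^ ((1 - θ) / 2) * c₃ ^ (1 / 2 : ℝ)) *
          (ENNReal.ofReal A ^ (1 - θ) * ENNReal.ofReal B ^ θ) := by
        have hsq : ∀ (x c : ℝ≥0∞) (s : ℝ), 0 ≤ s →
            (x ^ 2 * c) ^ (s / 2) = x ^ s * c ^ (s / 2) := fun x c s hs => by
          rw [ENNReal.mul_rpow_of_nonneg _ _ (by linarith), ← ENNReal.rpow_natCast,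
            ← ENNReal.rpow_mul]
          congr 2
          push_cast
          ring
        rw [hsq _ c₁ _ hθ.le, hsq _ c₂ _ (by linarith)]
        ring
    _ = _ := by
        rw [ENNReal.ofReal_mul ENNReal.toReal_nonneg, ENNReal.ofReal_toReal hKt,
          ENNReal.ofReal_mul (by positivity), ENNReal.ofReal_rpow_of_nonneg hA0 (by linarith),
          ENNReal.ofReal_rpow_of_nonneg hB0 hθ.le]

end UnitPiece

/-! ### Locally absolutely continuous functions on the half-line -/

theorem AbsolutelyContinuousOnInterval.comp_lipschitz {X Y : Type*} [PseudoMetricSpace X]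
    [PseudoMetricSpace Y] {f : ℝ → X} {a b : ℝ} (hf : AbsolutelyContinuousOnInterval f a b)
    {φ : X → Y} (hφ : ∀ x y, dist (φ x) (φ y) ≤ dist x y) :
    AbsolutelyContinuousOnInterval (fun t => φ (f t)) a b := by
  rw [absolutelyContinuousOnInterval_iff] at *
  intro ε hε
  obtain ⟨δ, hδ, h⟩ := hf ε hε
  exact ⟨δ, hδ, fun E hE hE' => (Finset.sum_le_sum fun i _ => hφ _ _).trans_lt (h E hE hE')⟩

theorem dist_re_le (x y : ℂ) : dist x.re y.re ≤ dist x y := by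
  rw [Real.dist_eq, ← Complex.sub_re, dist_eq_norm]; exact Complex.abs_re_le_norm _

theorem dist_im_le (x y : ℂ) : dist x.im y.im ≤ dist x y := by
  rw [Real.dist_eq, ← Complex.sub_im, dist_eq_norm]; exact Complex.abs_im_le_norm _

theorem IntervalIntegrable.re_im {γ : ℝ → ℂ} {a b : ℝ} (h : IntervalIntegrable γ volume a b) :
    IntervalIntegrable (fun t => (γ t).re) volume a b ∧
      IntervalIntegrable (fun t => (γ t).im) volume a b :=
  ⟨⟨h.1.re, h.2.re⟩, ⟨h.1.im, h.2.im⟩⟩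

theorem intervalIntegral_eq_re_add_im {γ : ℝ → ℂ} {a b : ℝ}
    (h : IntervalIntegrable γ volume a b) :
    ∫ t in a..b, γ t = (∫ t in a..b, (γ t).re : ℝ) • (1 : ℂ) +
      (∫ t in a..b, (γ t).im : ℝ) • Complex.I := by
  have h1 : IntervalIntegrable (fun t => (((γ t).re : ℝ) : ℂ)) volume a b :=
    ⟨h.re_im.1.1.ofReal, h.re_im.1.2.ofReal⟩
  have h2 : IntervalIntegrable (fun t => (((γ t).im : ℝ) : ℂ) * Complex.I) volume a b :=
    IntervalIntegrable.mul_const ⟨h.re_im.2.1.ofReal, h.re_im.2.2.ofReal⟩ _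
  simp only [Complex.real_smul, mul_one]
  rw [← intervalIntegral.integral_ofReal, ← intervalIntegral.integral_ofReal,
    ← intervalIntegral.integral_mul_const, ← intervalIntegral.integral_add h1 h2]
  simp only [Complex.re_add_im]

/-- Real and imaginary parts are treated separately and recombined as multiples of 1 and i. -/
theorem IntervalIntegrable.absolutelyContinuousOnInterval_integral_complex {γ : ℝ → ℂ}
    {a b c : ℝ} (h : IntervalIntegrable γ volume a b) (hc : c ∈ uIcc a b) :
    AbsolutelyContinuousOnInterval (fun x => ∫ t in c..x, γ t) a b := by
  have key : ∀ x ∈ uIcc a b, ∫ t in c..x, γ t = (∫ t in c..x, (γ t).re : ℝ) • (1 : ℂ) +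
      (∫ t in c..x, (γ t).im : ℝ) • Complex.I := fun x hx =>
    intervalIntegral_eq_re_add_im (h.mono_set (uIcc_subset_uIcc hc hx))
  have hconst : ∀ z : ℂ, AbsolutelyContinuousOnInterval (fun _ : ℝ => z) a b := fun z =>
    (LipschitzWith.const z).lipschitzOnWith.absolutelyContinuousOnInterval
  have h1 := (h.re_im.1.absolutelyContinuousOnInterval_intervalIntegral hc).smul (hconst 1)
  have h2 := (h.re_im.2.absolutelyContinuousOnInterval_intervalIntegral hc).smul
    (hconst Complex.I)
  have h3 := h1.add h2
  rw [absolutelyContinuousOnInterval_iff] at h3 ⊢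
  intro ε hε
  obtain ⟨δ, hδ, h⟩ := h3 ε hε
  refine ⟨δ, hδ, fun E hE hE' => ?_⟩
  refine lt_of_le_of_lt (le_of_eq (Finset.sum_congr rfl fun i hi => ?_)) (h E hE hE')
  have hm := hE.1 i hi
  rw [key _ hm.1, key _ hm.2]
  rfl

/-- `g` is, on `(0, ∞)`, a locally absolutely continuous function with derivative `γ`. -/
def HasACDeriv (g γ : ℝ → ℂ) : Prop :=
  ∀ a b : ℝ, 0 < a → a ≤ b → IntervalIntegrable γ volume a b ∧ ∫ t in a..b, γ t = g b - g a

namespace HasACDeriv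

variable {g γ g₁ γ₁ g₂ γ₂ : ℝ → ℂ}

theorem eq_add (h : HasACDeriv g γ) {a b t : ℝ} (ha : 0 < a) (ht : t ∈ uIcc a b) (hab : a ≤ b) :
    g t = g a + ∫ u in a..t, γ u := by
  rw [uIcc_of_le hab] at ht
  rw [(h a t ha ht.1).2]; ring

theorem absolutelyContinuousOnInterval (h : HasACDeriv g γ) {a b : ℝ} (ha : 0 < a)
    (hab : a ≤ b) : AbsolutelyContinuousOnInterval g a b := by
  have h1 := ((h a b ha hab).1.absolutelyContinuousOnInterval_integral_complex
    left_mem_uIcc)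
  rw [absolutelyContinuousOnInterval_iff] at h1 ⊢
  intro ε hε
  obtain ⟨δ, hδ, h2⟩ := h1 ε hε
  refine ⟨δ, hδ, fun E hE hE' => ?_⟩
  refine lt_of_le_of_lt (le_of_eq (Finset.sum_congr rfl fun i hi => ?_)) (h2 E hE hE')
  have hm := hE.1 i hi
  rw [h.eq_add ha hm.1 hab, h.eq_add ha hm.2 hab, dist_add_left]

theorem ae_hasDerivAt (h : HasACDeriv g γ) {a b : ℝ} (ha : 0 < a) (hab : a ≤ b) :
    ∀ᵐ t, t ∈ uIcc a b → HasDerivAt g (γ t) t := by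
  have h1 : ∀ᵐ t : ℝ, t ≠ a := by simp [ae_iff, measure_singleton]
  have h2 : ∀ᵐ t : ℝ, t ≠ b := by simp [ae_iff, measure_singleton]
  filter_upwards [(h a b ha hab).1.ae_hasDerivAt_integral, h1, h2] with t ht hta htb hmem
  have hd := (ht hmem a left_mem_uIcc).const_add (g a)
  refine hd.congr_of_eventuallyEq ?_
  rw [uIcc_of_le hab] at hmem
  have : Ioo a b ∈ 𝓝 t := Ioo_mem_nhds (lt_of_le_of_ne hmem.1 hta.symm)
    (lt_of_le_of_ne hmem.2 htb)
  filter_upwards [this] with u hu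
  exact h.eq_add ha (by rw [uIcc_of_le hab]; exact Ioo_subset_Icc_self hu) hab

/-- Subtracting the integral of γ leaves an absolutely continuous function with derivative 0 almost
everywhere, hence a constant. -/
theorem of_ae (hi : ∀ a b : ℝ, 0 < a → a ≤ b → IntervalIntegrable γ volume a b)
    (hac : ∀ a b : ℝ, 0 < a → a ≤ b → AbsolutelyContinuousOnInterval g a b)
    (hd : ∀ a b : ℝ, 0 < a → a ≤ b → ∀ᵐ t, t ∈ uIcc a b → HasDerivAt g (γ t) t) :
    HasACDeriv g γ := by
  intro a b ha hab
  refine ⟨hi a b ha hab, ?_⟩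
  have h1 := (hac a b ha hab).sub
    ((hi a b ha hab).absolutelyContinuousOnInterval_integral_complex left_mem_uIcc)
  have h2 : ∀ᵐ t, t ∈ uIcc a b → HasDerivAt (g - fun x => ∫ t in a..x, γ t) 0 t := by
    filter_upwards [hd a b ha hab, (hi a b ha hab).ae_hasDerivAt_integral] with t ht1 ht2 hm
    have := (ht1 hm).sub (ht2 hm a left_mem_uIcc)
    rwa [sub_self] at this
  obtain ⟨C, hC⟩ := h1.const_of_ae_hasDerivAt_zero h2
  have ha' := hC a left_mem_uIcc
  have hb' := hC b right_mem_uIcc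
  simp only [Pi.sub_apply, intervalIntegral.integral_same, sub_zero] at ha' hb'
  rw [ha', ← hb']; ring

/-- Bounded variation gives differentiability almost everywhere; integrability of the derivative
comes from its real and imaginary parts. -/
theorem of_absolutelyContinuous
    (hac : ∀ a b : ℝ, 0 < a → a ≤ b → AbsolutelyContinuousOnInterval g a b) :
    HasACDeriv g (deriv g) := by
  have hd : ∀ a b : ℝ, 0 < a → a ≤ b → ∀ᵐ t, t ∈ uIcc a b → HasDerivAt g (deriv g t) t :=
    fun a b ha hab =>
      (hac a b ha hab).boundedVariationOn.ae_differentiableAt_of_mem_uIcc.mono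
        fun t ht hm => (ht hm).hasDerivAt
  refine of_ae (fun a b ha hab => ?_) hac hd
  have hre := ((hac a b ha hab).comp_lipschitz dist_re_le).intervalIntegrable_deriv
  have him := ((hac a b ha hab).comp_lipschitz dist_im_le).intervalIntegrable_deriv
  have hre' : IntervalIntegrable (fun t => ((deriv (fun t => (g t).re) t : ℝ) : ℂ)) volume a b :=
    ⟨hre.1.ofReal, hre.2.ofReal⟩
  have him' : IntervalIntegrable (fun t => ((deriv (fun t => (g t).im) t : ℝ) : ℂ)) volume a b :=
    ⟨him.1.ofReal, him.2.ofReal⟩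
  refine (hre'.add (him'.mul_const Complex.I)).congr_ae ?_
  rw [Filter.EventuallyEq, ae_restrict_iff' measurableSet_uIoc]
  filter_upwards [hd a b ha hab] with t ht hm
  have h := ht (uIoc_subset_uIcc hm)
  have h1 : HasDerivAt (fun t => (g t).re) (deriv g t).re t := by
    have := (Complex.reCLM.hasFDerivAt (x := g t)).comp_hasDerivAt t h
    exact this
  have h2 : HasDerivAt (fun t => (g t).im) (deriv g t).im t := by
    have := (Complex.imCLM.hasFDerivAt (x := g t)).comp_hasDerivAt t h
    exact this
  simp only [h1.deriv, h2.deriv, Complex.re_add_im]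

theorem of_hasDerivAt (hd : ∀ t, 0 < t → HasDerivAt g (γ t) t) (hc : ContinuousOn γ (Ioi 0)) :
    HasACDeriv g γ := by
  intro a b ha hab
  have hsub : uIcc a b ⊆ Ioi 0 := by
    rw [uIcc_of_le hab]; exact fun t ht => ha.trans_le ht.1
  have hi : IntervalIntegrable γ volume a b := (hc.mono hsub).intervalIntegrable
  exact ⟨hi, intervalIntegral.integral_eq_sub_of_hasDerivAt (fun t ht => hd t (hsub ht)) hi⟩

theorem continuousOn (h : HasACDeriv g γ) : ContinuousOn g (Ioi 0) := by
  intro t ht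
  have ht : 0 < t := ht
  have hac := (h.absolutelyContinuousOnInterval (a := t / 2) (b := 2 * t) (by positivity)
    (by linarith)).continuousOn
  rw [uIcc_of_le (by linarith)] at hac
  exact (hac.continuousAt (Icc_mem_nhds (by linarith) (by linarith))).continuousWithinAt

theorem congr (h : HasACDeriv g₁ γ₁) (hg : ∀ t, 0 < t → g₂ t = g₁ t)
    (hγ : ∀ t, 0 < t → γ₂ t = γ₁ t) : HasACDeriv g₂ γ₂ := by
  intro a b ha hab
  have he : EqOn γ₁ γ₂ (uIcc a b) := fun t ht => by
    rw [uIcc_of_le hab] at ht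
    exact (hγ t (ha.trans_le ht.1)).symm
  obtain ⟨h1, h2⟩ := h a b ha hab
  refine ⟨h1.congr (he.mono uIoc_subset_uIcc), ?_⟩
  rw [← intervalIntegral.integral_congr he, h2, hg a ha, hg b (ha.trans_le hab)]

theorem add (h₁ : HasACDeriv g₁ γ₁) (h₂ : HasACDeriv g₂ γ₂) :
    HasACDeriv (fun t => g₁ t + g₂ t) (fun t => γ₁ t + γ₂ t) := by
  intro a b ha hab
  obtain ⟨i1, e1⟩ := h₁ a b ha hab
  obtain ⟨i2, e2⟩ := h₂ a b ha hab
  refine ⟨i1.add i2, ?_⟩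
  rw [intervalIntegral.integral_add i1 i2, e1, e2]; ring

theorem const_mul (h : HasACDeriv g γ) (c : ℂ) :
    HasACDeriv (fun t => c * g t) (fun t => c * γ t) := by
  intro a b ha hab
  obtain ⟨i1, e1⟩ := h a b ha hab
  refine ⟨i1.const_mul c, ?_⟩
  rw [intervalIntegral.integral_const_mul, e1]; ring

theorem ofReal_mul (h : HasACDeriv g γ) {u u' : ℝ → ℝ} (hu : ∀ t, 0 < t → HasDerivAt u (u' t) t)
    (hu' : ContinuousOn u' (Ioi 0)) :
    HasACDeriv (fun t => (u t : ℂ) * g t) (fun t => (u' t : ℂ) * g t + (u t : ℂ) * γ t) := by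
  have hsub : ∀ {a b : ℝ}, 0 < a → a ≤ b → uIcc a b ⊆ Ioi 0 := fun ha hab => by
    rw [uIcc_of_le hab]; exact fun t ht => ha.trans_le ht.1
  have hcu : ContinuousOn u (Ioi 0) := fun t ht => (hu t ht).continuousAt.continuousWithinAt
  have hU : HasACDeriv (fun t => (u t : ℂ)) (fun t => (u' t : ℂ)) :=
    of_hasDerivAt (fun t ht => (hu t ht).ofReal_comp)
      (Complex.continuous_ofReal.comp_continuousOn hu')
  refine of_ae (fun a b ha hab => ?_) (fun a b ha hab => ?_) (fun a b ha hab => ?_)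
  · refine IntervalIntegrable.add ?_ ?_
    · exact (((Complex.continuous_ofReal.comp_continuousOn hu').mul
        h.continuousOn).mono (hsub ha hab)).intervalIntegrable
    · exact (h a b ha hab).1.continuousOn_mul
        ((Complex.continuous_ofReal.comp_continuousOn hcu).mono (hsub ha hab))
  · exact (hU.absolutelyContinuousOnInterval ha hab).smul
      (h.absolutelyContinuousOnInterval ha hab)
  · filter_upwards [h.ae_hasDerivAt ha hab] with t ht hm
    exact ((hu t (hsub ha hab hm)).ofReal_comp).mul (ht hm)

/-- The one-dimensional change of variables for an injective map, which asks no more of γ than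
integrability. -/
theorem comp_rpow (h : HasACDeriv g γ) {q : ℝ} (hq : 0 < q) :
    HasACDeriv (fun s => g (s ^ q)) (fun s => ((q * s ^ (q - 1) : ℝ) : ℂ) * γ (s ^ q)) := by
  intro a b ha hab
  have hb : 0 < b := ha.trans_le hab
  have hab' : a ^ q ≤ b ^ q := Real.rpow_le_rpow ha.le hab hq.le
  obtain ⟨i1, e1⟩ := h (a ^ q) (b ^ q) (by positivity) hab'
  have himg : (fun s : ℝ => s ^ q) '' Ioc a b = Ioc (a ^ q) (b ^ q) := by
    ext y
    constructor
    · rintro ⟨s, hs, rfl⟩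
      exact ⟨Real.rpow_lt_rpow ha.le hs.1 hq, Real.rpow_le_rpow (ha.trans hs.1).le hs.2 hq.le⟩
    · intro hy
      have hy0 : 0 < y := lt_trans (by positivity) hy.1
      refine ⟨y ^ q⁻¹, ⟨?_, ?_⟩, Real.rpow_inv_rpow hy0.le hq.ne'⟩
      · rw [Real.lt_rpow_inv_iff_of_pos ha.le hy0.le hq]; exact hy.1
      · rw [Real.rpow_inv_le_iff_of_pos hy0.le hb.le hq]; exact hy.2
  have hder : ∀ s ∈ Ioc a b, HasDerivWithinAt (fun s : ℝ => s ^ q) (q * s ^ (q - 1)) (Ioc a b) s :=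
    fun s hs => (Real.hasDerivAt_rpow_const (Or.inl (ha.trans hs.1).ne')).hasDerivWithinAt
  have hinj : InjOn (fun s : ℝ => s ^ q) (Ioc a b) := fun s hs t ht hst =>
    (Real.rpow_left_inj (ha.trans hs.1).le (ha.trans ht.1).le hq.ne').1 hst
  have hcongr : EqOn (fun s => |q * s ^ (q - 1)| • γ (s ^ q))
      (fun s => ((q * s ^ (q - 1) : ℝ) : ℂ) * γ (s ^ q)) (Ioc a b) := fun s hs => by
    have hs0 : 0 < s := ha.trans hs.1
    simp only
    rw [abs_of_nonneg (by positivity), Complex.real_smul]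
  constructor
  · rw [intervalIntegrable_iff_integrableOn_Ioc_of_le hab]
    rw [intervalIntegrable_iff_integrableOn_Ioc_of_le hab', ← himg,
      integrableOn_image_iff_integrableOn_abs_deriv_smul measurableSet_Ioc hder hinj] at i1
    exact i1.congr_fun hcongr measurableSet_Ioc
  · rw [intervalIntegral.integral_of_le hab'] at e1
    rw [intervalIntegral.integral_of_le hab, ← e1, ← himg,
      integral_image_eq_integral_abs_deriv_smul measurableSet_Ioc hder hinj]
    exact (setIntegral_congr_fun measurableSet_Ioc hcongr).symm

theorem comp_mul_left (h : HasACDeriv g γ) {r : ℝ} (hr : 0 < r) :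
    HasACDeriv (fun s => g (r * s)) (fun s => (r : ℂ) * γ (r * s)) := by
  intro a b ha hab
  obtain ⟨i1, e1⟩ := h (r * a) (r * b) (by positivity) (by gcongr)
  constructor
  · have := (i1.comp_mul_left (c := r)).const_mul (r : ℂ)
    simpa [hr.ne'] using this
  · have hrc : (r : ℂ) ≠ 0 := by exact_mod_cast hr.ne'
    rw [intervalIntegral.integral_const_mul, ← e1,
      intervalIntegral.integral_comp_mul_left γ hr.ne', Complex.real_smul, Complex.ofReal_inv,
      mul_inv_cancel_left₀ hrc]

end HasACDeriv

/-! ### Jets of successive derivatives: power substitution and products -/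

/-- `D 0, D 1, …, D d` are successive derivatives on `(0, ∞)`, in the locally absolutely
continuous sense. -/
def IsACJet (d : ℕ) (D : ℕ → ℝ → ℂ) : Prop := ∀ i < d, HasACDeriv (D i) (D (i + 1))

/-- All links but the last are classical, with continuous derivatives; only the last one rests on
absolute continuity. -/
theorem HasLocACDeriv.isACJet {d : ℕ} (hd : 1 ≤ d) {f : ℝ → ℂ} (h : HasLocACDeriv (d - 1) f) :
    IsACJet d (fun i => iteratedDeriv i f) := by
  intro i hi
  beta_reduce
  rcases lt_or_eq_of_le (Nat.le_sub_one_of_lt hi) with hlt | rfl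
  · have hu : UniqueDiffOn ℝ (Ioi (0 : ℝ)) := isOpen_Ioi.uniqueDiffOn
    have he : ∀ j, EqOn (iteratedDerivWithin j f (Ioi 0)) (iteratedDeriv j f) (Ioi 0) :=
      fun j => iteratedDerivWithin_of_isOpen isOpen_Ioi
    refine HasACDeriv.of_hasDerivAt (fun t ht => ?_) ?_
    · have h1 := h.1.differentiableOn_iteratedDerivWithin (m := i) (by exact_mod_cast hlt) hu
      have h2 : DifferentiableAt ℝ (iteratedDeriv i f) t :=
        ((h1 t ht).differentiableAt (isOpen_Ioi.mem_nhds ht)).congr_of_eventuallyEq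
          (eventually_of_mem (isOpen_Ioi.mem_nhds ht) fun s hs => (he i hs).symm)
      rw [iteratedDeriv_succ]
      exact h2.hasDerivAt
    · exact (h.1.continuousOn_iteratedDerivWithin (m := i + 1)
        (by exact_mod_cast hlt) hu).congr (he _).symm
  · rw [iteratedDeriv_succ]
    exact HasACDeriv.of_absolutelyContinuous h.2

/-- The iterated derivatives of `s ↦ s ^ b * D 0 (s ^ q)`. -/
noncomputable def powJet (q : ℝ) : ℕ → ℝ → (ℕ → ℝ → ℂ) → ℝ → ℂ
  | 0, b, D => fun s => ((s ^ b : ℝ) : ℂ) * D 0 (s ^ q)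
  | n + 1, b, D => fun s =>
      (b : ℂ) * powJet q n (b - 1) D s + (q : ℂ) * powJet q n (b + q - 1) (fun i => D (i + 1)) s

theorem hasACDeriv_powJet {q : ℝ} (hq : 0 < q) (n : ℕ) (b : ℝ) (D : ℕ → ℝ → ℂ)
    (hD : IsACJet (n + 1) D) : HasACDeriv (powJet q n b D) (powJet q (n + 1) b D) := by
  induction n generalizing b D with
  | zero =>
    have h := ((hD 0 (by norm_num)).comp_rpow hq).ofReal_mul (u := fun s => s ^ b)
      (u' := fun s => b * s ^ (b - 1))
      (fun t ht => Real.hasDerivAt_rpow_const (Or.inl ht.ne'))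
      (continuousOn_const.mul fun t ht =>
        (Real.continuousAt_rpow_const t _ (Or.inl (ne_of_gt ht))).continuousWithinAt)
    refine h.congr (fun t _ => rfl) fun t ht => ?_
    simp only [powJet]
    rw [show b + q - 1 = b + (q - 1) by ring, Real.rpow_add ht]
    push_cast
    ring
  | succ n ih =>
    exact ((ih (b - 1) D fun i hi => hD i (by omega)).const_mul b).add
      ((ih (b + q - 1) (fun i => D (i + 1)) fun i hi => hD (i + 1) (by omega)).const_mul q)

/-- Each differentiation either lowers the power of s by one, or passes from D j to D (j+1) at the
price of s^{q-1}. A term with j passages thus carries s^{b+jq-n}. -/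
theorem exists_norm_powJet_le (q : ℝ) (n : ℕ) (b : ℝ) :
    ∃ C : ℝ, 0 ≤ C ∧ ∀ (D : ℕ → ℝ → ℂ) (s : ℝ), 0 < s →
      ‖powJet q n b D s‖ ≤ C * ∑ j ∈ Finset.range (n + 1), s ^ (b + j * q - n) * ‖D j (s ^ q)‖ := by
  induction n generalizing b with
  | zero =>
    refine ⟨1, zero_le_one, fun D s hs => ?_⟩
    simp [powJet, abs_of_nonneg (Real.rpow_nonneg hs.le b)]
  | succ n ih =>
    obtain ⟨C₁, hC₁, h₁⟩ := ih (b - 1)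
    obtain ⟨C₂, hC₂, h₂⟩ := ih (b + q - 1)
    refine ⟨|b| * C₁ + |q| * C₂, by positivity, fun D s hs => ?_⟩
    simp only [powJet]
    refine (norm_add_le _ _).trans ?_
    rw [norm_mul, norm_mul, Complex.norm_real, Complex.norm_real, Real.norm_eq_abs,
      Real.norm_eq_abs, add_mul]
    have hnn : ∀ j : ℕ, 0 ≤ s ^ (b + j * q - (n + 1 : ℕ)) * ‖D j (s ^ q)‖ := fun j => by
      positivity
    refine add_le_add ?_ ?_
    · rw [mul_assoc]
      refine mul_le_mul_of_nonneg_left ((h₁ D s hs).trans ?_) (abs_nonneg b)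
      refine mul_le_mul_of_nonneg_left ?_ hC₁
      rw [Finset.sum_range_succ _ (n + 1)]
      refine le_trans (le_of_eq (Finset.sum_congr rfl fun j _ => ?_))
        (le_add_of_nonneg_right (hnn _))
      congr 2
      push_cast; ring
    · rw [mul_assoc]
      refine mul_le_mul_of_nonneg_left ((h₂ _ s hs).trans ?_) (abs_nonneg q)
      refine mul_le_mul_of_nonneg_left ?_ hC₂
      rw [Finset.sum_range_succ' _ (n + 1)]
      refine le_trans (le_of_eq (Finset.sum_congr rfl fun j _ => ?_))
        (le_add_of_nonneg_right (hnn _))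
      congr 2
      push_cast; ring

/-- Bound for the derivatives of `s ↦ f (s ^ q)`, where no undifferentiated term appears. -/
theorem exists_norm_powJet_zero_le (q : ℝ) (n : ℕ) :
    ∃ C : ℝ, 0 ≤ C ∧ ∀ (D : ℕ → ℝ → ℂ) (s : ℝ), 0 < s →
      ‖powJet q (n + 1) 0 D s‖ ≤ C * ∑ j ∈ Finset.range (n + 1),
        s ^ ((j + 1 : ℕ) * q - (n + 1 : ℕ)) * ‖D (j + 1) (s ^ q)‖ := by
  -- At b = 0 the branch with coefficient b dies, and the other one starts from exponent 0 + q - 1.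
  obtain ⟨C, hC, h⟩ := exists_norm_powJet_le q n (0 + q - 1)
  refine ⟨|q| * C, by positivity, fun D s hs => ?_⟩
  simp only [powJet, Complex.ofReal_zero, zero_mul, zero_add] at h ⊢
  rw [norm_mul, Complex.norm_real, Real.norm_eq_abs, mul_assoc]
  refine mul_le_mul_of_nonneg_left ((h _ s hs).trans (le_of_eq ?_)) (abs_nonneg q)
  congr 1
  refine Finset.sum_congr rfl fun j _ => ?_
  congr 2
  push_cast; ring

/-- The iterated derivatives of the product `X 0 * D 0`. -/
noncomputable def mulJet : ℕ → (ℕ → ℝ → ℝ) → (ℕ → ℝ → ℂ) → ℝ → ℂ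
  | 0, X, D => fun s => (X 0 s : ℂ) * D 0 s
  | n + 1, X, D => fun s => mulJet n (fun i => X (i + 1)) D s + mulJet n X (fun i => D (i + 1)) s

theorem hasACDeriv_mulJet (n : ℕ) (X : ℕ → ℝ → ℝ) (D : ℕ → ℝ → ℂ)
    (hX : ∀ i t, HasDerivAt (X i) (X (i + 1) t) t) (hD : IsACJet (n + 1) D) :
    HasACDeriv (mulJet n X D) (mulJet (n + 1) X D) := by
  induction n generalizing X D with
  | zero =>
    exact (hD 0 (by norm_num)).ofReal_mul (fun t _ => hX 0 t)
      fun t _ => (hX 1 t).continuousAt.continuousWithinAt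
  | succ n ih =>
    exact (ih (fun i => X (i + 1)) D (fun i => hX (i + 1)) fun i hi => hD i (by omega)).add
      (ih X (fun i => D (i + 1)) hX fun i hi => hD (i + 1) (by omega))

/-- The recursion is Leibniz's rule with its 2^n terms left uncollected. -/
theorem norm_mulJet_le (n : ℕ) (X : ℕ → ℝ → ℝ) (D : ℕ → ℝ → ℂ) {s c c' : ℝ} (hc : 0 ≤ c)
    (hX : ∀ i ≤ n, |X i s| ≤ c) (hD : ∀ i ≤ n, ‖D i s‖ ≤ c') :
    ‖mulJet n X D s‖ ≤ 2 ^ n * (c * c') := by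
  induction n generalizing X D with
  | zero =>
    simp only [mulJet, norm_mul, Complex.norm_real, Real.norm_eq_abs, pow_zero, one_mul]
    exact mul_le_mul (hX 0 le_rfl) (hD 0 le_rfl) (norm_nonneg _) hc
  | succ n ih =>
    refine (norm_add_le _ _).trans ?_
    have h1 := ih (fun i => X (i + 1)) D (fun i hi => hX _ (by omega)) fun i hi => hD _ (by omega)
    have h2 := ih X (fun i => D (i + 1)) (fun i hi => hX _ (by omega)) fun i hi => hD _ (by omega)
    rw [pow_succ]
    linarith

theorem mulJet_eq_zero (n : ℕ) (X : ℕ → ℝ → ℝ) (D : ℕ → ℝ → ℂ) {s : ℝ}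
    (hX : ∀ i ≤ n, X i s = 0) : mulJet n X D s = 0 := by
  induction n generalizing X D with
  | zero => simp [mulJet, hX 0 le_rfl]
  | succ n ih =>
    simp only [mulJet]
    rw [ih _ _ fun i hi => hX _ (by omega), ih _ _ fun i hi => hX _ (by omega), add_zero]

/-! ### Iterated tail integrals as integrals over the orthant -/

/-- Lebesgue measure on the open positive orthant. -/
noncomputable def orthantMeasure (n : ℕ) : Measure (Fin n → ℝ) :=
  Measure.pi fun _ => volume.restrict (Ioi 0)

instance (n : ℕ) : SigmaFinite (orthantMeasure n) := by
  unfold orthantMeasure; infer_instance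

theorem orthantMeasure_eq (n : ℕ) :
    orthantMeasure n = volume.restrict (Set.pi univ fun _ => Ioi 0) := by
  rw [orthantMeasure, volume_pi, Measure.restrict_pi_pi]

theorem measurePreserving_orthant_cons (n : ℕ) :
    MeasurePreserving (MeasurableEquiv.piFinSuccAbove (fun _ : Fin (n + 1) => ℝ) 0).symm
      ((volume.restrict (Ioi 0)).prod (orthantMeasure n)) (orthantMeasure (n + 1)) :=
  (measurePreserving_piFinSuccAbove (fun _ : Fin (n + 1) => volume.restrict (Ioi (0 : ℝ))) 0).symm

theorem sum_piFinSuccAbove_symm (n : ℕ) (q : ℝ × (Fin n → ℝ)) :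
    ∑ i, (MeasurableEquiv.piFinSuccAbove (fun _ : Fin (n + 1) => ℝ) 0).symm q i =
      q.1 + ∑ i, q.2 i := by
  simp [Fin.sum_univ_succ, MeasurableEquiv.piFinSuccAbove_symm_apply, Fin.insertNthEquiv]

theorem lintegral_orthant_succ (n : ℕ) (φ : ℝ → ℝ≥0∞) (hφ : Measurable φ) (s : ℝ) :
    ∫⁻ w, φ (s + ∑ i, w i) ∂orthantMeasure (n + 1) =
      ∫⁻ u in Ioi 0, ∫⁻ w, φ (s + u + ∑ i, w i) ∂orthantMeasure n := by
  rw [← (measurePreserving_orthant_cons n).lintegral_comp_emb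
    (MeasurableEquiv.measurableEmbedding _)]
  simp only [sum_piFinSuccAbove_symm, ← add_assoc]
  rw [lintegral_prod]
  fun_prop

/-- The sum of n + 1 positive coordinates has density t^n/n!, bounded here by t^n. One more variable
turns the integral into one over tails, and exchanging the order leaves an interval of length t - s
≤ t. -/
theorem lintegral_orthant_le (n : ℕ) (φ : ℝ → ℝ≥0∞) (hφ : Measurable φ) {s : ℝ} (hs : 0 ≤ s) :
    ∫⁻ w, φ (s + ∑ i, w i) ∂orthantMeasure (n + 1) ≤
      ∫⁻ t in Ioi s, ENNReal.ofReal t ^ n * φ t := by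
  induction n generalizing s with
  | zero =>
    rw [lintegral_orthant_succ _ _ hφ]
    simp only [Finset.univ_eq_empty, Finset.sum_empty, add_zero, lintegral_const, pow_zero,
      one_mul]
    have h1 : (orthantMeasure 0) univ = 1 := by simp [orthantMeasure]
    simp only [h1, mul_one]
    have h := (measurePreserving_add_left (volume : Measure ℝ) s).setLIntegral_comp_preimage_emb
      (MeasurableEquiv.addLeft s).measurableEmbedding φ (Ioi s)
    rw [← h]
    refine le_of_eq ?_
    congr 2
    ext; simp
  | succ n ih =>
    rw [lintegral_orthant_succ _ _ hφ]
    set Φ : ℝ → ℝ≥0∞ := fun t => ENNReal.ofReal t ^ n * φ t with hΦ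
    have hΦm : Measurable Φ := by fun_prop
    calc ∫⁻ u in Ioi 0, ∫⁻ w, φ (s + u + ∑ i, w i) ∂orthantMeasure (n + 1)
        ≤ ∫⁻ u in Ioi 0, ∫⁻ t in Ioi (s + u), Φ t :=
          setLIntegral_mono' measurableSet_Ioi fun u hu => ih (add_nonneg hs (le_of_lt hu))
      _ = ∫⁻ u, ∫⁻ t, {q : ℝ × ℝ | 0 < q.1 ∧ s + q.1 < q.2}.indicator (fun q => Φ q.2) (u, t) := by
          rw [← lintegral_indicator measurableSet_Ioi]
          refine lintegral_congr fun u => ?_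
          by_cases hu : 0 < u
          · rw [indicator_of_mem (show u ∈ Ioi 0 from hu), ← lintegral_indicator measurableSet_Ioi]
            refine lintegral_congr fun t => ?_
            simp [indicator_apply, hu]
          · rw [indicator_of_notMem (show u ∉ Ioi 0 from hu)]
            simp [hu]
      _ = ∫⁻ t, ∫⁻ u, {q : ℝ × ℝ | 0 < q.1 ∧ s + q.1 < q.2}.indicator (fun q => Φ q.2) (u, t) := by
          apply lintegral_lintegral_swap
          refine Measurable.aemeasurable (Measurable.indicator (hΦm.comp measurable_snd) ?_)
          exact (measurableSet_lt measurable_const measurable_fst).inter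
            (measurableSet_lt (by fun_prop) measurable_snd)
      _ ≤ ∫⁻ t, (Ioi s).indicator (fun t => ENNReal.ofReal t ^ (n + 1) * φ t) t := by
          refine lintegral_mono fun t => ?_
          have h1 : ∀ u, {q : ℝ × ℝ | 0 < q.1 ∧ s + q.1 < q.2}.indicator (fun q => Φ q.2) (u, t) =
              (Ioo 0 (t - s)).indicator (fun _ => Φ t) u := fun u => by
            simp only [indicator_apply, mem_ofPred_eq, mem_Ioo, lt_sub_iff_add_lt, add_comm s]
          simp only [h1]
          rw [lintegral_indicator_const measurableSet_Ioo, Real.volume_Ioo, sub_zero]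
          by_cases ht : s < t
          · rw [indicator_of_mem (show t ∈ Ioi s from ht), hΦ, pow_succ]
            calc _ ≤ ENNReal.ofReal t ^ n * φ t * ENNReal.ofReal t := by
                  gcongr; linarith
              _ = _ := by ring
          · rw [ENNReal.ofReal_of_nonpos (by linarith)]; simp
      _ = _ := by rw [lintegral_indicator measurableSet_Ioi]

theorem HasACDeriv.tendsto_integral {g γ : ℝ → ℂ} (h : HasACDeriv g γ) {s : ℝ} (hs : 0 < s)
    (hi : IntegrableOn γ (Ioi s)) :
    Tendsto g atTop (𝓝 (g s + ∫ t in Ioi s, γ t)) := by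
  have h1 := (intervalIntegral_tendsto_integral_Ioi s hi tendsto_id).const_add (g s)
  refine h1.congr' ?_
  filter_upwards [eventually_ge_atTop s] with b hb
  rw [id, (h s b hs hb).2]; ring

/-- A function vanishing at infinity together with its derivatives is an iterated tail integral
of its top derivative. -/
theorem IsACJet.eq_integral_orthant {n : ℕ} {D : ℕ → ℝ → ℂ} (hD : IsACJet n D)
    (hm : Measurable (D n)) (h0 : ∀ i < n, Tendsto (D i) atTop (𝓝 0))
    (hi : ∀ s, 0 < s → ∫⁻ t in Ioi s, ENNReal.ofReal t ^ (n - 1) * ‖D n t‖ₑ < ∞) {s : ℝ}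
    (hs : 0 < s) :
    D 0 s = (-1) ^ n * ∫ w, D n (s + ∑ i, w i) ∂orthantMeasure n := by
  induction n generalizing D s with
  | zero => simp [orthantMeasure, measureReal_def]
  | succ n ih =>
    have hfin : ∀ s, 0 < s → ∫⁻ w, ‖D (n + 1) (s + ∑ i, w i)‖ₑ ∂orthantMeasure (n + 1) < ∞ :=
      fun s hs => (lintegral_orthant_le n (fun t => ‖D (n + 1) t‖ₑ) hm.enorm hs.le).trans_lt
        (hi s hs)
    have hIH : ∀ t, 0 < t →
        D 1 t = (-1) ^ n * ∫ w, D (n + 1) (t + ∑ i, w i) ∂orthantMeasure n := fun t ht => by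
      refine ih (D := fun i => D (i + 1)) (fun i hin => hD (i + 1) (by omega)) hm
        (fun i hin => h0 (i + 1) (by omega)) (fun s hs => ?_) ht
      rcases Nat.eq_zero_or_pos n with rfl | hn
      · exact hi s hs
      -- The induction hypothesis asks for one power of t less: on t > s one has t^m ≤ s⁻¹ t^{m+1}.
      · obtain ⟨m, rfl⟩ : ∃ m, n = m + 1 := ⟨n - 1, by omega⟩
        have h1 := ENNReal.mul_lt_top (ENNReal.ofReal_lt_top (r := s⁻¹)) (hi s hs)
        rw [← lintegral_const_mul' _ _ ENNReal.ofReal_ne_top] at h1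
        refine lt_of_le_of_lt (setLIntegral_mono' measurableSet_Ioi fun t ht => ?_) h1
        have ht' : s < t := ht
        simp only [Nat.add_sub_cancel]
        have h2 : 1 ≤ ENNReal.ofReal s⁻¹ * ENNReal.ofReal t := by
          rw [← ENNReal.ofReal_mul (by positivity), ← ENNReal.ofReal_one]
          apply ENNReal.ofReal_le_ofReal
          rw [inv_mul_eq_div, le_div_iff₀ hs]; linarith
        calc _ = 1 * (ENNReal.ofReal t ^ m * ‖D (m + 1 + 1) t‖ₑ) := (one_mul _).symm
          _ ≤ (ENNReal.ofReal s⁻¹ * ENNReal.ofReal t) *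
              (ENNReal.ofReal t ^ m * ‖D (m + 1 + 1) t‖ₑ) := by gcongr
          _ = _ := by rw [pow_succ]; ring
    have hint : Integrable (fun w => D (n + 1) (s + ∑ i, w i)) (orthantMeasure (n + 1)) :=
      ⟨(hm.comp (by fun_prop)).aestronglyMeasurable, hfin s hs⟩
    have hint2 : Integrable (fun q : ℝ × (Fin n → ℝ) => D (n + 1) (s + q.1 + ∑ i, q.2 i))
        ((volume.restrict (Ioi 0)).prod (orthantMeasure n)) := by
      have := ((measurePreserving_orthant_cons n).integrable_comp_emb
        (MeasurableEquiv.measurableEmbedding _)).2 hint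
      refine this.congr (ae_of_all _ fun q => ?_)
      simp only [Function.comp, sum_piFinSuccAbove_symm, add_assoc]
    have hint3 := hint2.integral_prod_left
    have heq : ∀ u ∈ Ioi (0 : ℝ), (-1) ^ n *
        ∫ w, D (n + 1) (s + u + ∑ i, w i) ∂orthantMeasure n = D 1 (u + s) := fun u hu => by
      rw [← hIH _ (add_pos hs hu), add_comm]
    have hint4 : IntegrableOn (fun u => D 1 (u + s)) (Ioi 0) :=
      IntegrableOn.congr_fun (hint3.const_mul ((-1) ^ n)) heq measurableSet_Ioi
    have hint5 : IntegrableOn (D 1) (Ioi s) := by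
      have := (measurePreserving_add_right (volume : Measure ℝ) s).integrableOn_comp_preimage
        (MeasurableEquiv.addRight s).measurableEmbedding (f := D 1) (s := Ioi s)
      rw [← this]
      simpa [Function.comp_def] using hint4
    -- One more integration from infinity; its variable becomes the first coordinate of the larger
    -- orthant.
    have hlim := tendsto_nhds_unique ((hD 0 (by omega)).tendsto_integral hs hint5)
      (h0 0 (by omega))
    have hD0 : D 0 s = -∫ t in Ioi s, D 1 t := eq_neg_of_add_eq_zero_left hlim
    have hshift : ∫ t in Ioi s, D 1 t = ∫ u in Ioi 0, D 1 (u + s) := by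
      have := (measurePreserving_add_right (volume : Measure ℝ) s).setIntegral_preimage_emb
        (MeasurableEquiv.addRight s).measurableEmbedding (D 1) (Ioi s)
      rw [← this]
      simp
    rw [hD0, hshift, ← setIntegral_congr_fun measurableSet_Ioi heq, integral_const_mul, pow_succ,
      ← (measurePreserving_orthant_cons n).integral_comp (MeasurableEquiv.measurableEmbedding _)]
    simp only [sum_piFinSuccAbove_symm, ← add_assoc]
    rw [integral_prod _ hint2]
    ring

/-! ### Lacunary bounds and decay of lower derivatives -/

/-- The suprema of `φ` on the intervals `[ρ^k, ρ^(k+1))`, weighted by `ρ^(k n)`, are summable. -/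
def LacunaryBound (ρ : ℝ) (n : ℕ) (φ : ℝ → ℂ) : Prop :=
  ∃ M : ℤ → ℝ≥0∞, ∑' k, ENNReal.ofReal (ρ ^ k) ^ n * M k ≠ ∞ ∧
    ∀ k, ∀ t ∈ Ico (ρ ^ k) (ρ ^ (k + 1)), ‖φ t‖ₑ ≤ M k

theorem exists_mem_Ico_zpow_nat {ρ : ℝ} (hρ : 1 < ρ) {k : ℤ} {t : ℝ} (ht : ρ ^ k ≤ t) :
    ∃ i : ℕ, t ∈ Ico (ρ ^ (k + i)) (ρ ^ (k + i + 1)) := by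
  have hρ0 : 0 < ρ := by linarith
  obtain ⟨j, hj⟩ := exists_mem_Ico_zpow (lt_of_lt_of_le (zpow_pos hρ0 k) ht) hρ
  have hkj : k ≤ j := by
    have := (zpow_lt_zpow_iff_right₀ hρ).1 (ht.trans_lt hj.2)
    omega
  refine ⟨(j - k).toNat, ?_⟩
  rw [Int.toNat_of_nonneg (by omega)]
  simpa using hj

theorem lintegral_Ici_zpow_le {ρ : ℝ} (hρ : 1 < ρ) {φ : ℝ → ℂ} {M : ℤ → ℝ≥0∞}
    (hM : ∀ k, ∀ t ∈ Ico (ρ ^ k) (ρ ^ (k + 1)), ‖φ t‖ₑ ≤ M k) (k : ℤ) :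
    ∫⁻ t in Ici (ρ ^ k), ‖φ t‖ₑ ≤
      ENNReal.ofReal (ρ - 1) * ∑' i : ℕ, ENNReal.ofReal (ρ ^ (k + i)) * M (k + i) := by
  have hρ0 : 0 < ρ := by linarith
  calc ∫⁻ t in Ici (ρ ^ k), ‖φ t‖ₑ
      ≤ ∫⁻ t in ⋃ i : ℕ, Ico (ρ ^ (k + i)) (ρ ^ (k + i + 1)), ‖φ t‖ₑ :=
        lintegral_mono_set fun t ht => mem_iUnion.2 (exists_mem_Ico_zpow_nat hρ ht)
    _ ≤ ∑' i : ℕ, ∫⁻ t in Ico (ρ ^ (k + i)) (ρ ^ (k + i + 1)), ‖φ t‖ₑ :=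
        lintegral_iUnion_le _ _
    _ ≤ ∑' i : ℕ, ENNReal.ofReal (ρ - 1) * (ENNReal.ofReal (ρ ^ (k + i)) * M (k + i)) := by
        refine ENNReal.tsum_le_tsum fun i => ?_
        refine (setLIntegral_mono' measurableSet_Ico (hM _)).trans (le_of_eq ?_)
        rw [setLIntegral_const, Real.volume_Ico, zpow_add_one₀ hρ0.ne',
          show ρ ^ (k + i) * ρ - ρ ^ (k + i) = (ρ - 1) * ρ ^ (k + i) by ring,
          ENNReal.ofReal_mul (by linarith)]
        ring
    _ = _ := ENNReal.tsum_mul_left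

theorem LacunaryBound.lintegral_lt_top {ρ : ℝ} (hρ : 1 < ρ) {n : ℕ} {φ : ℝ → ℂ}
    (h : LacunaryBound ρ (n + 1) φ) :
    ∫⁻ t in Ioi 0, ENNReal.ofReal t ^ n * ‖φ t‖ₑ < ∞ := by
  obtain ⟨M, hs, hM⟩ := h
  have hρ0 : 0 < ρ := by linarith
  calc ∫⁻ t in Ioi 0, ENNReal.ofReal t ^ n * ‖φ t‖ₑ
      ≤ ∫⁻ t in ⋃ k : ℤ, Ico (ρ ^ k) (ρ ^ (k + 1)), ENNReal.ofReal t ^ n * ‖φ t‖ₑ :=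
        lintegral_mono_set fun t ht => mem_iUnion.2 (exists_mem_Ico_zpow ht hρ)
    _ ≤ ∑' k : ℤ, ∫⁻ t in Ico (ρ ^ k) (ρ ^ (k + 1)), ENNReal.ofReal t ^ n * ‖φ t‖ₑ :=
        lintegral_iUnion_le _ _
    _ ≤ ∑' k : ℤ, (ENNReal.ofReal ρ ^ n * ENNReal.ofReal (ρ - 1)) *
          (ENNReal.ofReal (ρ ^ k) ^ (n + 1) * M k) := by
        refine ENNReal.tsum_le_tsum fun k => ?_
        calc ∫⁻ t in Ico (ρ ^ k) (ρ ^ (k + 1)), ENNReal.ofReal t ^ n * ‖φ t‖ₑ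
            ≤ ∫⁻ _t in Ico (ρ ^ k) (ρ ^ (k + 1)), ENNReal.ofReal (ρ ^ (k + 1)) ^ n * M k := by
              refine setLIntegral_mono' measurableSet_Ico fun t ht => ?_
              gcongr
              · exact ht.2.le
              · exact hM k t ht
          _ = _ := by
              rw [setLIntegral_const, Real.volume_Ico, zpow_add_one₀ hρ0.ne',
                show ρ ^ k * ρ - ρ ^ k = (ρ - 1) * ρ ^ k by ring,
                ENNReal.ofReal_mul (sub_nonneg.2 hρ.le), ENNReal.ofReal_mul (zpow_nonneg hρ0.le k)]
              ring
    _ = (ENNReal.ofReal ρ ^ n * ENNReal.ofReal (ρ - 1)) *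
          ∑' k : ℤ, ENNReal.ofReal (ρ ^ k) ^ (n + 1) * M k := ENNReal.tsum_mul_left
    _ < ∞ := ENNReal.mul_lt_top (ENNReal.mul_lt_top (ENNReal.pow_lt_top ENNReal.ofReal_lt_top)
        ENNReal.ofReal_lt_top) hs.lt_top

theorem HasACDeriv.enorm_le_lintegral {g γ : ℝ → ℂ} (h : HasACDeriv g γ)
    (h0 : Tendsto g atTop (𝓝 0)) {t : ℝ} (ht : 0 < t) : ‖g t‖ₑ ≤ ∫⁻ u in Ioi t, ‖γ u‖ₑ := by
  have h1 : Tendsto (fun b => ‖g b - g t‖ₑ) atTop (𝓝 ‖0 - g t‖ₑ) :=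
    (h0.sub_const (g t)).enorm
  rw [zero_sub, enorm_neg] at h1
  refine le_of_tendsto h1 ?_
  filter_upwards [eventually_ge_atTop t] with b hb
  rw [← (h t b ht hb).2, intervalIntegral.integral_of_le hb]
  exact (enorm_integral_le_lintegral_enorm _).trans (lintegral_mono_set Ioc_subset_Ioi_self)

/-- A lacunary bound for the derivative of a function vanishing at infinity gives one for the
function. -/
theorem LacunaryBound.of_hasACDeriv {ρ : ℝ} (hρ : 1 < ρ) {n : ℕ} (hn : 1 ≤ n) {g γ : ℝ → ℂ}
    (h : LacunaryBound ρ (n + 1) γ) (hg : HasACDeriv g γ) (h0 : Tendsto g atTop (𝓝 0)) :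
    LacunaryBound ρ n g := by
  obtain ⟨M, hs, hM⟩ := h
  have hρ0 : 0 < ρ := by linarith
  -- The new bound is an estimate of ∫ ‖γ‖ over [ρ^k, ∞), which dominates g on the k-th interval
  -- because g vanishes at infinity.
  refine ⟨fun k => ENNReal.ofReal (ρ - 1) *
    ∑' i : ℕ, ENNReal.ofReal (ρ ^ (k + i)) * M (k + i), ?_, fun k t ht => ?_⟩
  · have hr : ENNReal.ofReal ρ⁻¹ < 1 := by
      rw [← ENNReal.ofReal_one]
      exact (ENNReal.ofReal_lt_ofReal_iff one_pos).2 (inv_lt_one_of_one_lt₀ hρ)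
    -- A discrete Hardy inequality. After exchanging the sums and shifting k by i, ρ^{kn} = ρ^{-in}
    -- ρ^{(k+i)n} ≤ ρ^{-i} ρ^{(k+i)n}; n ≥ 1 is what yields a convergent geometric factor.
    have key : ∑' k : ℤ, ENNReal.ofReal (ρ ^ k) ^ n * (ENNReal.ofReal (ρ - 1) *
        ∑' i : ℕ, ENNReal.ofReal (ρ ^ (k + i)) * M (k + i)) ≤
        ENNReal.ofReal (ρ - 1) * ((∑' i : ℕ, ENNReal.ofReal ρ⁻¹ ^ i) *
          ∑' k : ℤ, ENNReal.ofReal (ρ ^ k) ^ (n + 1) * M k) := by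
      simp only [mul_left_comm _ (ENNReal.ofReal (ρ - 1))]
      rw [ENNReal.tsum_mul_left]
      refine mul_le_mul_right ?_ _
      conv_lhs => simp only [← ENNReal.tsum_mul_left]
      rw [ENNReal.tsum_comm, ← ENNReal.tsum_mul_right]
      refine ENNReal.tsum_le_tsum fun i => ?_
      rw [← ENNReal.tsum_mul_left, ← (Equiv.addRight (i : ℤ)).tsum_eq
        (fun k : ℤ => ENNReal.ofReal ρ⁻¹ ^ i * (ENNReal.ofReal (ρ ^ k) ^ (n + 1) * M k))]
      refine ENNReal.tsum_le_tsum fun k => ?_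
      simp only [Equiv.coe_addRight]
      have h1 : ENNReal.ofReal (ρ ^ k) ^ n ≤
          ENNReal.ofReal ρ⁻¹ ^ i * ENNReal.ofReal (ρ ^ (k + i)) ^ n := by
        have h2 : ENNReal.ofReal (ρ ^ k) =
            ENNReal.ofReal ρ⁻¹ ^ i * ENNReal.ofReal (ρ ^ (k + i)) := by
          rw [← ENNReal.ofReal_pow (by positivity), ← ENNReal.ofReal_mul (by positivity),
            zpow_add₀ hρ0.ne', zpow_natCast, inv_pow]
          congr 1
          field_simp
        calc ENNReal.ofReal (ρ ^ k) ^ n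
            = (ENNReal.ofReal ρ⁻¹ ^ i) ^ n * ENNReal.ofReal (ρ ^ (k + i)) ^ n := by
              rw [h2, mul_pow]
          _ ≤ (ENNReal.ofReal ρ⁻¹ ^ i) ^ 1 * ENNReal.ofReal (ρ ^ (k + i)) ^ n := by
              refine mul_le_mul_left ?_ _
              exact pow_le_pow_right_of_le_one' (pow_le_one' hr.le i) hn
          _ = _ := by rw [pow_one]
      calc _ ≤ (ENNReal.ofReal ρ⁻¹ ^ i * ENNReal.ofReal (ρ ^ (k + i)) ^ n) *
            (ENNReal.ofReal (ρ ^ (k + i)) * M (k + i)) := mul_le_mul_left h1 _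
        _ = _ := by rw [pow_succ]; ring
    refine (key.trans_lt (ENNReal.mul_lt_top ENNReal.ofReal_lt_top
      (ENNReal.mul_lt_top ?_ hs.lt_top))).ne
    rw [ENNReal.tsum_geometric, ENNReal.inv_lt_top]
    exact tsub_pos_of_lt hr
  · refine (hg.enorm_le_lintegral h0 ((zpow_pos hρ0 k).trans_le ht.1)).trans ?_
    exact (lintegral_mono_set fun u hu => ht.1.trans (le_of_lt hu)).trans
      (lintegral_Ici_zpow_le hρ hM k)

theorem HasACDeriv.comp_add_one {g γ : ℝ → ℂ} (h : HasACDeriv g γ) :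
    HasACDeriv (fun t => g (t + 1)) (fun t => γ (t + 1)) := by
  intro a b ha hab
  obtain ⟨i1, e1⟩ := h (a + 1) (b + 1) (by linarith) (by linarith)
  refine ⟨by simpa using i1.comp_add_right 1, ?_⟩
  rw [intervalIntegral.integral_comp_add_right, e1]

/-- If a function vanishes at infinity and its `n`-th derivative has a limit, the limit is `0`. -/
theorem IsACJet.eq_zero_of_tendsto {n : ℕ} {D : ℕ → ℝ → ℂ} (hD : IsACJet n D) {L : ℂ}
    (h0 : Tendsto (D 0) atTop (𝓝 0))
    (hL : Tendsto (D n) atTop (𝓝 L)) : L = 0 := by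
  induction n generalizing D with
  | zero => exact tendsto_nhds_unique hL h0
  | succ n ih =>
    -- The unit difference also tends to 0, and its n-th derivative is the mean of D (n+1) over [t,
    -- t+1], so it tends to L as well.
    refine ih (D := fun i t => D i (t + 1) + (-1) * D i t)
      (fun i hi => (hD i (by omega)).comp_add_one.add ((hD i (by omega)).const_mul (-1))) ?_ ?_
    · have h1 := (h0.comp (tendsto_atTop_add_const_right atTop (1 : ℝ) tendsto_id)).add
        (h0.const_mul (-1))
      simpa using h1
    · rw [Metric.tendsto_atTop] at hL ⊢
      intro ε hε
      obtain ⟨N, hN⟩ := hL (ε / 2) (by positivity)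
      refine ⟨max N 1, fun t ht => ?_⟩
      have ht1 : 0 < t := by linarith [le_max_right N 1]
      obtain ⟨i1, e1⟩ := hD n (by omega) t (t + 1) ht1 (by linarith)
      have e2 : D n (t + 1) + -1 * D n t - L = ∫ u in t..(t + 1), (D (n + 1) u - L) := by
        rw [intervalIntegral.integral_sub i1 (by simp), e1]
        simp; ring
      rw [dist_eq_norm, e2]
      refine lt_of_le_of_lt (intervalIntegral.norm_integral_le_of_norm_le_const
        (C := ε / 2) fun u hu => ?_) (by simp; linarith)
      rw [uIoc_of_le (by linarith)] at hu
      rw [← dist_eq_norm]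
      exact (hN u (by linarith [le_max_left N 1, hu.1])).le

/-- Decay of the lower derivatives. -/
theorem IsACJet.tendsto_and_lacunaryBound {ρ : ℝ} (hρ : 1 < ρ) {n : ℕ} {D : ℕ → ℝ → ℂ}
    (hD : IsACJet n D) (h0 : Tendsto (D 0) atTop (𝓝 0)) (hb : LacunaryBound ρ n (D n)) :
    (∀ i < n, Tendsto (D i) atTop (𝓝 0)) ∧ ∀ i, 1 ≤ i → i ≤ n → LacunaryBound ρ i (D i) := by
  -- Downward induction from the top order. A bound at order i + 1 makes D (i+1) integrable at
  -- infinity, so D i has a limit, necessarily 0, and the bound passes to D i when i ≥ 1.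
  have step : ∀ j i, i + j = n → (1 ≤ i → LacunaryBound ρ i (D i)) ∧
      (1 ≤ j → Tendsto (D i) atTop (𝓝 0)) := by
    intro j
    induction j with
    | zero => intro i hi; rw [add_zero] at hi; subst hi; exact ⟨fun _ => hb, fun h => by omega⟩
    | succ j ih =>
      intro i hi
      have hb' := (ih (i + 1) (by omega)).1 (by omega)
      have hder := hD i (by omega)
      have hint : IntegrableOn (D (i + 1)) (Ioi 1) := by
        constructor
        · have : Ioi (1 : ℝ) = ⋃ m : ℕ, Ioc (1 : ℝ) (1 + m) := by
            ext t
            simp only [mem_Ioi, mem_iUnion, mem_Ioc]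
            exact ⟨fun h => ⟨⌈t⌉₊, h, by linarith [Nat.le_ceil t]⟩, fun ⟨_, h, _⟩ => h⟩
          rw [this, aestronglyMeasurable_iUnion_iff]
          intro m
          exact (hder 1 (1 + m) one_pos (by simp)).1.1.aestronglyMeasurable
        · refine lt_of_le_of_lt ?_ (hb'.lintegral_lt_top hρ)
          refine (setLIntegral_mono' measurableSet_Ioi fun t ht => ?_).trans
            (lintegral_mono_set (Ioi_subset_Ioi zero_le_one))
          have h1 : 1 ≤ ENNReal.ofReal t := by
            rw [← ENNReal.ofReal_one]; exact ENNReal.ofReal_le_ofReal (le_of_lt ht)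
          calc _ = 1 * ‖D (i + 1) t‖ₑ := (one_mul _).symm
            _ ≤ _ := by gcongr; exact one_le_pow_of_one_le' h1 _
      have hlim := hder.tendsto_integral one_pos hint
      have hz := IsACJet.eq_zero_of_tendsto (n := i) (fun k hk => hD k (by omega)) h0 hlim
      rw [hz] at hlim
      exact ⟨fun hi1 => hb'.of_hasACDeriv hρ hi1 hder hlim, fun _ => hlim⟩
  exact ⟨fun i hi => (step (n - i) i (by omega)).2 (by omega),
    fun i hi hin => (step (n - i) i (by omega)).1 hi⟩

/-! ### From essential suprema to lacunary bounds -/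

/-- An absolutely continuous derivative may be altered on a null set. `deriv g` is always
measurable, and replacing it by 0 where it exceeds m makes an almost everywhere bound hold
everywhere. -/
theorem HasACDeriv.exists_measurable_le {g γ : ℝ → ℂ} (h : HasACDeriv g γ) {m : ℝ → ℝ≥0∞}
    (hm : Measurable m) (hγ : ∀ᵐ t ∂volume.restrict (Ioi 0), ‖γ t‖ₑ ≤ m t) :
    ∃ γ' : ℝ → ℂ, Measurable γ' ∧ HasACDeriv g γ' ∧ ∀ t, ‖γ' t‖ₑ ≤ m t := by
  classical
  have hs : MeasurableSet {t | ‖deriv g t‖ₑ ≤ m t} :=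
    measurableSet_le (measurable_deriv g).enorm hm
  refine ⟨fun t => if ‖deriv g t‖ₑ ≤ m t then deriv g t else 0,
    Measurable.ite hs (measurable_deriv g) measurable_const, ?_, fun t => ?_⟩
  · have key : ∀ a b, 0 < a → a ≤ b → ∀ᵐ t, t ∈ uIcc a b →
        (if ‖deriv g t‖ₑ ≤ m t then deriv g t else 0) = γ t ∧ HasDerivAt g (γ t) t := by
      intro a b ha hab
      rw [ae_restrict_iff' measurableSet_Ioi] at hγ
      filter_upwards [h.ae_hasDerivAt ha hab, hγ] with t h1 h2 ht
      have ht0 : t ∈ Ioi (0 : ℝ) := by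
        rw [uIcc_of_le hab] at ht; exact ha.trans_le ht.1
      rw [(h1 ht).deriv, if_pos (h2 ht0)]
      exact ⟨rfl, h1 ht⟩
    refine HasACDeriv.of_ae (fun a b ha hab => ?_)
      (fun a b ha hab => h.absolutelyContinuousOnInterval ha hab) fun a b ha hab => ?_
    · refine (h a b ha hab).1.congr_ae ?_
      rw [EventuallyEq, ae_restrict_iff' measurableSet_uIoc]
      filter_upwards [key a b ha hab] with t ht hmem
      exact (ht (uIoc_subset_uIcc hmem)).1.symm
    · filter_upwards [key a b ha hab] with t ht hmem
      rw [(ht hmem).1]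
      exact (ht hmem).2
  · beta_reduce
    split_ifs with h1
    · exact h1
    · simp

theorem eq_of_mem_Ico_zpow {ρ : ℝ} (hρ : 1 < ρ) {j k : ℤ} {t : ℝ}
    (hj : t ∈ Ico (ρ ^ j) (ρ ^ (j + 1))) (hk : t ∈ Ico (ρ ^ k) (ρ ^ (k + 1))) : j = k := by
  have h1 := (zpow_lt_zpow_iff_right₀ hρ).1 (hj.1.trans_lt hk.2)
  have h2 := (zpow_lt_zpow_iff_right₀ hρ).1 (hk.1.trans_lt hj.2)
  omega

theorem exists_measurable_lacunary {ρ : ℝ} (hρ : 1 < ρ) (M : ℤ → ℝ≥0∞) :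
    ∃ m : ℝ → ℝ≥0∞, Measurable m ∧ ∀ k, ∀ t ∈ Ico (ρ ^ k) (ρ ^ (k + 1)), m t = M k := by
  refine ⟨fun t => ⨆ k : ℤ, (Ico (ρ ^ k) (ρ ^ (k + 1))).indicator (fun _ => M k) t,
    Measurable.iSup fun k => measurable_const.indicator measurableSet_Ico, fun k t ht => ?_⟩
  refine le_antisymm (iSup_le fun j => ?_)
    (le_iSup_of_le k (by rw [indicator_of_mem ht]))
  by_cases hj : t ∈ Ico (ρ ^ j) (ρ ^ (j + 1))
  · rw [indicator_of_mem hj, eq_of_mem_Ico_zpow hρ hj ht]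
  · rw [indicator_of_notMem hj]; exact zero_le

/-- A jet whose top derivative is bounded almost everywhere by a measurable function can be given
a measurable top derivative with the same bound everywhere. -/
theorem exists_isACJet_enorm_le {d : ℕ} (hd : 1 ≤ d) {f : ℝ → ℂ}
    (hAC : HasLocACDeriv (d - 1) f) {m : ℝ → ℝ≥0∞} (hm : Measurable m)
    (hf : ∀ᵐ t ∂volume.restrict (Ioi 0), ‖iteratedDeriv d f t‖ₑ ≤ m t) :
    ∃ D : ℕ → ℝ → ℂ, (∀ i < d, D i = iteratedDeriv i f) ∧ IsACJet d D ∧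
      (∀ i, 1 ≤ i → i ≤ d → Measurable (D i)) ∧ ∀ t, ‖D d t‖ₑ ≤ m t := by
  have hjet := hAC.isACJet hd
  obtain ⟨n, rfl⟩ : ∃ n, d = n + 1 := ⟨d - 1, by omega⟩
  obtain ⟨γ, hγ, hγD, hγm⟩ := (hjet n (by omega)).exists_measurable_le hm hf
  refine ⟨Function.update (fun i => iteratedDeriv i f) (n + 1) γ, fun i hi => ?_, fun i hi => ?_,
    fun i hi hin => ?_, fun t => ?_⟩
  · rw [Function.update_of_ne (by omega)]
  · rw [Function.update_of_ne (by omega)]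
    rcases eq_or_ne i n with rfl | hne
    · rwa [Function.update_self]
    · rw [Function.update_of_ne (by omega)]; exact hjet i hi
  · rcases eq_or_ne i (n + 1) with rfl | hne
    · rwa [Function.update_self]
    · rw [Function.update_of_ne hne]
      obtain ⟨j, rfl⟩ : ∃ j, i = j + 1 := ⟨i - 1, by omega⟩
      rw [iteratedDeriv_succ]
      exact measurable_deriv _
  · rw [Function.update_self]
    exact hγm t

theorem exists_isACJet_lacunaryBound {d : ℕ} (hd : 1 ≤ d) {f : ℝ → ℂ}
    (hAC : HasLocACDeriv (d - 1) f) {ρ : ℝ} (hρ : 1 < ρ) {M : ℤ → ℝ≥0∞}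
    (hs : ∑' k, ENNReal.ofReal (ρ ^ k) ^ d * M k ≠ ∞)
    (hM : ∀ k, ∀ᵐ t, t ∈ Ico (ρ ^ k) (ρ ^ (k + 1)) → ‖iteratedDeriv d f t‖ₑ ≤ M k) :
    ∃ D : ℕ → ℝ → ℂ, D 0 = f ∧ IsACJet d D ∧ (∀ i, 1 ≤ i → i ≤ d → Measurable (D i)) ∧
      LacunaryBound ρ d (D d) := by
  obtain ⟨m, hm, hmM⟩ := exists_measurable_lacunary hρ M
  obtain ⟨D, hDi, hD, hDm, hb⟩ := exists_isACJet_enorm_le hd hAC hm (by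
    rw [ae_restrict_iff' measurableSet_Ioi]
    filter_upwards [ae_all_iff.2 hM] with t ht ht0
    obtain ⟨k, hk⟩ := exists_mem_Ico_zpow ht0 hρ
    rw [hmM k t hk]
    exact ht k hk)
  exact ⟨D, (hDi 0 hd).trans iteratedDeriv_zero, hD, hDm, M, hs,
    fun k t ht => (hb t).trans_eq (hmM k t ht)⟩

theorem ConditionA.conditionB {d : ℕ} {f : ℝ → ℂ} (h : ConditionA d f) : ConditionB d 1 f := by
  simpa [ConditionA, ConditionB] using h

/-- The weighted essential supremum H is nonincreasing, so H(2^k) is at most H on the preceding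
interval [2^{k-1}, 2^k). Hence ∑ 2^{kdp} H(2^k) is bounded by a multiple of the integral in the
condition. -/
theorem ConditionB.exists_lacunary {d : ℕ} {p : ℝ} (hp : 0 < p) (hp1 : p ≤ 1)
    {f : ℝ → ℂ} (h : ConditionB d p f) :
    ∃ M : ℤ → ℝ≥0∞, ∑' k, ENNReal.ofReal (2 ^ k) ^ d * M k ≠ ∞ ∧
      ∀ k, ∀ᵐ t, t ∈ Ico ((2 : ℝ) ^ k) (2 ^ (k + 1)) → ‖iteratedDeriv d f t‖ₑ ≤ M k := by
  set H : ℝ → ℝ≥0∞ := fun t => essSup (fun u => ENNReal.ofReal (u ^ ((d : ℝ) * (1 - p))) *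
    ‖iteratedDeriv d f u‖ₑ) (volume.restrict (Ici t)) with hH
  have hanti : ∀ s t, s ≤ t → H t ≤ H s := fun s t hst =>
    essSup_mono_measure' (Measure.restrict_mono (Ici_subset_Ici.2 hst) le_rfl)
  have h2 : ∀ k : ℤ, (0 : ℝ) < 2 ^ k := fun k => zpow_pos two_pos k
  have hpow : 0 ≤ (d : ℝ) * (1 - p) := mul_nonneg (Nat.cast_nonneg d) (by linarith)
  -- For u ≥ 2^k and p ≤ 1 the factor u^{d(1-p)} is at least 2^{kd(1-p)}. Multiplied by 2^{kd}, this
  -- choice leaves 2^{kdp} H(2^k).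
  refine ⟨fun k => ENNReal.ofReal (((2 : ℝ) ^ k) ^ (-((d : ℝ) * (1 - p)))) * H (2 ^ k), ?_,
    fun k => ?_⟩
  · have hle : ∀ k : ℤ, ENNReal.ofReal (2 ^ k) ^ d *
        (ENNReal.ofReal (((2 : ℝ) ^ k) ^ (-((d : ℝ) * (1 - p)))) * H (2 ^ k)) ≤
        ENNReal.ofReal (2 ^ ((d : ℝ) * p + 1)) *
          ∫⁻ t in Ico ((2 : ℝ) ^ (k - 1)) (2 ^ k),
            ENNReal.ofReal (t ^ ((d : ℝ) * p - 1)) * H t := by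
      intro k
      have hk : (2 : ℝ) ^ k = 2 * 2 ^ (k - 1) := by
        rw [zpow_sub_one₀ two_ne_zero]; ring
      have hlow : ENNReal.ofReal (((2 : ℝ) ^ (k - 1)) ^ ((d : ℝ) * p) / 2 ^ k) * H (2 ^ k) *
          ENNReal.ofReal (2 ^ (k - 1)) ≤ ∫⁻ t in Ico ((2 : ℝ) ^ (k - 1)) (2 ^ k),
            ENNReal.ofReal (t ^ ((d : ℝ) * p - 1)) * H t := by
        calc _ = ∫⁻ _t in Ico ((2 : ℝ) ^ (k - 1)) (2 ^ k),
              ENNReal.ofReal (((2 : ℝ) ^ (k - 1)) ^ ((d : ℝ) * p) / 2 ^ k) * H (2 ^ k) := by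
              rw [setLIntegral_const, Real.volume_Ico]
              congr 2
              rw [hk]; ring
          _ ≤ _ := by
              refine setLIntegral_mono' measurableSet_Ico fun t ht => ?_
              have ht0 : 0 < t := (h2 _).trans_le ht.1
              refine mul_le_mul' (ENNReal.ofReal_le_ofReal ?_) (hanti _ _ ht.2.le)
              rw [Real.rpow_sub ht0, Real.rpow_one]
              have := (h2 (k - 1)).le
              have := h2 k
              gcongr
              · exact ht.1
              · exact ht.2.le
      refine le_trans (le_of_eq ?_) (mul_le_mul_right hlow _)
      have hx := h2 (k - 1)
      have e : ((2 : ℝ) ^ k) ^ d * ((2 : ℝ) ^ k) ^ (-((d : ℝ) * (1 - p))) =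
          2 ^ ((d : ℝ) * p + 1) * (((2 : ℝ) ^ (k - 1)) ^ ((d : ℝ) * p) / 2 ^ k) *
            2 ^ (k - 1) := by
        rw [← Real.rpow_natCast, ← Real.rpow_add (h2 k),
          show (d : ℝ) + -((d : ℝ) * (1 - p)) = d * p by ring, hk,
          Real.mul_rpow two_pos.le hx.le, Real.rpow_add two_pos, Real.rpow_one]
        field_simp
      rw [← mul_assoc, ← ENNReal.ofReal_pow (h2 k).le, ← ENNReal.ofReal_mul (by positivity), e,
        ENNReal.ofReal_mul (by positivity), ENNReal.ofReal_mul (by positivity)]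
      ring
    refine ((ENNReal.tsum_le_tsum hle).trans_lt ?_).ne
    rw [ENNReal.tsum_mul_left]
    refine ENNReal.mul_lt_top ENNReal.ofReal_lt_top (lt_of_le_of_lt ?_ h)
    rw [← lintegral_iUnion (fun _ => measurableSet_Ico)]
    · exact lintegral_mono_set (iUnion_subset fun k t ht => (h2 _).trans_le ht.1)
    · intro j k hjk
      refine Set.disjoint_left.2 fun t hj hk => hjk ?_
      have := eq_of_mem_Ico_zpow one_lt_two (j := j - 1) (k := k - 1) (by simpa using hj)
        (by simpa using hk)
      omega
  · have h3 := ENNReal.ae_le_essSup (μ := volume.restrict (Ici ((2 : ℝ) ^ k)))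
      (fun u => ENNReal.ofReal (u ^ ((d : ℝ) * (1 - p))) * ‖iteratedDeriv d f u‖ₑ)
    rw [ae_restrict_iff' measurableSet_Ici] at h3
    filter_upwards [h3] with t ht hmem
    refine le_trans ?_ (mul_le_mul_right (ht hmem.1) _)
    rw [← mul_assoc, ← ENNReal.ofReal_mul (Real.rpow_nonneg (h2 k).le _)]
    refine le_mul_of_one_le_left (zero_le) ?_
    rw [← ENNReal.ofReal_one]
    refine ENNReal.ofReal_le_ofReal ?_
    rw [Real.rpow_neg (h2 k).le, inv_mul_eq_div, one_le_div (Real.rpow_pos_of_pos (h2 k) _)]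
    exact Real.rpow_le_rpow (h2 k).le hmem.1 hpow

theorem ConditionB.exists_isACJet {d : ℕ} (hd : 1 ≤ d) {f : ℝ → ℂ}
    (hAC : HasLocACDeriv (d - 1) f) {p : ℝ} (hp : 0 < p) (hp1 : p ≤ 1)
    (h : ConditionB d p f) :
    ∃ D : ℕ → ℝ → ℂ, D 0 = f ∧ IsACJet d D ∧ (∀ i, 1 ≤ i → i ≤ d → Measurable (D i)) ∧
      LacunaryBound 2 d (D d) := by
  obtain ⟨M, hs, hM⟩ := h.exists_lacunary hp hp1
  exact exists_isACJet_lacunaryBound hd hAC one_lt_two hs hM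

theorem measurable_powJet {q : ℝ} (n : ℕ) (b : ℝ) (D : ℕ → ℝ → ℂ)
    (hD : ∀ i ≤ n, Measurable (D i)) : Measurable (powJet q n b D) := by
  induction n generalizing b D with
  | zero =>
    exact (Complex.measurable_ofReal.comp (measurable_id.pow_const b)).mul
      ((hD 0 le_rfl).comp (measurable_id.pow_const q))
  | succ n ih =>
    exact ((ih (b - 1) D fun i hi => hD i (by omega)).const_mul _).add
      ((ih (b + q - 1) _ fun i hi => hD (i + 1) (by omega)).const_mul _)

theorem measurable_powJet_zero {q : ℝ} (n : ℕ) (D : ℕ → ℝ → ℂ)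
    (hD : ∀ i, 1 ≤ i → i ≤ n + 1 → Measurable (D i)) :
    Measurable (powJet q (n + 1) 0 D) := by
  simp only [powJet, Complex.ofReal_zero, zero_mul, zero_add]
  exact (measurable_powJet n _ _ fun i hi => hD (i + 1) (by omega) (by omega)).const_mul _

/-- The map t ↦ t^{1/p} carries the k-th interval of ratio 2^p onto the dyadic one. There the j-th
term of the chain rule, times the weight (2^p)^{k(n+1)}, is O(2^{k(j+1)} ‖D (j+1)‖); so each order
from 1 to n + 1 contributes its own convergent sum. -/
theorem LacunaryBound.powJet {p : ℝ} (hp : 0 < p) {n : ℕ} {D : ℕ → ℝ → ℂ}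
    (h : ∀ i, 1 ≤ i → i ≤ n + 1 → LacunaryBound 2 i (D i)) :
    LacunaryBound (2 ^ p) (n + 1) (powJet (1 / p) (n + 1) 0 D) := by
  obtain ⟨C, hC, hbound⟩ := exists_norm_powJet_zero_le (1 / p) n
  choose! M hs hM using h
  have h2 : ∀ k : ℤ, (0 : ℝ) < 2 ^ k := fun k => zpow_pos two_pos k
  have hρ : (0 : ℝ) < 2 ^ p := by positivity
  have hρk : ∀ k : ℤ, (0 : ℝ) < (2 ^ p) ^ k := fun k => zpow_pos hρ k
  have hpk : ∀ k : ℤ, (((2 : ℝ) ^ p) ^ k) ^ (1 / p) = 2 ^ k := fun k => by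
    rw [← Real.rpow_intCast, ← Real.rpow_mul two_pos.le, ← Real.rpow_mul two_pos.le,
      ← Real.rpow_intCast]
    congr 1
    field_simp
  -- The factor 2^{j+1} accounts for t^{1/p} < 2 · 2^k on the k-th interval.
  refine ⟨fun k => (ENNReal.ofReal ((2 ^ p) ^ k) ^ (n + 1))⁻¹ * (ENNReal.ofReal C *
    ∑ j ∈ Finset.range (n + 1), ENNReal.ofReal (2 ^ (j + 1)) *
      (ENNReal.ofReal (2 ^ k) ^ (j + 1) * M (j + 1) k)), ?_, fun k t ht => ?_⟩
  · have e : ∀ k : ℤ, ENNReal.ofReal ((2 ^ p) ^ k) ^ (n + 1) *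
        ((ENNReal.ofReal ((2 ^ p) ^ k) ^ (n + 1))⁻¹ * (ENNReal.ofReal C *
        ∑ j ∈ Finset.range (n + 1), ENNReal.ofReal (2 ^ (j + 1)) *
        (ENNReal.ofReal (2 ^ k) ^ (j + 1) * M (j + 1) k))) = ENNReal.ofReal C *
        ∑ j ∈ Finset.range (n + 1), ENNReal.ofReal (2 ^ (j + 1)) *
        (ENNReal.ofReal (2 ^ k) ^ (j + 1) * M (j + 1) k) := fun k =>
      ENNReal.mul_inv_cancel_left (pow_ne_zero _ (ENNReal.ofReal_pos.2 (hρk k)).ne')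
        (ENNReal.pow_ne_top ENNReal.ofReal_ne_top)
    simp only [e]
    rw [ENNReal.tsum_mul_left, Summable.tsum_finsetSum fun _ _ => ENNReal.summable]
    refine ENNReal.mul_ne_top ENNReal.ofReal_ne_top ((ENNReal.sum_ne_top).2 fun j hj => ?_)
    rw [ENNReal.tsum_mul_left]
    have := Finset.mem_range.1 hj
    exact ENNReal.mul_ne_top ENNReal.ofReal_ne_top (hs (j + 1) (by omega) (by omega))
  · have ht0 : 0 < t := (hρk k).trans_le ht.1
    have htq : t ^ (1 / p) ∈ Ico ((2 : ℝ) ^ k) (2 ^ (k + 1)) := by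
      rw [← hpk k, ← hpk (k + 1)]
      exact ⟨Real.rpow_le_rpow (hρk k).le ht.1 (by positivity),
        Real.rpow_lt_rpow ht0.le ht.2 (by positivity)⟩
    have h1 : ‖_root_.powJet (1 / p) (n + 1) 0 D t‖ₑ ≤ ENNReal.ofReal C *
        ∑ j ∈ Finset.range (n + 1), ENNReal.ofReal (t ^ ((j + 1 : ℕ) * (1 / p) - (n + 1 : ℕ))) *
          ‖D (j + 1) (t ^ (1 / p))‖ₑ := by
      rw [← ofReal_norm]
      refine (ENNReal.ofReal_le_ofReal (hbound D t ht0)).trans (le_of_eq ?_)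
      rw [ENNReal.ofReal_mul hC, ENNReal.ofReal_sum_of_nonneg fun j _ => by positivity]
      congr 1
      refine Finset.sum_congr rfl fun j _ => ?_
      rw [ENNReal.ofReal_mul (by positivity), ofReal_norm]
    refine h1.trans ?_
    beta_reduce
    rw [mul_left_comm, Finset.mul_sum (a := (_ : ℝ≥0∞)⁻¹)]
    refine mul_le_mul_right (Finset.sum_le_sum fun j hj => ?_) _
    have hj := Finset.mem_range.1 hj
    rw [← mul_assoc, ← mul_assoc]
    refine mul_le_mul' ?_ (hM (j + 1) (by omega) (by omega) k _ htq)
    rw [← ENNReal.ofReal_pow (hρk k).le, ← ENNReal.ofReal_inv_of_pos (pow_pos (hρk k) _),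
      ← ENNReal.ofReal_pow (h2 k).le, mul_assoc, ← ENNReal.ofReal_mul (by positivity),
      ← ENNReal.ofReal_mul (inv_nonneg.2 (pow_nonneg (hρk k).le _))]
    refine ENNReal.ofReal_le_ofReal ?_
    rw [Real.rpow_sub ht0, Real.rpow_natCast, div_eq_inv_mul, mul_comm ((j + 1 : ℕ) : ℝ),
      Real.rpow_mul ht0.le, Real.rpow_natCast, ← mul_pow, ← zpow_one_add₀ two_ne_zero]
    have := hρk k
    have h3 := htq.2.le
    have h4 := ht.1
    rw [add_comm] at h3
    gcongr

/-! ### Profiles as superpositions of boxes and cubes -/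

theorem prod_cut_eq_ite {d : ℕ} (x z : Fin d → ℝ) :
    ∏ i, cut (x i) (z i) = if ∀ i, |x i| < z i then 1 else 0 := by
  simp only [cut]
  rw [Finset.prod_ite_zero]
  simp

/-- The integral of `w ↦ φ (∑ w i)` over the shifted orthant `{w | ∀ i, |x i| ^ p < w i}`. -/
noncomputable def orthantIntegral {d : ℕ} (p : ℝ) (φ : ℝ → ℂ) (x : EuclideanSpace ℝ (Fin d)) : ℂ :=
  ∫ w in Set.pi univ fun i => Ioi (|x i| ^ p), φ (∑ i, w i)

open scoped Pointwise in
-- Dilating w by c scales Lebesgue measure by c^d and the thresholds to c|x_i|^p = |c^{1/p} x_i|^p.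
theorem orthantIntegral_comp_mul {d : ℕ} {p : ℝ} (hp : 0 < p) (φ : ℝ → ℂ) {c : ℝ} (hc : 0 < c)
    (x : EuclideanSpace ℝ (Fin d)) :
    orthantIntegral p (fun t => φ (c * t)) x =
      ((c ^ d : ℝ) : ℂ)⁻¹ * orthantIntegral p φ (c ^ (1 / p) • x) := by
  have h := Measure.setIntegral_comp_smul_of_pos (volume : Measure (Fin d → ℝ))
    (fun w => φ (∑ i, w i)) (Set.pi univ fun i => Ioi (|x i| ^ p)) hc
  have hset : c • (Set.pi univ fun i => Ioi (|x i| ^ p)) =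
      Set.pi univ fun i => Ioi (|(c ^ (1 / p) • x) i| ^ p) := by
    ext w
    rw [mem_smul_set_iff_inv_smul_mem₀ hc.ne']
    simp only [Set.mem_pi, mem_univ, forall_const, mem_Ioi, Pi.smul_apply, PiLp.smul_apply,
      smul_eq_mul]
    refine forall_congr' fun i => ?_
    rw [abs_mul, abs_of_nonneg (Real.rpow_nonneg hc.le _),
      Real.mul_rpow (Real.rpow_nonneg hc.le _) (abs_nonneg _), ← Real.rpow_mul hc.le,
      one_div_mul_cancel hp.ne', Real.rpow_one, lt_inv_mul_iff₀ hc]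
  rw [hset] at h
  simp only [Pi.smul_apply, smul_eq_mul, ← Finset.mul_sum] at h
  unfold orthantIntegral
  rw [h, Complex.real_smul]
  simp

/-- Translating w by the vector (|x_i|^p) absorbs the argument into the domain of integration, which
becomes a condition on each coordinate separately. -/
theorem IsACJet.eq_orthantIntegral {d : ℕ} {D : ℕ → ℝ → ℂ} (hD : IsACJet d D)
    (hm : Measurable (D d)) (h0 : ∀ i < d, Tendsto (D i) atTop (𝓝 0))
    (hi : ∀ s, 0 < s → ∫⁻ t in Ioi s, ENNReal.ofReal t ^ (d - 1) * ‖D d t‖ₑ < ∞) (p : ℝ)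
    {x : EuclideanSpace ℝ (Fin d)} (hx : 0 < ∑ i, |x i| ^ p) :
    D 0 (∑ i, |x i| ^ p) = (-1) ^ d * orthantIntegral p (D d) x := by
  rw [hD.eq_integral_orthant hm h0 hi hx, orthantMeasure_eq]
  congr 1
  have h := (measurePreserving_add_right (volume : Measure (Fin d → ℝ))
    fun i => |x i| ^ p).setIntegral_preimage_emb (measurableEmbedding_addRight _)
    (fun w => D d (∑ i, w i)) (Set.pi univ fun i => Ioi (|x i| ^ p))
  unfold orthantIntegral
  rw [← h]
  have hset : (fun w : Fin d → ℝ => w + fun i => |x i| ^ p) ⁻¹'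
      (Set.pi univ fun i => Ioi (|x i| ^ p)) = Set.pi univ fun _ => Ioi 0 := by
    ext w; simp
  rw [hset]
  simp only [Pi.add_apply, Finset.sum_add_distrib, add_comm]

theorem integrableOn_orthantIntegral {d : ℕ} (hd : 1 ≤ d) {p : ℝ} {φ : ℝ → ℂ} (hm : Measurable φ)
    (hi : ∫⁻ t in Ioi 0, ENNReal.ofReal t ^ (d - 1) * ‖φ t‖ₑ < ∞) (x : EuclideanSpace ℝ (Fin d)) :
    IntegrableOn (fun w : Fin d → ℝ => φ (∑ i, w i)) (Set.pi univ fun i => Ioi (|x i| ^ p)) := by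
  obtain ⟨n, rfl⟩ : ∃ n, d = n + 1 := ⟨d - 1, by omega⟩
  have h : IntegrableOn (fun w : Fin (n + 1) → ℝ => φ (∑ i, w i)) (Set.pi univ fun _ => Ioi 0) := by
    refine ⟨(hm.comp (by fun_prop)).aestronglyMeasurable, ?_⟩
    rw [← orthantMeasure_eq]
    have h1 := lintegral_orthant_le n (fun t => ‖φ t‖ₑ) hm.enorm (le_refl 0)
    simp only [zero_add] at h1
    exact h1.trans_lt hi
  exact h.mono_set (Set.pi_mono fun i _ => Ioi_subset_Ioi (Real.rpow_nonneg (abs_nonneg _) _))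

/-- Local Hölder continuity of `u ↦ u ^ p` on bounded intervals. -/
theorem exists_abs_rpow_sub_rpow_le {p : ℝ} (hp : 0 < p) (R : ℝ) :
    ∃ C : ℝ, 0 ≤ C ∧ ∀ u ∈ Icc 0 R, ∀ v ∈ Icc 0 R, ∀ ℓ, |u - v| ≤ ℓ →
      |u ^ p - v ^ p| ≤ C * min ℓ 1 ^ min p 1 := by
  rcases lt_or_ge R 0 with hR | hR
  · exact ⟨0, le_rfl, fun u hu => absurd (hu.1.trans hu.2) (not_le.2 hR)⟩
  have hbig : ∀ u ∈ Icc 0 R, ∀ v ∈ Icc 0 R, |u ^ p - v ^ p| ≤ R ^ p := by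
    intro u hu v hv
    rw [abs_sub_le_iff]
    have h1 := Real.rpow_le_rpow hu.1 hu.2 hp.le
    have h2 := Real.rpow_le_rpow hv.1 hv.2 hp.le
    have h3 := Real.rpow_nonneg hu.1 p
    have h4 := Real.rpow_nonneg hv.1 p
    constructor <;> linarith
  obtain ⟨C, hC, hsmall⟩ : ∃ C : ℝ, 0 ≤ C ∧ ∀ u ∈ Icc 0 R, ∀ v ∈ Icc 0 R,
      |u ^ p - v ^ p| ≤ C * |u - v| ^ min p 1 := by
    rcases le_total p 1 with h1 | h1
    · refine ⟨1, zero_le_one, fun u hu v hv => ?_⟩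
      rw [min_eq_left h1, one_mul]
      have key : ∀ a b : ℝ, 0 ≤ b → b ≤ a → |a ^ p - b ^ p| ≤ |a - b| ^ p := by
        intro a b hb hab
        have h2 := Real.rpow_add_le_add_rpow (sub_nonneg.2 hab) hb hp.le h1
        rw [sub_add_cancel] at h2
        rw [abs_of_nonneg (sub_nonneg.2 hab),
          abs_of_nonneg (sub_nonneg.2 (Real.rpow_le_rpow hb hab hp.le))]
        linarith
      rcases le_total v u with h | h
      · exact key u v hv.1 h
      · rw [abs_sub_comm, abs_sub_comm u]; exact key v u hu.1 h
    · refine ⟨p * R ^ (p - 1), by positivity, fun u hu v hv => ?_⟩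
      rw [min_eq_right h1, Real.rpow_one]
      have := Convex.norm_image_sub_le_of_norm_hasDerivWithin_le (f := fun u : ℝ => u ^ p)
        (f' := fun u => p * u ^ (p - 1)) (C := p * R ^ (p - 1)) (s := Icc 0 R)
        (fun u _ => (Real.hasDerivAt_rpow_const (Or.inr h1)).hasDerivWithinAt)
        (fun u hu => by
          rw [Real.norm_eq_abs, abs_of_nonneg (mul_nonneg hp.le (Real.rpow_nonneg hu.1 _))]
          exact mul_le_mul_of_nonneg_left (Real.rpow_le_rpow hu.1 hu.2 (by linarith)) hp.le)
        (convex_Icc 0 R) hv hu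
      simpa only [Real.norm_eq_abs] using this
  refine ⟨max C (R ^ p), le_max_of_le_left hC, fun u hu v hv ℓ hℓ => ?_⟩
  rcases le_total ℓ 1 with h | h
  · rw [min_eq_left h]
    refine (hsmall u hu v hv).trans (mul_le_mul (le_max_left _ _)
      (Real.rpow_le_rpow (abs_nonneg _) hℓ (le_min hp.le zero_le_one))
      (Real.rpow_nonneg (abs_nonneg _) _) (le_max_of_le_left hC))
  · rw [min_eq_right h, Real.one_rpow, mul_one]
    exact (hbig u hu v hv).trans (le_max_right _ _)

/-- Truncation of `u ↦ u ^ (1 / p)` to `[0, ρ]`. -/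
noncomputable def clampRoot (p ρ u : ℝ) : ℝ := (max 0 (min u ρ)) ^ (1 / p)

theorem measurable_clampRoot (p ρ : ℝ) : Measurable (clampRoot p ρ) :=
  (measurable_const.max (measurable_id.min measurable_const)).pow_const _

theorem clampRoot_nonneg (p ρ u : ℝ) : 0 ≤ clampRoot p ρ u :=
  Real.rpow_nonneg (le_max_left _ _) _

theorem clampRoot_le {p ρ : ℝ} (hp : 0 < p) (hρ : 0 < ρ) (u : ℝ) :
    clampRoot p ρ u ≤ ρ ^ (1 / p) :=
  Real.rpow_le_rpow (le_max_left _ _) (max_le hρ.le (min_le_right _ _)) (by positivity)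

theorem clampRoot_of_mem {p ρ u : ℝ} (hu : u ∈ Ioc 0 ρ) : clampRoot p ρ u = u ^ (1 / p) := by
  rw [clampRoot, min_eq_left hu.2, max_eq_right hu.1.le]

theorem lt_clampRoot_iff {p ρ u t : ℝ} (hp : 0 < p) (hu : u ∈ Ioc 0 ρ) :
    |t| < clampRoot p ρ u ↔ |t| ^ p < u := by
  rw [clampRoot_of_mem hu, one_div, Real.lt_rpow_inv_iff_of_pos (abs_nonneg _) hu.1.le hp]

/-- The measure is a product, so one coordinate suffices. If two roots u^{1/p}, v^{1/p} lie in an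
interval of length ℓ, Hölder continuity of the p-th power bounds |u - v|, hence the diameter of the
set. -/
theorem boxBound_clampRoot {d : ℕ} {p ρ : ℝ} (hp : 0 < p) :
    ∃ C : ℝ, 0 ≤ C ∧ BoxBound (d := d) (Measure.pi fun _ => volume.restrict (Ioc 0 ρ))
      (fun w i => clampRoot p ρ (w i)) C (min p 1) := by
  obtain ⟨C, hC, h⟩ := exists_abs_rpow_sub_rpow_le hp (ρ ^ (1 / p))
  refine ⟨C ^ d, by positivity, fun a ℓ hℓ => ?_⟩
  have hset : {w : Fin d → ℝ | ∀ i, a i ≤ clampRoot p ρ (w i) ∧ clampRoot p ρ (w i) ≤ a i + ℓ i} =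
      Set.pi univ fun i => {u | a i ≤ clampRoot p ρ u ∧ clampRoot p ρ u ≤ a i + ℓ i} := by
    ext w; simp
  have hm : ∀ i, MeasurableSet {u | a i ≤ clampRoot p ρ u ∧ clampRoot p ρ u ≤ a i + ℓ i} :=
    fun i => (measurableSet_le measurable_const (measurable_clampRoot p ρ)).inter
      (measurableSet_le (measurable_clampRoot p ρ) measurable_const)
  have hconst : C ^ d * ∏ i, min (ℓ i) 1 ^ min p 1 = ∏ i, C * min (ℓ i) 1 ^ min p 1 := by
    rw [Finset.prod_mul_distrib, Finset.prod_const, Finset.card_univ, Fintype.card_fin]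
  rw [hset, Measure.pi_pi, hconst, ENNReal.ofReal_prod_of_nonneg fun i _ =>
    mul_nonneg hC (Real.rpow_nonneg (le_min (hℓ i).le zero_le_one) _)]
  refine Finset.prod_le_prod' fun i _ => ?_
  rw [Measure.restrict_apply (hm i)]
  refine (Real.volume_le_diam _).trans (Metric.ediam_le fun u hu v hv => ?_)
  rw [edist_dist, Real.dist_eq]
  refine ENNReal.ofReal_le_ofReal ?_
  have hpow : ∀ u ∈ Ioc 0 ρ, (clampRoot p ρ u) ^ p = u := fun u hu => by
    rw [clampRoot_of_mem hu, one_div, Real.rpow_inv_rpow hu.1.le hp.ne']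
  have h1 := h (clampRoot p ρ u) ⟨clampRoot_nonneg _ _ _, clampRoot_le hp
      (hu.2.1.trans_le hu.2.2) u⟩ (clampRoot p ρ v) ⟨clampRoot_nonneg _ _ _, clampRoot_le hp
      (hu.2.1.trans_le hu.2.2) v⟩ (ℓ i) (abs_sub_le_iff.2
        ⟨by linarith [hu.1.2, hv.1.1], by linarith [hu.1.1, hv.1.2]⟩)
  rwa [hpow u hu.2, hpow v hv.2] at h1

/-- All w_i are positive on the domain, so w_i > ρ for some i forces ∑ w_i ≥ ρ and the integrand
vanishes: truncating the parameters loses nothing. -/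
theorem orthantIntegral_eq_boxIntegral {d : ℕ} {p ρ : ℝ} (hp : 0 < p) {φ : ℝ → ℂ}
    (h0 : ∀ t, ρ ≤ t → φ t = 0) :
    (orthantIntegral p φ : EuclideanSpace ℝ (Fin d) → ℂ) =
      boxIntegral (Measure.pi fun _ => volume.restrict (Ioc 0 ρ))
        (fun w i => clampRoot p ρ (w i)) fun w => φ (∑ i, w i) := by
  ext x
  unfold orthantIntegral boxIntegral
  rw [← Measure.restrict_pi_pi, ← volume_pi, ← integral_indicator (MeasurableSet.univ_pi fun _ =>
    measurableSet_Ioi), ← integral_indicator (MeasurableSet.univ_pi fun _ => measurableSet_Ioc)]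
  congr 1
  ext w
  classical
  simp only [prod_cut_eq_ite, indicator_apply, Set.mem_pi, mem_univ, forall_const, mem_Ioi]
  by_cases hw : ∀ i, w i ∈ Ioc 0 ρ
  · rw [if_pos hw]
    have : (∀ i, |x i| < clampRoot p ρ (w i)) ↔ ∀ i, |x i| ^ p < w i :=
      forall_congr' fun i => lt_clampRoot_iff hp (hw i)
    simp only [this, ite_mul, one_mul, zero_mul]
  · rw [if_neg hw]
    split_ifs with h
    · refine h0 _ ?_
      have hpos : ∀ i, 0 < w i := fun i => (Real.rpow_nonneg (abs_nonneg _) _).trans_lt (h i)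
      push Not at hw
      obtain ⟨i, hi⟩ := hw
      have : ρ < w i := by
        by_contra! hc
        exact hi ⟨hpos i, hc⟩
      exact this.le.trans (Finset.single_le_sum (fun j _ => (hpos j).le) (Finset.mem_univ i))
    · rfl

theorem continuous_orthantIntegral {d : ℕ} {p ρ : ℝ} (hp : 0 < p) (hρ : 0 < ρ) {φ : ℝ → ℂ} {B : ℝ}
    (hφ : Measurable φ) (hB : ∀ t, ‖φ t‖ ≤ B) (h0 : ∀ t, ρ ≤ t → φ t = 0) :
    Continuous (orthantIntegral p φ : EuclideanSpace ℝ (Fin d) → ℂ) := by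
  rw [orthantIntegral_eq_boxIntegral hp h0]
  obtain ⟨C, -, hbox⟩ := boxBound_clampRoot (d := d) (ρ := ρ) hp
  exact continuous_boxIntegral hbox (lt_min hp one_pos)
    (measurable_pi_iff.2 fun i => (measurable_clampRoot p ρ).comp (measurable_pi_apply i))
    (fun w i => clampRoot_nonneg _ _ _) (fun w i => clampRoot_le hp hρ _)
    (hφ.comp (by fun_prop)) fun w => hB _

theorem exists_hasWienerNorm_orthantIntegral {d : ℕ} {p ρ : ℝ} (hp : 0 < p) (hρ : 0 < ρ) {θ : ℝ}
    (hθ : 0 < θ) (hθ1 : θ ≤ 1) (hθp : 1 < θ * (1 + min p 1)) :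
    ∃ K : ℝ, 0 ≤ K ∧ ∀ (φ : ℝ → ℂ) (A B : ℝ), Measurable φ → 0 ≤ A → 0 ≤ B → (∀ t, ‖φ t‖ ≤ B) →
      (∀ t, ρ ≤ t → φ t = 0) →
      (∀ x : EuclideanSpace ℝ (Fin d), ‖orthantIntegral p φ x‖ ≤ A) →
      HasWienerNorm (orthantIntegral p φ : EuclideanSpace ℝ (Fin d) → ℂ)
        (K * (A ^ (1 - θ) * B ^ θ)) := by
  obtain ⟨C, hC, hbox⟩ := boxBound_clampRoot (d := d) (ρ := ρ) hp
  obtain ⟨K, hK, h⟩ := exists_hasWienerNorm_boxIntegral hbox hC (lt_min hp one_pos)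
    (measurable_pi_iff.2 fun i => (measurable_clampRoot p ρ).comp (measurable_pi_apply i))
    (fun w i => clampRoot_nonneg _ _ _) (fun w i => clampRoot_le hp hρ _) hθ hθ1 hθp
  refine ⟨K, hK, fun φ A B hφ hA hB hφB h0 hφA => ?_⟩
  have e := orthantIntegral_eq_boxIntegral (d := d) hp h0
  rw [e] at hφA ⊢
  exact h _ A B (hφ.comp (by fun_prop)) hA hB (fun w => hφB _) hφA

/-- At θ = 1 the size A of the function enters with exponent 0. -/
theorem exists_hasWienerNorm_orthantIntegral_of_bound (d : ℕ) {p ρ : ℝ} (hp : 0 < p)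
    (hρ : 0 < ρ) :
    ∃ K : ℝ, 0 ≤ K ∧ ∀ (φ : ℝ → ℂ) (B : ℝ), Measurable φ → 0 ≤ B → (∀ t, ‖φ t‖ ≤ B) →
      (∀ t, ρ ≤ t → φ t = 0) →
      HasWienerNorm (orthantIntegral p φ : EuclideanSpace ℝ (Fin d) → ℂ) (K * B) := by
  obtain ⟨K, hK, h⟩ := exists_hasWienerNorm_orthantIntegral (d := d) hp hρ one_pos le_rfl
    (by have := lt_min hp one_pos; linarith)
  refine ⟨K, hK, fun φ B hφ hB hφB h0 => ?_⟩
  have hA : ∀ x : EuclideanSpace ℝ (Fin d), ‖orthantIntegral p φ x‖ ≤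
      B * (Measure.pi fun _ : Fin d => volume.restrict (Ioc 0 ρ)).real univ := by
    intro x
    rw [orthantIntegral_eq_boxIntegral hp h0]
    refine norm_integral_le_of_norm_le_const (ae_of_all _ fun w => ?_)
    rw [norm_mul]
    exact (mul_le_of_le_one_left (norm_nonneg _) (norm_prod_cut_le_one _ _)).trans (hφB _)
  simpa using h φ _ B hφ (by positivity) hB hφB h0 hA

/-- The tail integral of `φ` from the largest coordinate. -/
noncomputable def maxIntegral {d : ℕ} (φ : ℝ → ℂ) (x : EuclideanSpace ℝ (Fin d)) : ℂ :=
  ∫ u in Ioi (pAbs ∞ x), φ u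

theorem pAbs_top_nonneg {d : ℕ} (x : EuclideanSpace ℝ (Fin d)) : 0 ≤ pAbs ∞ x := norm_nonneg _

theorem pAbs_top_smul {d : ℕ} {r : ℝ} (hr : 0 ≤ r) (x : EuclideanSpace ℝ (Fin d)) :
    pAbs ∞ (r • x) = r * pAbs ∞ x := by
  have : (WithLp.toLp ∞ fun j => (r • x) j : PiLp ∞ fun _ : Fin d => ℝ) =
      r • WithLp.toLp ∞ fun j => x j := rfl
  rw [pAbs, this, norm_smul, Real.norm_of_nonneg hr, pAbs]

theorem pAbs_top_lt_iff {d : ℕ} {x : EuclideanSpace ℝ (Fin d)} {u : ℝ} (hu : 0 < u) :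
    pAbs ∞ x < u ↔ ∀ i, |x i| < u := by
  rw [pAbs_top]
  refine ⟨fun h i => (le_ciSup (Finite.bddAbove_range fun j => |x j|) i).trans_lt h, fun h => ?_⟩
  rcases isEmpty_or_nonempty (Fin d) with he | hne
  · rwa [Real.iSup_of_isEmpty]
  · obtain ⟨i, hi⟩ := exists_eq_ciSup_of_finite (f := fun j => |x j|)
    exact hi ▸ h i

theorem maxIntegral_comp_mul {d : ℕ} (φ : ℝ → ℂ) {c : ℝ} (hc : 0 < c)
    (x : EuclideanSpace ℝ (Fin d)) :
    maxIntegral (fun t => φ (c * t)) x = (c : ℂ)⁻¹ * maxIntegral φ (c • x) := by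
  unfold maxIntegral
  rw [integral_comp_mul_left_Ioi _ _ hc, pAbs_top_smul hc.le, Complex.real_smul]
  simp

theorem maxIntegral_eq_boxIntegral {d : ℕ} {ρ : ℝ} {φ : ℝ → ℂ}
    (h0 : ∀ t, ρ ≤ t → φ t = 0) :
    (maxIntegral φ : EuclideanSpace ℝ (Fin d) → ℂ) =
      boxIntegral (volume.restrict (Ioc 0 ρ)) (fun u _ => clampRoot 1 ρ u) φ := by
  ext x
  unfold maxIntegral boxIntegral
  rw [← integral_indicator measurableSet_Ioi, ← integral_indicator measurableSet_Ioc]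
  congr 1
  ext u
  simp only [prod_cut_eq_ite, indicator_apply, mem_Ioi]
  by_cases hu : u ∈ Ioc 0 ρ
  · have : (∀ i, |x i| < clampRoot 1 ρ u) ↔ pAbs ∞ x < u := by
      rw [pAbs_top_lt_iff hu.1]
      exact forall_congr' fun i => by rw [lt_clampRoot_iff one_pos hu, Real.rpow_one]
    simp only [if_pos hu, this, ite_mul, one_mul, zero_mul]
  · rw [if_neg hu]
    split_ifs with h
    · refine h0 _ ?_
      by_contra! hc
      exact hu ⟨(pAbs_top_nonneg x).trans_lt h, hc.le⟩
    · rfl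

/-- With a single parameter the mass is governed by the shortest side, and the minimum of d numbers
is at most the product of their d-th roots. The exponent 1/d is positive, which is enough for θ = 1.
-/
theorem boxBound_clampRoot_diagonal {d : ℕ} (hd : 1 ≤ d) (ρ : ℝ) :
    ∃ C : ℝ, 0 ≤ C ∧ BoxBound (d := d) (volume.restrict (Ioc 0 ρ))
      (fun u _ => clampRoot 1 ρ u) C (1 / d) := by
  obtain ⟨C, hC, h⟩ := boxBound_clampRoot (d := 1) (ρ := ρ) one_pos
  have hone : ∀ a ℓ : ℝ, 0 < ℓ → volume.restrict (Ioc 0 ρ)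
      {u | a ≤ clampRoot 1 ρ u ∧ clampRoot 1 ρ u ≤ a + ℓ} ≤ ENNReal.ofReal (C * min ℓ 1) := by
    intro a ℓ hℓ
    have h1 := h (fun _ => a) (fun _ => ℓ) fun _ => hℓ
    have hset : {w : Fin 1 → ℝ | ∀ i, a ≤ clampRoot 1 ρ (w i) ∧ clampRoot 1 ρ (w i) ≤ a + ℓ} =
      Set.pi univ fun _ => {u | a ≤ clampRoot 1 ρ u ∧ clampRoot 1 ρ u ≤ a + ℓ} := by
      ext w; simp
    rw [hset, Measure.pi_pi] at h1
    simpa using h1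
  refine ⟨C, hC, fun a ℓ hℓ => ?_⟩
  have : Nonempty (Fin d) := ⟨⟨0, hd⟩⟩
  obtain ⟨i₀, hi₀⟩ := Finite.exists_min ℓ
  have hsub : {u | ∀ i, a i ≤ clampRoot 1 ρ u ∧ clampRoot 1 ρ u ≤ a i + ℓ i} ⊆
      {u | a i₀ ≤ clampRoot 1 ρ u ∧ clampRoot 1 ρ u ≤ a i₀ + ℓ i₀} := fun u hu => hu i₀
  refine (measure_mono hsub).trans ((hone _ _ (hℓ i₀)).trans (ENNReal.ofReal_le_ofReal
      (mul_le_mul_of_nonneg_left ?_ hC)))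
  have hm : 0 ≤ min (ℓ i₀) 1 := le_min (hℓ i₀).le zero_le_one
  have hd0 : (d : ℝ) ≠ 0 := by positivity
  calc min (ℓ i₀) 1 = ∏ _i : Fin d, min (ℓ i₀) 1 ^ (1 / (d : ℝ)) := by
        rw [Finset.prod_const, Finset.card_univ, Fintype.card_fin, ← Real.rpow_natCast,
          ← Real.rpow_mul hm, one_div_mul_cancel hd0, Real.rpow_one]
    _ ≤ _ := Finset.prod_le_prod (fun i _ => Real.rpow_nonneg hm _) fun i _ =>
        Real.rpow_le_rpow hm (min_le_min_right 1 (hi₀ i)) (by positivity)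

theorem exists_hasWienerNorm_maxIntegral {d : ℕ} (hd : 1 ≤ d) {ρ : ℝ} (hρ : 0 < ρ) :
    ∃ K : ℝ, 0 ≤ K ∧ ∀ (φ : ℝ → ℂ) (B : ℝ), Measurable φ → 0 ≤ B → (∀ t, ‖φ t‖ ≤ B) →
      (∀ t, ρ ≤ t → φ t = 0) →
      HasWienerNorm (maxIntegral φ : EuclideanSpace ℝ (Fin d) → ℂ) (K * B) := by
  obtain ⟨C, hC, hbox⟩ := boxBound_clampRoot_diagonal hd ρ
  have hd0 : (0 : ℝ) < 1 / d := by positivity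
  obtain ⟨K, hK, h⟩ := exists_hasWienerNorm_boxIntegral hbox hC hd0
    (measurable_pi_iff.2 fun i => measurable_clampRoot 1 ρ)
    (fun w i => clampRoot_nonneg _ _ _) (fun w i => clampRoot_le one_pos hρ _)
    one_pos le_rfl (by linarith)
  refine ⟨K, hK, fun φ B hφ hB hφB h0 => ?_⟩
  rw [maxIntegral_eq_boxIntegral h0]
  have hA : ∀ x : EuclideanSpace ℝ (Fin d), ‖boxIntegral (volume.restrict (Ioc 0 ρ))
      (fun u _ => clampRoot 1 ρ u) φ x‖ ≤ B * (volume.restrict (Ioc 0 ρ)).real univ := by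
    intro x
    refine norm_integral_le_of_norm_le_const (ae_of_all _ fun w => ?_)
    rw [norm_mul]
    exact (mul_le_of_le_one_left (norm_nonneg _) (norm_prod_cut_le_one _ _)).trans (hφB _)
  simpa using h φ _ B hφ (by positivity) hB hφB hA

/-! ### Summing lacunary pieces: conditions А and Б -/

theorem continuous_of_mem_wienerAlgebra {d : ℕ} {F : EuclideanSpace ℝ (Fin d) → ℂ}
    (hF : F ∈ WienerAlgebra d) : Continuous F := by
  obtain ⟨g, hg, hF⟩ := hF
  rw [funext hF]
  refine continuous_of_dominated (bound := fun y => ‖g y‖) (fun x => ?_)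
    (fun x => ae_of_all _ fun y => ?_) hg.norm (ae_of_all _ fun y => by fun_prop)
  · exact hg.aestronglyMeasurable.mul (by fun_prop : Continuous fun y : EuclideanSpace ℝ (Fin d) =>
      Complex.exp (-Complex.I * ((inner ℝ x y : ℝ) : ℂ))).aestronglyMeasurable
  · rw [norm_mul, HasWienerNorm.norm_exp_inner, mul_one]

/-- The derivatives are available on (0, ∞) only, so integral representations are proved off the
origin; continuity recovers that point. -/
theorem eq_of_continuous_of_ne_zero {d : ℕ} (hd : 1 ≤ d) {F G : EuclideanSpace ℝ (Fin d) → ℂ}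
    (hF : Continuous F) (hG : Continuous G) (h : ∀ x, x ≠ 0 → F x = G x) : F = G := by
  have : Nonempty (Fin d) := ⟨⟨0, hd⟩⟩
  have : (𝓝[≠] (0 : EuclideanSpace ℝ (Fin d))).NeBot := Module.punctured_nhds_neBot ℝ _ _
  exact Continuous.ext_on (dense_compl_singleton (0 : EuclideanSpace ℝ (Fin d))) hF hG h

theorem HasWienerNorm.const_mul {d : ℕ} {F : EuclideanSpace ℝ (Fin d) → ℂ} {a : ℝ}
    (h : HasWienerNorm F a) (c : ℂ) : HasWienerNorm (fun x => c * F x) (‖c‖ * a) := by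
  obtain ⟨g, hg, hga, hF⟩ := h
  refine ⟨fun y => c * g y, hg.const_mul c, ?_, fun x => ?_⟩
  · simp only [norm_mul]
    rw [integral_const_mul]
    exact mul_le_mul_of_nonneg_left hga (norm_nonneg c)
  · simp only [mul_assoc]
    rw [integral_const_mul, hF]

theorem const_mul_mem_wienerAlgebra {d : ℕ} {F : EuclideanSpace ℝ (Fin d) → ℂ}
    (h : F ∈ WienerAlgebra d) (c : ℂ) : (fun x => c * F x) ∈ WienerAlgebra d := by
  obtain ⟨g, hg, hF⟩ := h
  exact (HasWienerNorm.const_mul ⟨g, hg, le_rfl, hF⟩ c).mem_wienerAlgebra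

theorem hasSum_setIntegral_lacunary {α : Type*} [MeasurableSpace α] {μ : Measure α} {ρ : ℝ}
    (hρ : 1 < ρ) {L : α → ℝ} (hL : Measurable L) {S : Set α} (hS : MeasurableSet S)
    (hpos : ∀ w ∈ S, 0 < L w) {φ : ℝ → ℂ} (hi : IntegrableOn (fun w => φ (L w)) S μ) :
    HasSum (fun k : ℤ => ∫ w in S, (Ico (ρ ^ k) (ρ ^ (k + 1))).indicator φ (L w) ∂μ)
      (∫ w in S, φ (L w) ∂μ) := by
  have hSU : S = ⋃ k : ℤ, S ∩ L ⁻¹' Ico (ρ ^ k) (ρ ^ (k + 1)) := by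
    ext w
    simp only [mem_iUnion, mem_inter_iff, exists_and_left, iff_self_and]
    exact fun hw => exists_mem_Ico_zpow (hpos w hw) hρ
  have h := hasSum_integral_iUnion (μ := μ) (f := fun w => φ (L w))
    (s := fun k : ℤ => S ∩ L ⁻¹' Ico (ρ ^ k) (ρ ^ (k + 1)))
    (fun k => hS.inter (hL measurableSet_Ico))
    (fun j k hjk => Set.disjoint_left.2 fun w hj hk => hjk (eq_of_mem_Ico_zpow hρ hj.2 hk.2))
    (hSU ▸ hi)
  rw [← hSU] at h
  refine h.congr_fun fun k => ?_
  rw [← setIntegral_indicator (hL measurableSet_Ico)]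
  rfl

/-- An integral operator that is bounded on functions supported in `[1, ρ)` and homogeneous of
degree `N` maps functions with a lacunary bound to the Wiener algebra. -/
theorem mem_wienerAlgebra_of_lacunaryBound {d N : ℕ} {ρ K : ℝ} (hρ : 1 < ρ)
    (I : (ℝ → ℂ) → EuclideanSpace ℝ (Fin d) → ℂ)
    (hunit : ∀ (φ : ℝ → ℂ) (B : ℝ), Measurable φ → 0 ≤ B → (∀ t, ‖φ t‖ ≤ B) →
      (∀ t, ρ ≤ t → φ t = 0) → HasWienerNorm (I φ) (K * B))
    (hscale : ∀ c : ℝ, 0 < c → ∃ r : ℝ, 0 < r ∧ ∀ (φ : ℝ → ℂ) x,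
      I (fun t => φ (c * t)) x = ((c ^ N : ℝ) : ℂ)⁻¹ * I φ (r • x))
    {φ : ℝ → ℂ} (hφ : Measurable φ) (hb : LacunaryBound ρ N φ)
    (hsum : ∀ x, HasSum (fun k : ℤ => I ((Ico (ρ ^ k) (ρ ^ (k + 1))).indicator φ) x) (I φ x)) :
    I φ ∈ WienerAlgebra d := by
  obtain ⟨M, hs, hM⟩ := hb
  have hρ0 : 0 < ρ := by linarith
  have hk : ∀ k : ℤ, 0 < ρ ^ k := zpow_pos hρ0
  have hMtop : ∀ k, M k ≠ ∞ := fun k h => by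
    refine ENNReal.ne_top_of_tsum_ne_top hs k ?_
    rw [h, ENNReal.mul_top (pow_ne_zero _ (ENNReal.ofReal_pos.2 (hk k)).ne')]
  refine HasWienerNorm.mem_wienerAlgebra_of_hasSum
    (f := fun k : ℤ => I ((Ico (ρ ^ k) (ρ ^ (k + 1))).indicator φ))
    (b := fun k => K * ((ρ ^ k) ^ N * (M k).toReal)) (fun k => ?_) ?_ hsum
  · obtain ⟨r, hr, h⟩ := hscale (ρ ^ k) (hk k)
    -- Rescaled by ρ^k, the k-th piece is supported in [1, ρ). Undoing this costs the factor ρ^{kN}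
    -- and a dilation of x, which leaves the norm unchanged.
    have h1 := hunit (fun t => (Ico (ρ ^ k) (ρ ^ (k + 1))).indicator φ (ρ ^ k * t)) (M k).toReal
      ((hφ.indicator measurableSet_Ico).comp (measurable_const_mul _)) ENNReal.toReal_nonneg
      (fun t => by
        by_cases ht : ρ ^ k * t ∈ Ico (ρ ^ k) (ρ ^ (k + 1))
        · rw [indicator_of_mem ht, ← toReal_enorm]
          exact ENNReal.toReal_mono (hMtop k) (hM k _ ht)
        · rw [indicator_of_notMem ht, norm_zero]; exact ENNReal.toReal_nonneg)
      fun t ht => indicator_of_notMem (fun hmem => by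
        have h2 := hmem.2
        rw [zpow_add_one₀ hρ0.ne', mul_lt_mul_iff_right₀ (hk k)] at h2
        linarith) _
    have h2 := (h1.comp_smul (inv_ne_zero hr.ne')).const_mul (((ρ ^ k) ^ N : ℝ) : ℂ)
    have hc : (((ρ ^ k) ^ N : ℝ) : ℂ) ≠ 0 := by
      exact_mod_cast (pow_pos (hk k) N).ne'
    convert h2.mono (le_of_eq ?_) using 1
    · ext x
      rw [h, mul_inv_cancel_left₀ hc, smul_smul, mul_inv_cancel₀ hr.ne', one_smul]
    · rw [Complex.norm_real, Real.norm_of_nonneg (pow_pos (hk k) N).le]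
      ring
  · refine Summable.mul_left K ?_
    refine (ENNReal.summable_toReal hs).congr fun k => ?_
    rw [ENNReal.toReal_mul, ENNReal.toReal_pow, ENNReal.toReal_ofReal (hk k).le]

theorem orthantIntegral_mem_wienerAlgebra {d : ℕ} (hd : 1 ≤ d) {p ρ : ℝ} (hp : 0 < p) (hρ : 1 < ρ)
    {φ : ℝ → ℂ} (hφ : Measurable φ) (hb : LacunaryBound ρ d φ) :
    (orthantIntegral p φ : EuclideanSpace ℝ (Fin d) → ℂ) ∈ WienerAlgebra d := by
  obtain ⟨K, -, hK⟩ := exists_hasWienerNorm_orthantIntegral_of_bound d hp (zero_lt_one.trans hρ)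
  refine mem_wienerAlgebra_of_lacunaryBound hρ _ hK
    (fun c hc => ⟨c ^ (1 / p), by positivity, fun φ x => orthantIntegral_comp_mul hp φ hc x⟩)
    hφ hb fun x => ?_
  obtain ⟨n, rfl⟩ : ∃ n, d = n + 1 := ⟨d - 1, by omega⟩
  refine hasSum_setIntegral_lacunary hρ (by fun_prop)
    (MeasurableSet.univ_pi fun i => measurableSet_Ioi) (fun w hw => ?_)
    (integrableOn_orthantIntegral hd hφ (hb.lintegral_lt_top hρ) x)
  exact Finset.sum_pos (fun i _ => (Real.rpow_nonneg (abs_nonneg _) p).trans_lt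
    (hw i (mem_univ i))) Finset.univ_nonempty

theorem maxIntegral_mem_wienerAlgebra {d : ℕ} (hd : 1 ≤ d) {ρ : ℝ} (hρ : 1 < ρ)
    {φ : ℝ → ℂ} (hφ : Measurable φ) (hb : LacunaryBound ρ 1 φ) :
    (maxIntegral φ : EuclideanSpace ℝ (Fin d) → ℂ) ∈ WienerAlgebra d := by
  obtain ⟨K, -, hK⟩ := exists_hasWienerNorm_maxIntegral hd (zero_lt_one.trans hρ)
  refine mem_wienerAlgebra_of_lacunaryBound hρ _ hK
    (fun c hc => ⟨c, hc, fun φ x => by rw [maxIntegral_comp_mul φ hc x, pow_one]⟩)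
    hφ hb fun x => ?_
  refine hasSum_setIntegral_lacunary hρ measurable_id measurableSet_Ioi
    (fun u hu => (pAbs_top_nonneg x).trans_lt hu) ⟨hφ.aestronglyMeasurable, ?_⟩
  refine lt_of_le_of_lt (lintegral_mono_set (Ioi_subset_Ioi (pAbs_top_nonneg x))) ?_
  simpa using hb.lintegral_lt_top hρ

theorem continuous_pAbs_ofReal {d : ℕ} {p : ℝ} (hp : 0 < p) :
    Continuous fun x : EuclideanSpace ℝ (Fin d) => pAbs (ENNReal.ofReal p) x := by
  simp only [pAbs_ofReal hp]
  refine Continuous.rpow_const (continuous_finsetSum _ fun i _ => ?_) fun x => Or.inr (by positivity)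
  exact Continuous.rpow_const (by fun_prop) fun x => Or.inr hp.le

theorem continuous_pAbs_top {d : ℕ} :
    Continuous fun x : EuclideanSpace ℝ (Fin d) => pAbs ∞ x := by
  refine continuous_norm.comp ((PiLp.continuous_toLp ∞ fun _ : Fin d => ℝ).comp ?_)
  fun_prop

theorem pAbs_ofReal_nonneg {d : ℕ} {p : ℝ} (hp : 0 < p) (x : EuclideanSpace ℝ (Fin d)) :
    0 ≤ pAbs (ENNReal.ofReal p) x := by
  rw [pAbs_ofReal hp]
  exact Real.rpow_nonneg (Finset.sum_nonneg fun i _ => Real.rpow_nonneg (abs_nonneg _) _) _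

theorem sum_abs_rpow_pos {d : ℕ} {p : ℝ} {x : EuclideanSpace ℝ (Fin d)} (hx : x ≠ 0) :
    0 < ∑ i, |x i| ^ p := by
  obtain ⟨i, hi⟩ : ∃ i, x i ≠ 0 := by
    by_contra! h
    exact hx (by ext i; simpa using h i)
  refine (Real.rpow_pos_of_pos (abs_pos.2 hi) p).trans_le ?_
  exact Finset.single_le_sum (f := fun i => |x i| ^ p)
    (fun j _ => Real.rpow_nonneg (abs_nonneg _) _) (Finset.mem_univ i)

theorem pAbs_top_pos {d : ℕ} {x : EuclideanSpace ℝ (Fin d)} (hx : x ≠ 0) : 0 < pAbs ∞ x := by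
  by_contra! h
  obtain ⟨i, hi⟩ : ∃ i, x i ≠ 0 := by
    by_contra! h
    exact hx (by ext i; simpa using h i)
  exact lt_irrefl _ ((pAbs_top_lt_iff (abs_pos.2 hi)).1 (h.trans_lt (abs_pos.2 hi)) i)

/-- The descent to lower derivatives is used twice: for f with ratio 2, since the chain rule
involves all orders, and for E(s) = f(s^{1/p}) with ratio 2^p, so that the derivatives of E below
order d vanish at infinity and the orthant formula applies. -/
theorem mem_wienerAlgebra_of_powJet {d : ℕ} (hd : 1 ≤ d) {f : ℝ → ℂ} (hf : IsC0HalfLine f)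
    {D : ℕ → ℝ → ℂ} (hD0 : D 0 = f) (hD : IsACJet d D)
    (hm : ∀ i, 1 ≤ i → i ≤ d → Measurable (D i)) (hb : LacunaryBound 2 d (D d)) {p : ℝ}
    (hp : 0 < p) :
    (fun x => f (pAbs (ENNReal.ofReal p) x)) ∈ WienerAlgebra d := by
  obtain ⟨n, rfl⟩ : ∃ n, d = n + 1 := ⟨d - 1, by omega⟩
  have hρ : (1 : ℝ) < 2 ^ p := Real.one_lt_rpow one_lt_two hp
  have hlow := (hD.tendsto_and_lacunaryBound one_lt_two (hD0 ▸ hf.2) hb).2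
  have hb' := LacunaryBound.powJet hp hlow
  set E : ℕ → ℝ → ℂ := fun i => powJet (1 / p) i 0 D with hE
  have hEjet : IsACJet (n + 1) E := fun i hi =>
    hasACDeriv_powJet (by positivity) i 0 D fun j hj => hD j (by omega)
  have hE0 : ∀ s, E 0 s = f (s ^ (1 / p)) := fun s => by simp [hE, powJet, hD0]
  have hElim : Tendsto (E 0) atTop (𝓝 0) := by
    rw [funext hE0]
    exact hf.2.comp (tendsto_rpow_atTop (by positivity))
  have hElow := hEjet.tendsto_and_lacunaryBound hρ hElim hb'
  have hEm : Measurable (E (n + 1)) := measurable_powJet_zero n D hm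
  have hmem := const_mul_mem_wienerAlgebra
    (orthantIntegral_mem_wienerAlgebra hd hp hρ hEm hb') ((-1) ^ (n + 1))
  have hcont : Continuous fun x : EuclideanSpace ℝ (Fin (n + 1)) =>
      f (pAbs (ENNReal.ofReal p) x) :=
    hf.1.comp_continuous (continuous_pAbs_ofReal hp) fun x => pAbs_ofReal_nonneg hp x
  rwa [eq_of_continuous_of_ne_zero hd hcont (continuous_of_mem_wienerAlgebra hmem) fun x hx => ?_]
  rw [pAbs_ofReal hp, ← hE0]
  exact hEjet.eq_orthantIntegral hEm hElow.1 (fun s hs => lt_of_le_of_lt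
    (lintegral_mono_set (Ioi_subset_Ioi hs.le)) (hb'.lintegral_lt_top hρ)) p (sum_abs_rpow_pos hx)

theorem mem_wienerAlgebra_top {d : ℕ} (hd : 1 ≤ d) {f : ℝ → ℂ} (hf : IsC0HalfLine f)
    {γ : ℝ → ℂ} (hD : HasACDeriv f γ) (hm : Measurable γ) (hb : LacunaryBound 2 1 γ) :
    (fun x => f (pAbs ∞ x)) ∈ WienerAlgebra d := by
  have hmem := const_mul_mem_wienerAlgebra (maxIntegral_mem_wienerAlgebra hd one_lt_two hm hb) (-1)
  have hcont : Continuous fun x : EuclideanSpace ℝ (Fin d) => f (pAbs ∞ x) :=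
    hf.1.comp_continuous continuous_pAbs_top fun x => pAbs_top_nonneg x
  rwa [eq_of_continuous_of_ne_zero hd hcont (continuous_of_mem_wienerAlgebra hmem) fun x hx => ?_]
  have hpos := pAbs_top_pos hx
  have hint : IntegrableOn γ (Ioi (pAbs ∞ x)) := by
    refine ⟨hm.aestronglyMeasurable, ?_⟩
    refine lt_of_le_of_lt (lintegral_mono_set (Ioi_subset_Ioi hpos.le)) ?_
    simpa using hb.lintegral_lt_top one_lt_two
  have h := tendsto_nhds_unique (hD.tendsto_integral hpos hint) hf.2
  rw [eq_neg_of_add_eq_zero_left h, maxIntegral]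
  ring

/-- Only the dyadic bound on the top derivative is retained from the condition, and its form does
not involve p; hence every exponent q is allowed. -/
theorem ConditionB.mem_wienerAlgebra {d : ℕ} (hd : 1 ≤ d) {f : ℝ → ℂ} (hf : IsC0HalfLine f)
    (hAC : HasLocACDeriv (d - 1) f) {p : ℝ} (hp : 0 < p) (hp1 : p ≤ 1) (h : ConditionB d p f)
    {q : ℝ} (hq : 0 < q) : (fun x => f (pAbs (ENNReal.ofReal q) x)) ∈ WienerAlgebra d := by
  obtain ⟨D, hD0, hD, hm, hb⟩ := h.exists_isACJet hd hAC hp hp1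
  exact mem_wienerAlgebra_of_powJet hd hf hD0 hD hm hb hq

theorem ConditionB.mem_wienerAlgebra_top {d : ℕ} (hd : 1 ≤ d) {f : ℝ → ℂ} (hf : IsC0HalfLine f)
    (hAC : HasLocACDeriv (d - 1) f) {p : ℝ} (hp : 0 < p) (hp1 : p ≤ 1) (h : ConditionB d p f) :
    (fun x => f (pAbs ∞ x)) ∈ WienerAlgebra d := by
  obtain ⟨D, rfl, hD, hm, hb⟩ := h.exists_isACJet hd hAC hp hp1
  exact _root_.mem_wienerAlgebra_top hd hf (hD 0 hd) (hm 1 le_rfl hd)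
    ((hD.tendsto_and_lacunaryBound one_lt_two hf.2 hb).2 1 le_rfl hd)

/-! ### Smooth dyadic decomposition: condition В -/

theorem exists_forall_of_forall_exists_mono {d : ℕ} {P : ℕ → ℝ → Prop}
    (hmono : ∀ i c c', c ≤ c' → P i c → P i c') (h : ∀ i ≤ d, ∃ c, P i c) :
    ∃ c, 0 ≤ c ∧ ∀ i ≤ d, P i c := by
  choose! c hc using h
  refine ⟨∑ i ∈ Finset.range (d + 1), |c i|, by positivity, fun i hi => ?_⟩
  refine hmono i _ _ ((le_abs_self _).trans ?_) (hc i hi)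
  exact Finset.single_le_sum (f := fun i => |c i|) (fun _ _ => abs_nonneg _)
    (Finset.mem_range.2 (by omega))

theorem rpow_le_const_mul_rpow {x₀ x α β : ℝ} (h0 : 0 < x₀) (hx : x₀ ≤ x) (h : α ≤ β) :
    x ^ α ≤ x₀ ^ (α - β) * x ^ β := by
  have hx0 := h0.trans_le hx
  calc x ^ α = x ^ (α - β) * x ^ β := by rw [← Real.rpow_add hx0]; ring_nf
    _ ≤ _ := by
      refine mul_le_mul_of_nonneg_right ?_ (Real.rpow_nonneg hx0.le _)
      exact Real.rpow_le_rpow_of_nonpos h0 hx (by linarith)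

theorem rpow_le_two_rpow_abs {s : ℝ} (hs : s ∈ Icc (1 / 2) (2 : ℝ)) (α : ℝ) :
    s ^ α ≤ 2 ^ |α| := by
  have hs0 : 0 < s := by linarith [hs.1]
  rcases le_total 0 α with h | h
  · rw [abs_of_nonneg h]; exact Real.rpow_le_rpow hs0.le hs.2 h
  · rw [abs_of_nonpos h]
    refine (Real.rpow_le_rpow_of_nonpos (by norm_num) hs.1 h).trans (le_of_eq ?_)
    rw [one_div, Real.inv_rpow zero_le_two, Real.rpow_neg zero_le_two]

/-- A smooth bump supported in `[1/2, 2]` whose dyadic dilates form a partition of unity. -/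
noncomputable def dyadicBump (s : ℝ) : ℝ :=
  Real.smoothTransition (2 - s) - Real.smoothTransition (2 - 2 * s)

theorem contDiff_dyadicBump (n : ℕ) : ContDiff ℝ n dyadicBump := by
  have h : ContDiff ℝ n Real.smoothTransition := Real.smoothTransition.contDiff (n := n)
  exact (h.comp (contDiff_const.sub contDiff_id)).sub
    (h.comp (contDiff_const.sub (contDiff_const.mul contDiff_id)))

theorem abs_dyadicBump_le (s : ℝ) : |dyadicBump s| ≤ 1 := by
  have := Real.smoothTransition.le_one (2 - s)
  have := Real.smoothTransition.le_one (2 - 2 * s)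
  have := Real.smoothTransition.nonneg (2 - s)
  have := Real.smoothTransition.nonneg (2 - 2 * s)
  unfold dyadicBump
  rw [abs_sub_le_iff]
  constructor <;> linarith

theorem dyadicBump_eq_zero {s : ℝ} (hs : s ∉ Icc (1 / 2) (2 : ℝ)) : dyadicBump s = 0 := by
  unfold dyadicBump
  rw [mem_Icc, not_and_or, not_le, not_le] at hs
  rcases hs with hs | hs
  · rw [Real.smoothTransition.one_of_one_le (by linarith),
      Real.smoothTransition.one_of_one_le (by linarith), sub_self]
  · rw [Real.smoothTransition.zero_of_nonpos (by linarith),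
      Real.smoothTransition.zero_of_nonpos (by linarith), sub_self]

theorem iteratedDeriv_dyadicBump_eq_zero (i : ℕ) {s : ℝ} (hs : s ∉ Icc (1 / 2) (2 : ℝ)) :
    iteratedDeriv i dyadicBump s = 0 := by
  have h : dyadicBump =ᶠ[𝓝 s] 0 :=
    eventually_of_mem (isClosed_Icc.isOpen_compl.mem_nhds hs) fun t ht => dyadicBump_eq_zero ht
  rw [h.iteratedDeriv_eq, iteratedDeriv_const_zero]

theorem hasDerivAt_iteratedDeriv_dyadicBump (i : ℕ) (t : ℝ) :
    HasDerivAt (iteratedDeriv i dyadicBump) (iteratedDeriv (i + 1) dyadicBump t) t := by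
  rw [iteratedDeriv_succ]
  exact ((contDiff_dyadicBump (i + 1)).differentiable_iteratedDeriv i (by norm_cast; omega)
    t).hasDerivAt

theorem exists_iteratedDeriv_dyadicBump_le (d : ℕ) :
    ∃ c : ℝ, 0 ≤ c ∧ ∀ i ≤ d, ∀ s, |iteratedDeriv i dyadicBump s| ≤ c := by
  refine exists_forall_of_forall_exists_mono
    (P := fun i c => ∀ s, |iteratedDeriv i dyadicBump s| ≤ c)
    (fun i c c' hc h s => (h s).trans hc) fun i _ => ?_
  have hcont : Continuous (iteratedDeriv i dyadicBump) :=
    continuous_iff_continuousAt.2 fun t => (hasDerivAt_iteratedDeriv_dyadicBump i t).continuousAt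
  obtain ⟨c, hc⟩ := isCompact_Icc.exists_bound_of_continuousOn
    (hcont.continuousOn (s := Icc (1 / 2) (2 : ℝ)))
  refine ⟨max c 0, fun s => ?_⟩
  by_cases hs : s ∈ Icc (1 / 2) (2 : ℝ)
  · exact (hc s hs).trans (le_max_left _ _)
  · rw [iteratedDeriv_dyadicBump_eq_zero i hs, abs_zero]; exact le_max_right _ _

theorem measurable_mulJet (n : ℕ) (X : ℕ → ℝ → ℝ) (D : ℕ → ℝ → ℂ)
    (hX : ∀ i ≤ n, Measurable (X i)) (hD : ∀ i ≤ n, Measurable (D i)) :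
    Measurable (mulJet n X D) := by
  induction n generalizing X D with
  | zero => exact (Complex.measurable_ofReal.comp (hX 0 le_rfl)).mul (hD 0 le_rfl)
  | succ n ih =>
    exact (ih _ D (fun i hi => hX (i + 1) (by omega)) fun i hi => hD i (by omega)).add
      (ih X _ (fun i hi => hX i (by omega)) fun i hi => hD (i + 1) (by omega))

theorem continuous_sum_abs_rpow {d : ℕ} {p : ℝ} (hp : 0 < p) :
    Continuous fun x : EuclideanSpace ℝ (Fin d) => ∑ i, |x i| ^ p :=
  continuous_finsetSum _ fun i _ => Continuous.rpow_const (by fun_prop) fun x => Or.inr hp.le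

theorem sum_abs_rpow_nonneg {d : ℕ} (p : ℝ) (x : EuclideanSpace ℝ (Fin d)) :
    0 ≤ ∑ i, |x i| ^ p :=
  Finset.sum_nonneg fun i _ => Real.rpow_nonneg (abs_nonneg _) _

/-- Wiener norm of a compactly supported profile, by interpolation between the bound of the
profile and the bound of its top derivative. -/
theorem exists_hasWienerNorm_of_isACJet {d : ℕ} (hd : 1 ≤ d) {p R : ℝ} (hp : 1 ≤ p)
    (hR : 0 < R) {θ : ℝ} (hθ : 1 / 2 < θ) (hθ1 : θ ≤ 1) :
    ∃ K : ℝ, 0 ≤ K ∧ ∀ (J : ℕ → ℝ → ℂ) (A B : ℝ), IsACJet d J → Measurable (J d) →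
      ContinuousOn (J 0) (Ici 0) → 0 ≤ A → 0 ≤ B → (∀ s, ‖J 0 s‖ ≤ A) → (∀ s, ‖J d s‖ ≤ B) →
      (∀ i ≤ d, ∀ s, R ≤ s → J i s = 0) →
      HasWienerNorm (fun x : EuclideanSpace ℝ (Fin d) => J 0 (∑ i, |x i| ^ p))
        (K * (A ^ (1 - θ) * B ^ θ)) := by
  have hp0 : 0 < p := by linarith
  -- For p ≥ 1 the box exponent min p 1 equals 1, so the requirement is 2θ > 1.
  obtain ⟨K, hK, h⟩ := exists_hasWienerNorm_orthantIntegral (d := d) hp0 hR (θ := θ)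
    (by linarith) hθ1 (by rw [min_eq_right hp]; linarith)
  refine ⟨K, hK, fun J A B hJ hm hc hA hB hJA hJB h0 => ?_⟩
  have hlim : ∀ i < d, Tendsto (J i) atTop (𝓝 0) := fun i hi =>
    tendsto_const_nhds.congr' ((eventually_ge_atTop R).mono fun s hs => (h0 i hi.le s hs).symm)
  have hint : ∀ s, 0 < s → ∫⁻ t in Ioi s, ENNReal.ofReal t ^ (d - 1) * ‖J d t‖ₑ < ∞ := by
    intro s hs
    calc ∫⁻ t in Ioi s, ENNReal.ofReal t ^ (d - 1) * ‖J d t‖ₑ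
        ≤ ∫⁻ t in Ioi 0, (Ioc 0 R).indicator
            (fun _ => ENNReal.ofReal R ^ (d - 1) * ENNReal.ofReal B) t := by
          refine (lintegral_mono_set (Ioi_subset_Ioi hs.le)).trans
            (setLIntegral_mono' measurableSet_Ioi fun t ht => ?_)
          by_cases htR : t ≤ R
          · rw [indicator_of_mem (show t ∈ Ioc 0 R from ⟨ht, htR⟩), ← ofReal_norm]
            gcongr
            exact hJB t
          · rw [h0 d le_rfl t (not_le.1 htR).le]; simp
      _ ≤ ∫⁻ t, (Ioc 0 R).indicator
            (fun _ => ENNReal.ofReal R ^ (d - 1) * ENNReal.ofReal B) t := setLIntegral_le_lintegral _ _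
      _ < ∞ := by
          rw [lintegral_indicator measurableSet_Ioc, setLIntegral_const, Real.volume_Ioc]
          exact ENNReal.mul_lt_top (ENNReal.mul_lt_top (ENNReal.pow_lt_top ENNReal.ofReal_lt_top)
            ENNReal.ofReal_lt_top) ENNReal.ofReal_lt_top
  have hcO := continuous_orthantIntegral (d := d) hp0 hR hm hJB (h0 d le_rfl)
  have hcJ : Continuous fun x : EuclideanSpace ℝ (Fin d) => J 0 (∑ i, |x i| ^ p) :=
    hc.comp_continuous (continuous_sum_abs_rpow hp0) fun x => sum_abs_rpow_nonneg p x
  have heq := eq_of_continuous_of_ne_zero hd hcJ (hcO.const_mul ((-1) ^ d)) fun x hx =>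
    hJ.eq_orthantIntegral hm hlim hint p (sum_abs_rpow_pos hx)
  -- The orthant integral of J d equals ±J 0, so its size is controlled by A rather than by B. This
  -- is the gain from interpolation.
  have hOA : ∀ x : EuclideanSpace ℝ (Fin d), ‖orthantIntegral p (J d) x‖ ≤ A := fun x => by
    have := congrFun heq x
    have h2 : ‖orthantIntegral p (J d) x‖ = ‖J 0 (∑ i, |x i| ^ p)‖ := by rw [this]; simp
    exact h2.trans_le (hJA _)
  have h3 := (h (J d) A B hm hA hB hJB (h0 d le_rfl) hOA).const_mul ((-1) ^ d)
  rw [heq]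
  simpa using h3

/-- At θ = 1/2 the wanted inequality is τ/2 < κ, which is strict; u is an increase small enough to
preserve it. -/
theorem exists_theta {κ τ : ℝ} (hτ : 0 ≤ τ) (h : τ < 2 * κ) :
    ∃ θ : ℝ, 1 / 2 < θ ∧ θ ≤ 1 ∧ θ * τ < κ := by
  have h1 : 0 < κ - τ / 2 := by linarith
  set u := (κ - τ / 2) / (τ + 1) with hu
  have hu0 : 0 < u := by positivity
  refine ⟨1 / 2 + min (1 / 2) u, by have := lt_min one_half_pos hu0; linarith,
    by have := min_le_left (1 / 2) u; linarith, ?_⟩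
  have h2 : u * τ < κ - τ / 2 := by
    rw [hu, div_mul_eq_mul_div, div_lt_iff₀ (by linarith)]
    nlinarith
  have h3 : min (1 / 2) u * τ ≤ u * τ := mul_le_mul_of_nonneg_right (min_le_right _ _) hτ
  linarith

/-- The bumps telescope: the partial sums reach 1 - u 0. For s > s₁ the term u 0 vanishes, and for s
≤ s₁ it is z that vanishes. -/
theorem hasSum_dyadicBump {s s₁ : ℝ} (hs₁ : 0 < s₁) {z : ℂ} (hz : s ≤ s₁ → z = 0) :
    HasSum (fun m : ℕ => (dyadicBump ((s₁ * 2 ^ m)⁻¹ * s) : ℂ) * z) z := by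
  set u : ℕ → ℝ := fun m => Real.smoothTransition (2 - 2 * ((s₁ * 2 ^ m)⁻¹ * s)) with hu
  have hstep : ∀ m, dyadicBump ((s₁ * 2 ^ m)⁻¹ * s) = u (m + 1) - u m := fun m => by
    simp only [hu, dyadicBump]
    congr 3
    rw [pow_succ]
    field_simp
  obtain ⟨N, hN⟩ := pow_unbounded_of_one_lt (2 * s / s₁) (one_lt_two : (1 : ℝ) < 2)
  have hone : ∀ m, N ≤ m → u m = 1 := fun m hm => by
    refine Real.smoothTransition.one_of_one_le ?_
    have h1 : (2 : ℝ) ^ N ≤ 2 ^ m := pow_le_pow_right₀ one_le_two hm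
    have h2 : 2 * ((s₁ * 2 ^ m)⁻¹ * s) ≤ 1 := by
      rw [div_lt_iff₀ hs₁] at hN
      rw [mul_left_comm, inv_mul_le_iff₀ (by positivity), mul_one]
      nlinarith
    linarith
  have hsum : ∑ m ∈ Finset.range N, (dyadicBump ((s₁ * 2 ^ m)⁻¹ * s) : ℂ) * z = z := by
    rw [← Finset.sum_mul]
    simp only [hstep]
    rw [← Complex.ofReal_sum, Finset.sum_range_sub, hone N le_rfl]
    rcases le_or_gt s s₁ with h | h
    · rw [hz h, mul_zero]
    · have : u 0 = 0 := Real.smoothTransition.zero_of_nonpos (by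
        have : 1 ≤ s₁⁻¹ * s := by
          rw [inv_mul_eq_div, one_le_div hs₁]; exact h.le
        simp only [pow_zero, mul_one]
        linarith)
      rw [this]; simp
  have h := hasSum_sum_of_ne_finset_zero
    (f := fun m : ℕ => (dyadicBump ((s₁ * 2 ^ m)⁻¹ * s) : ℂ) * z) (s := Finset.range N)
    (L := SummationFilter.unconditional ℕ) fun m hm => by
    rw [Finset.mem_range, not_lt] at hm
    rw [hstep, hone m hm, hone (m + 1) (by omega)]; simp
  rwa [hsum] at h

/-- A profile vanishing near the origin, whose derivatives have controlled growth at infinity. -/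
theorem mem_wienerAlgebra_of_growth {d : ℕ} (hd : 1 ≤ d) {p κ σ s₁ : ℝ} (hp : 1 ≤ p)
    (hs₁ : 0 < s₁) (hσ : 0 ≤ σ) (hσκ : d * σ < 2 * κ) {E : ℕ → ℝ → ℂ} (hE : IsACJet d E)
    (hm : ∀ i ≤ d, Measurable (E i)) (hc : ContinuousOn (E 0) (Ici 0))
    (h0 : ∀ s ∈ Icc 0 s₁, E 0 s = 0)
    (hb : ∀ i ≤ d, ∃ C, ∀ s, s₁ / 2 ≤ s → ‖E i s‖ ≤ C * s ^ (-κ - i + i * σ)) :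
    (fun x : EuclideanSpace ℝ (Fin d) => E 0 (∑ i, |x i| ^ p)) ∈ WienerAlgebra d := by
  have hp0 : 0 < p := by linarith
  obtain ⟨θ, hθ, hθ1, hθσ⟩ := exists_theta (mul_nonneg (Nat.cast_nonneg d) hσ) hσκ
  -- Any R beyond the support [1/2, 2] of the bump serves.
  obtain ⟨K, hK, hW⟩ := exists_hasWienerNorm_of_isACJet (d := d) hd hp (R := 3) (by norm_num) hθ hθ1
  obtain ⟨c, hc0, hX⟩ := exists_iteratedDeriv_dyadicBump_le d
  -- Derivatives of s ↦ E 0 (rs) on the support of the bump. Since r ≥ s₁ and s ≥ 1/2, the argument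
  -- stays in the range rs ≥ s₁/2 of the hypothesis.
  obtain ⟨C, hC, hbC⟩ : ∃ C, 0 ≤ C ∧ ∀ i ≤ d, ∀ r, s₁ ≤ r → ∀ s ∈ Icc (1 / 2) (2 : ℝ),
      ‖(r : ℂ) ^ i * E i (r * s)‖ ≤ C * r ^ (-κ + i * σ) := by
    refine exists_forall_of_forall_exists_mono
      (P := fun i C => ∀ r, s₁ ≤ r → ∀ s ∈ Icc (1 / 2) (2 : ℝ),
        ‖(r : ℂ) ^ i * E i (r * s)‖ ≤ C * r ^ (-κ + i * σ))
      (fun i a b hab h r hr s hs => (h r hr s hs).trans (mul_le_mul_of_nonneg_right hab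
        (Real.rpow_nonneg (hs₁.le.trans hr) _))) fun i hi => ?_
    obtain ⟨C, hC⟩ := hb i hi
    refine ⟨|C| * 2 ^ |-κ - i + i * σ|, fun r hr s hs => ?_⟩
    have hr0 := hs₁.trans_le hr
    have hs0 : 0 < s := by linarith [hs.1]
    rw [norm_mul, norm_pow, Complex.norm_real, Real.norm_of_nonneg hr0.le]
    calc r ^ i * ‖E i (r * s)‖ ≤ r ^ i * (|C| * (r * s) ^ (-κ - i + i * σ)) := by
          refine mul_le_mul_of_nonneg_left ((hC _ ?_).trans ?_) (by positivity)
          · have := hs.1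
            nlinarith
          · exact mul_le_mul_of_nonneg_right (le_abs_self C) (by positivity)
      _ = |C| * s ^ (-κ - i + i * σ) * r ^ (-κ + i * σ) := by
          have e : r ^ (-κ + i * σ) = r ^ i * r ^ (-κ - i + i * σ) := by
            rw [← Real.rpow_natCast, ← Real.rpow_add hr0]; ring_nf
          rw [Real.mul_rpow hr0.le hs0.le, e]
          ring
      _ ≤ _ := by
          refine mul_le_mul_of_nonneg_right (mul_le_mul_of_nonneg_left
            (rpow_le_two_rpow_abs hs _) (abs_nonneg C)) (by positivity)
  -- As σ ≥ 0 and r is bounded below, the growth at order d dominates all lower orders.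
  obtain ⟨C', hC', hbC'⟩ : ∃ C', 0 ≤ C' ∧ ∀ i ≤ d, ∀ r, s₁ ≤ r →
      r ^ (-κ + i * σ) ≤ C' * r ^ (-κ + d * σ) := by
    refine exists_forall_of_forall_exists_mono
      (P := fun i C' => ∀ r, s₁ ≤ r → r ^ (-κ + i * σ) ≤ C' * r ^ (-κ + d * σ))
      (fun i a b hab h r hr => (h r hr).trans (mul_le_mul_of_nonneg_right hab
        (Real.rpow_nonneg (hs₁.le.trans hr) _))) fun i hi => ?_
    refine ⟨_, fun r hr => rpow_le_const_mul_rpow hs₁ hr ?_⟩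
    have : (i : ℝ) * σ ≤ d * σ := mul_le_mul_of_nonneg_right (by exact_mod_cast hi) hσ
    linarith
  set X : ℕ → ℝ → ℝ := fun i => iteratedDeriv i dyadicBump with hXdef
  have hX0 : X 0 = dyadicBump := iteratedDeriv_zero
  have hXd : ∀ i t, HasDerivAt (X i) (X (i + 1) t) t := hasDerivAt_iteratedDeriv_dyadicBump
  have hXc : ∀ i, Continuous (X i) := fun i =>
    continuous_iff_continuousAt.2 fun t => (hXd i t).continuousAt
  have hXz : ∀ i s, s ∉ Icc (1 / 2) (2 : ℝ) → X i s = 0 := fun i s hs =>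
    iteratedDeriv_dyadicBump_eq_zero i hs
  -- The piece at scale r, moved to unit scale: A is of order r^{-κ} and B of order r^{-κ+dσ}.
  have piece : ∀ r, s₁ ≤ r → HasWienerNorm (fun x : EuclideanSpace ℝ (Fin d) =>
      (dyadicBump (∑ i, |x i| ^ p) : ℂ) * E 0 (r * ∑ i, |x i| ^ p))
      (K * ((C * r ^ (-κ)) ^ (1 - θ) *
        (2 ^ d * (c * (C * (C' * r ^ (-κ + d * σ))))) ^ θ)) := by
    intro r hr
    have hr0 := hs₁.trans_le hr
    set Dr : ℕ → ℝ → ℂ := fun i s => (r : ℂ) ^ i * E i (r * s) with hDr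
    have hDjet : IsACJet d Dr := fun i hi =>
      (((hE i hi).comp_mul_left hr0).const_mul ((r : ℂ) ^ i)).congr (fun t _ => rfl)
        fun t _ => by simp only [hDr, pow_succ]; ring
    have h := hW (fun i => mulJet i X Dr) (C * r ^ (-κ))
      (2 ^ d * (c * (C * (C' * r ^ (-κ + d * σ)))))
      (fun i hi => hasACDeriv_mulJet i X Dr hXd fun j hj => hDjet j (by omega))
      (measurable_mulJet d X Dr (fun i _ => (hXc i).measurable) fun i hi =>
        ((hm i hi).comp (measurable_const_mul r)).const_mul _)
      ?_ (by positivity) (by positivity) (fun s => ?_) (fun s => ?_) fun i hi s hs => ?_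
    · simpa [mulJet, hDr, hX0] using h
    · simp only [mulJet]
      refine (Complex.continuous_ofReal.comp (hXc 0)).continuousOn.mul (continuousOn_const.mul ?_)
      exact hc.comp (by fun_prop) fun s hs => mul_nonneg hr0.le hs
    · simp only [mulJet]
      by_cases hs : s ∈ Icc (1 / 2) (2 : ℝ)
      · rw [norm_mul, Complex.norm_real, Real.norm_eq_abs, hX0]
        refine (mul_le_of_le_one_left (norm_nonneg _) (abs_dyadicBump_le s)).trans ?_
        simpa [hDr] using hbC 0 (Nat.zero_le d) r hr s hs
      · rw [hXz 0 s hs]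
        simp only [Complex.ofReal_zero, zero_mul, norm_zero]
        positivity
    · by_cases hs : s ∈ Icc (1 / 2) (2 : ℝ)
      · refine norm_mulJet_le d X Dr hc0 (fun i hi => hX i hi s) fun i hi => ?_
        exact (hbC i hi r hr s hs).trans (mul_le_mul_of_nonneg_left (hbC' i hi r hr) hC)
      · simp only [mulJet_eq_zero d X Dr fun i _ => hXz i s hs, norm_zero]
        positivity
    · exact mulJet_eq_zero i X Dr fun j _ => hXz j s fun hmem => by linarith [hmem.2]
  have hr : ∀ m : ℕ, s₁ ≤ s₁ * 2 ^ m := fun m =>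
    le_mul_of_one_le_right hs₁.le (one_le_pow₀ one_le_two)
  have hscale : ∀ (m : ℕ) (x : EuclideanSpace ℝ (Fin d)),
      ∑ i, |(((s₁ * 2 ^ m)⁻¹ : ℝ) ^ (1 / p) • x) i| ^ p = (s₁ * 2 ^ m)⁻¹ * ∑ i, |x i| ^ p := by
    intro m x
    have hpos : 0 < (s₁ * 2 ^ m)⁻¹ := by positivity
    rw [Finset.mul_sum]
    refine Finset.sum_congr rfl fun i _ => ?_
    rw [PiLp.smul_apply, smul_eq_mul, abs_mul, abs_of_pos (Real.rpow_pos_of_pos hpos _),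
      Real.mul_rpow (Real.rpow_nonneg hpos.le _) (abs_nonneg _), ← Real.rpow_mul hpos.le,
      one_div_mul_cancel hp0.ne', Real.rpow_one]
  refine HasWienerNorm.mem_wienerAlgebra_of_hasSum
    (f := fun m : ℕ => fun x : EuclideanSpace ℝ (Fin d) =>
      (dyadicBump ((s₁ * 2 ^ m)⁻¹ * ∑ i, |x i| ^ p) : ℂ) * E 0 (∑ i, |x i| ^ p))
    (b := fun m => K * ((C * (s₁ * 2 ^ m) ^ (-κ)) ^ (1 - θ) *
      (2 ^ d * (c * (C * (C' * (s₁ * 2 ^ m) ^ (-κ + d * σ))))) ^ θ)) (fun m => ?_) ?_ fun x => ?_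
  · have hne : ((s₁ * 2 ^ m)⁻¹ : ℝ) ^ (1 / p) ≠ 0 := (by positivity : (0 : ℝ) < _).ne'
    have h := (piece _ (hr m)).comp_smul hne
    simp only [hscale, mul_inv_cancel_left₀ (by positivity : s₁ * 2 ^ m ≠ 0)] at h
    exact h
  · refine Summable.mul_left K ?_
    -- The m-th norm is a constant times (s₁ 2^m)^{-(κ - θdσ)}, and κ - θdσ > 0 by the choice of θ.
    have hgeo : Summable fun m : ℕ => (C ^ (1 - θ) * (2 ^ d * (c * (C * C'))) ^ θ *
        s₁ ^ (-(κ - θ * (d * σ)))) * ((2 : ℝ) ^ (-(κ - θ * (d * σ)))) ^ m :=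
      (summable_geometric_of_lt_one (by positivity)
        (Real.rpow_lt_one_of_one_lt_of_neg one_lt_two (by linarith))).mul_left _
    refine hgeo.congr fun m => ?_
    have hrm : 0 < s₁ * 2 ^ m := by positivity
    have e1 : ((2 : ℝ) ^ (-(κ - θ * (d * σ)))) ^ m = ((2 : ℝ) ^ m) ^ (-(κ - θ * (d * σ))) := by
      rw [← Real.rpow_natCast, ← Real.rpow_natCast, ← Real.rpow_mul zero_le_two,
        ← Real.rpow_mul zero_le_two, mul_comm]
    have e2 : 2 ^ d * (c * (C * (C' * (s₁ * 2 ^ m) ^ (-κ + d * σ)))) =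
        2 ^ d * (c * (C * C')) * (s₁ * 2 ^ m) ^ (-κ + d * σ) := by ring
    rw [e1, mul_assoc, ← Real.mul_rpow hs₁.le (by positivity), e2,
      Real.mul_rpow hC (by positivity),
      Real.mul_rpow (x := 2 ^ d * (c * (C * C'))) (by positivity) (by positivity),
      ← Real.rpow_mul hrm.le, ← Real.rpow_mul hrm.le,
      show -(κ - θ * (d * σ)) = -κ * (1 - θ) + (-κ + d * σ) * θ by ring, Real.rpow_add hrm]
    ring
  · exact hasSum_dyadicBump hs₁ fun h => h0 _ ⟨sum_abs_rpow_nonneg p x, h⟩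

/-- A normalisation. The function is continued by f 0 to negative arguments, which makes it
continuous on the line, and the top derivative is altered on a null set. Replacing δ by min δ 1 only
weakens bounds on t ≥ t₀ > 0, and it ensures 1 - δ ≥ 0. -/
theorem ConditionV.exists_isACJet {d : ℕ} (hd : 1 ≤ d) {f : ℝ → ℂ} (hf : IsC0HalfLine f)
    (hAC : HasLocACDeriv (d - 1) f) (h : ConditionV d f) :
    ∃ a > (0 : ℝ), ∃ ε > (0 : ℝ), ∃ δ ≤ (1 : ℝ), 1 - 2 * ε / d < δ ∧ ∃ D : ℕ → ℝ → ℂ,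
      (∀ t, 0 ≤ t → D 0 t = f t) ∧ Continuous (D 0) ∧ IsACJet d D ∧ (∀ i ≤ d, Measurable (D i)) ∧
      (∀ t ∈ Icc 0 a, D 0 t = 0) ∧ (∀ i < d, ∀ t ∈ Ioo 0 a, D i t = 0) ∧
      ∀ i ≤ d, ∀ t₀ > (0 : ℝ), ∃ C, ∀ t, t₀ ≤ t → ‖D i t‖ ≤ C * t ^ (-(ε + i * δ)) := by
  obtain ⟨a, ha, ε, hε, δ, hδ, hz, hlow, Ctop, htop⟩ := h
  obtain ⟨D, hDi, hD, hDm, hb⟩ := exists_isACJet_enorm_le hd hAC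
    (m := fun t => ENNReal.ofReal (|Ctop| * t ^ (-(ε + d * δ)))) (by fun_prop) (by
      rw [ae_restrict_iff' measurableSet_Ioi] at htop ⊢
      filter_upwards [htop] with t ht ht0
      rw [← ofReal_norm]
      refine ENNReal.ofReal_le_ofReal ((ht ht0).trans ?_)
      exact mul_le_mul_of_nonneg_right (le_abs_self _) (Real.rpow_nonneg (le_of_lt ht0) _))
  have hpos : ∀ i ≤ d, ∀ t, 0 < t → Function.update D 0 (fun t => f (max t 0)) i t = D i t := by
    intro i _ t ht
    rcases eq_or_ne i 0 with rfl | hne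
    · rw [Function.update_self, max_eq_left ht.le, hDi 0 hd, iteratedDeriv_zero]
    · rw [Function.update_of_ne hne]
  have hcont : Continuous fun t => f (max t 0) :=
    hf.1.comp_continuous (by fun_prop) fun t => mem_Ici.2 (le_max_right _ _)
  have hlt : ∀ i < d, ∀ t ∈ Ioo 0 a, D i t = 0 := by
    intro i hi t ht
    have he : f =ᶠ[𝓝 t] 0 := eventually_of_mem (Ioo_mem_nhds ht.1 ht.2)
      fun s hs => hz s ⟨hs.1.le, hs.2.le⟩
    rw [hDi i hi, he.iteratedDeriv_eq, iteratedDeriv_const_zero]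
  refine ⟨a, ha, ε, hε, min δ 1, min_le_right _ _, lt_min hδ ?_,
    Function.update D 0 (fun t => f (max t 0)), fun t ht => ?_, ?_, fun i hi => ?_, fun i hi => ?_,
    fun t ht => ?_, fun i hi t ht => ?_, fun i hi t₀ ht₀ => ?_⟩
  · have : 0 < 2 * ε / d := by positivity
    linarith
  · rw [Function.update_self, max_eq_left ht]
  · rwa [Function.update_self]
  · exact (hD i hi).congr (fun t ht => hpos i hi.le t ht) fun t ht => hpos (i + 1) hi t ht
  · rcases eq_or_ne i 0 with rfl | hne
    · rw [Function.update_self]; exact hcont.measurable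
    · rw [Function.update_of_ne hne]; exact hDm i (by omega) hi
  · rw [Function.update_self, max_eq_left ht.1]; exact hz t ht
  · rw [hpos i hi.le t ht.1]; exact hlt i hi t ht
  · obtain ⟨C, hC0, hC⟩ : ∃ C, 0 ≤ C ∧ ∀ t, 0 < t → ‖D i t‖ ≤ C * t ^ (-(ε + i * δ)) := by
      rcases lt_or_eq_of_le hi with h | rfl
      · obtain ⟨C, hC⟩ := hlow i h
        refine ⟨|C|, abs_nonneg C, fun t ht => ?_⟩
        rw [hDi i h]
        exact (hC t ht).trans (mul_le_mul_of_nonneg_right (le_abs_self C)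
          (Real.rpow_nonneg ht.le _))
      · refine ⟨|Ctop|, abs_nonneg _, fun t ht => ?_⟩
        have h1 := hb t
        rwa [← ofReal_norm, ENNReal.ofReal_le_ofReal_iff (mul_nonneg (abs_nonneg _)
          (Real.rpow_nonneg ht.le _))] at h1
    refine ⟨C * t₀ ^ (-(ε + i * δ) - -(ε + i * min δ 1)), fun t ht => ?_⟩
    rw [hpos i hi t (ht₀.trans_le ht), mul_assoc]
    refine (hC t (ht₀.trans_le ht)).trans (mul_le_mul_of_nonneg_left ?_ hC0)
    refine rpow_le_const_mul_rpow ht₀ ht ?_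
    have : (i : ℝ) * min δ 1 ≤ i * δ := mul_le_mul_of_nonneg_left (min_le_left _ _)
      (Nat.cast_nonneg i)
    linarith

/-- With κ = ε/p and σ = (1-δ)/p, the terms of the n-th derivative of f(s^{1/p}) are O(s^{-κ-n+jσ})
for j ≤ n, and the worst is j = n. The requirement dσ < 2κ is δ > 1 - 2ε/d. -/
theorem ConditionV.mem_wienerAlgebra {d : ℕ} (hd : 1 ≤ d) {f : ℝ → ℂ} (hf : IsC0HalfLine f)
    (hAC : HasLocACDeriv (d - 1) f) (h : ConditionV d f) {p : ℝ} (hp : 1 ≤ p) :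
    (fun x => f (pAbs (ENNReal.ofReal p) x)) ∈ WienerAlgebra d := by
  obtain ⟨a, ha, ε, hε, δ, hδ1, hδ, D, hDf, hDc, hD, hDm, hDz, -, hDb⟩ := h.exists_isACJet hd hf hAC
  have hp0 : 0 < p := by linarith
  have hq : 0 < 1 / p := by positivity
  set q := 1 / p with hqdef
  have hE0 : ∀ s, powJet q 0 0 D s = D 0 (s ^ q) := fun s => by simp [powJet]
  have hd0 : (0 : ℝ) < d := by exact_mod_cast hd
  have hmem := mem_wienerAlgebra_of_growth (d := d) hd (p := p) (κ := q * ε) (σ := q * (1 - δ))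
    (s₁ := a ^ p) (E := fun i => powJet q i 0 D) hp (by positivity)
    (mul_nonneg hq.le (by linarith)) ?_
    (fun i hi => hasACDeriv_powJet hq i 0 D fun j hj => hD j (by omega))
    (fun i hi => measurable_powJet i 0 D fun j hj => hDm j (by omega)) ?_ (fun s hs => ?_)
    fun n hn => ?_
  · convert hmem using 2 with x
    rw [hE0, pAbs_ofReal hp0, hDf _ (Real.rpow_nonneg (sum_abs_rpow_nonneg p x) _)]
  · have h1 : d * (1 - δ) < 2 * ε := by
      have h2 : 1 - δ < 2 * ε / d := by linarith
      rw [lt_div_iff₀ hd0] at h2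
      linarith
    calc d * (q * (1 - δ)) = q * (d * (1 - δ)) := by ring
      _ < q * (2 * ε) := mul_lt_mul_of_pos_left h1 hq
      _ = _ := by ring
  · refine ContinuousOn.congr (f := fun s => D 0 (s ^ q)) ?_ fun s _ => hE0 s
    exact (hDc.comp (Real.continuous_rpow_const hq.le)).continuousOn
  · rw [hE0]
    refine hDz _ ⟨Real.rpow_nonneg hs.1 _, ?_⟩
    have := Real.rpow_le_rpow hs.1 hs.2 hq.le
    rwa [← Real.rpow_mul ha.le, hqdef, mul_one_div_cancel hp0.ne', Real.rpow_one] at this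
  · obtain ⟨C, hC, hE⟩ := exists_norm_powJet_le q n 0
    set s₀ := a ^ p / 2 with hs₀def
    have hs₀ : 0 < s₀ := by positivity
    choose! c hc using fun j (hj : j ≤ d) => hDb j hj (s₀ ^ q) (by positivity)
    refine ⟨C * ∑ j ∈ Finset.range (n + 1), |c j| *
      s₀ ^ ((0 + j * q - n + q * -(ε + j * δ)) - (-(q * ε) - n + n * (q * (1 - δ)))),
      fun s hs => ?_⟩
    have hs0 := hs₀.trans_le hs
    refine (hE D s hs0).trans ?_
    rw [mul_assoc, Finset.sum_mul]
    refine mul_le_mul_of_nonneg_left (Finset.sum_le_sum fun j hj => ?_) hC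
    have hj : j ≤ n := by have := Finset.mem_range.1 hj; omega
    calc s ^ (0 + j * q - n) * ‖D j (s ^ q)‖
        ≤ s ^ (0 + j * q - n) * (|c j| * (s ^ q) ^ (-(ε + j * δ))) := by
          refine mul_le_mul_of_nonneg_left ((hc j (hj.trans hn) (s ^ q)
            (Real.rpow_le_rpow hs₀.le hs hq.le)).trans ?_) (Real.rpow_nonneg hs0.le _)
          exact mul_le_mul_of_nonneg_right (le_abs_self _)
            (Real.rpow_nonneg (Real.rpow_nonneg hs0.le _) _)
      _ = |c j| * s ^ (0 + j * q - n + q * -(ε + j * δ)) := by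
          rw [← Real.rpow_mul hs0.le, Real.rpow_add hs0]; ring
      _ ≤ _ := by
          rw [mul_assoc]
          refine mul_le_mul_of_nonneg_left (rpow_le_const_mul_rpow hs₀ hs ?_) (abs_nonneg _)
          have h1 : (j : ℝ) * (q * (1 - δ)) ≤ n * (q * (1 - δ)) :=
            mul_le_mul_of_nonneg_right (by exact_mod_cast hj) (mul_nonneg hq.le (by linarith))
          linarith

/-- The intervals lying below a contribute nothing, and the others form a geometric series of ratio
2^{1-β}. -/
theorem LacunaryBound.of_rpow_decay {γ : ℝ → ℂ} {a β C : ℝ} (ha : 0 < a) (hβ : 1 < β)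
    (h0 : ∀ t ∈ Ioo 0 a, γ t = 0) (h : ∀ t, a ≤ t → ‖γ t‖ ≤ C * t ^ (-β)) :
    LacunaryBound 2 1 γ := by
  have h2 : ∀ k : ℤ, (0 : ℝ) < 2 ^ k := fun k => zpow_pos two_pos k
  obtain ⟨k₀, hk₀⟩ := exists_mem_Ico_zpow ha (one_lt_two : (1 : ℝ) < 2)
  refine ⟨fun k => if k < k₀ then 0 else ENNReal.ofReal (|C| * (2 ^ k) ^ (-β)), ?_,
    fun k t ht => ?_⟩
  · have hinj : Function.Injective fun n : ℕ => k₀ + (n : ℤ) := fun m n h => by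
      simpa using h
    rw [← hinj.tsum_eq fun k hk => ?_]
    · have hs : Summable fun n : ℕ => |C| * ((2 : ℝ) ^ k₀) ^ (1 - β) * (2 ^ (1 - β)) ^ n :=
        (summable_geometric_of_lt_one (by positivity)
          (Real.rpow_lt_one_of_one_lt_of_neg one_lt_two (by linarith))).mul_left _
      convert hs.tsum_ofReal_ne_top using 3 with n
      beta_reduce
      rw [if_neg (by omega), pow_one, ← ENNReal.ofReal_mul (h2 _).le]
      congr 1
      have e : (2 : ℝ) ^ (k₀ + n : ℤ) * (2 ^ (k₀ + n : ℤ)) ^ (-β) =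
          (2 ^ (k₀ + n : ℤ)) ^ (1 - β) := by
        rw [sub_eq_add_neg, Real.rpow_add (h2 _), Real.rpow_one]
      have e1 : ((2 : ℝ) ^ (1 - β)) ^ n = (2 ^ n) ^ (1 - β) := by
        rw [← Real.rpow_natCast, ← Real.rpow_natCast, ← Real.rpow_mul zero_le_two,
          ← Real.rpow_mul zero_le_two, mul_comm]
      rw [mul_left_comm, e, zpow_add₀ two_ne_zero, zpow_natCast,
        Real.mul_rpow (h2 _).le (by positivity), e1]
      ring
    · have hk' : k₀ ≤ k := by
        by_contra! hlt
        exact hk (by simp [hlt])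
      exact ⟨(k - k₀).toNat, by beta_reduce; omega⟩
  · have ht0 := (h2 k).trans_le ht.1
    rcases lt_or_ge t a with hta | hta
    · rw [h0 t ⟨ht0, hta⟩]; simp
    · have hk : k₀ < k + 1 := (zpow_lt_zpow_iff_right₀ one_lt_two).1
        ((hk₀.1.trans hta).trans_lt ht.2)
      beta_reduce
      rw [if_neg (by omega), ← ofReal_norm]
      refine ENNReal.ofReal_le_ofReal ((h t hta).trans ?_)
      refine mul_le_mul (le_abs_self C) ?_ (Real.rpow_nonneg ht0.le _) (abs_nonneg C)
      exact Real.rpow_le_rpow_of_nonpos (h2 k) ht.1 (by linarith)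

theorem pAbs_top_eq_pAbs_one (x : EuclideanSpace ℝ (Fin 1)) :
    pAbs ∞ x = pAbs (ENNReal.ofReal 1) x := by
  rw [pAbs_top, pAbs_ofReal one_pos]
  simp

/-- For d ≥ 2 one has 2ε/d ≤ ε, so δ + ε > 1 and f' decays fast enough for the representation by
cubes. For d = 1 this can fail, but there |x|_∞ = |x|_1. -/
theorem ConditionV.mem_wienerAlgebra_top {d : ℕ} (hd : 1 ≤ d) {f : ℝ → ℂ} (hf : IsC0HalfLine f)
    (hAC : HasLocACDeriv (d - 1) f) (h : ConditionV d f) :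
    (fun x => f (pAbs ∞ x)) ∈ WienerAlgebra d := by
  rcases eq_or_lt_of_le hd with rfl | hd2
  · simp only [pAbs_top_eq_pAbs_one]
    exact h.mem_wienerAlgebra hd hf hAC le_rfl
  obtain ⟨a, ha, ε, hε, δ, hδ1, hδ, D, hDf, hDc, hD, hDm, hDz, hDl, hDb⟩ :=
    h.exists_isACJet hd hf hAC
  obtain ⟨C, hC⟩ := hDb 1 hd a ha
  have hβ : 1 < ε + (1 : ℕ) * δ := by
    have h1 : 2 * ε / d ≤ ε := by
      rw [div_le_iff₀ (by positivity)]
      have : (2 : ℝ) ≤ d := by exact_mod_cast hd2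
      nlinarith
    push_cast
    linarith
  exact _root_.mem_wienerAlgebra_top hd hf
    ((hD 0 hd).congr (fun t ht => (hDf t ht.le).symm) fun _ _ => rfl) (hDm 1 hd)
    (LacunaryBound.of_rpow_decay ha hβ (hDl 1 hd2) hC)

theorem mainTheorem1 (d : ℕ) (hd : 1 ≤ d) (f₀ : ℝ → ℂ)
    (hC0 : IsC0HalfLine f₀) (hAC : HasLocACDeriv (d - 1) f₀) :
    (ConditionA d f₀ ∨ ConditionV d f₀ →
      ∀ p : ℝ≥0∞, 1 ≤ p → (fun x => f₀ (pAbs p x)) ∈ WienerAlgebra d) ∧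
    (∀ p : ℝ, 0 < p → p < 1 → ConditionB d p f₀ →
      (fun x => f₀ (pAbs (ENNReal.ofReal p) x)) ∈ WienerAlgebra d) := by
  refine ⟨fun h p hp => ?_, fun p hp hp1 h => h.mem_wienerAlgebra hd hC0 hAC hp hp1.le hp⟩
  -- Condition А is condition Б at exponent 1; p = ∞ goes through cubes, finite p through the
  -- substitution s^{1/p}.
  rcases eq_or_ne p ∞ with rfl | hpt
  · rcases h with h | h
    · exact h.conditionB.mem_wienerAlgebra_top hd hC0 hAC one_pos le_rfl
    · exact h.mem_wienerAlgebra_top hd hC0 hAC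
  · have hp1 : 1 ≤ p.toReal := by
      simpa using ENNReal.toReal_mono hpt hp
    rw [← ENNReal.ofReal_toReal hpt]
    rcases h with h | h
    · exact h.conditionB.mem_wienerAlgebra hd hC0 hAC one_pos le_rfl (by linarith)
    · exact h.mem_wienerAlgebra hd hC0 hAC hp1
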